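/- Let $n\ge 3$, and let $\mathbb{R}^{n+1,1}$ be Lorentzian space with light-cone $\mathcal L$; the metric is extended complex bilinearly to $\mathbb{C}^{n+2}=(\mathbb{R}^{n+1,1})^{\mathbb C}$, and $u\wedge v$ is the endomorphism $w\mapsto (u,w)v-(v,w)u$. Let $\Sigma$ be a surface and $\Lambda:\Sigma\to\mathbb{P}(\mathcal L)\cong S^n$ a smooth immersion, regarded as a null line subbundle of the trivial bundle $\underline{\mathbb R}^{n+1,1}=\Sigma\times\mathbb{R}^{n+1,1}$, where $\Sigma$ is oriented and carries the complex structure determined by the orientation and the conformal structure induced by $\Lambda$ (so $\Sigma$ is a Riemann surface and $\Lambda$ is conformal). For a never-zero section $\sigma$ of $\Lambda$ let $\Lambda^{(1)}$ be the bundle spanned by $\sigma$ and $d\sigma(T\Sigma)$, and let $S=\Lambda^{(1)}\oplus\langle\Delta\sigma\rangle$ be the central sphere congruence, where $\Delta$ is the Laplacian of the metric $(d\sigma,d\sigma)$; neither depends on the choice of $\sigma$. Write $d=\mathcal D+\mathcal N$, where $\mathcal D$ is the sum of the connections induced by the trivial connection $d$ on $S$ and on $S^\perp$. Bundles and their complexifications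 are not distinguished. A pair $(\Lambda,q)$ is a *constrained Willmore surface* if $q$ is a smooth real one-form with values in $\Lambda\wedge\Lambda^{(1)}$ such that $d^{\mathcal D}q=0$ and $d^{\mathcal D}{*\mathcal N}=2[q\wedge *\mathcal N]$. For $\lambda\in\mathbb{C}\setminus\{0\}$ put $$d^\lambda_q=\mathcal D+\lambda\mathcal N^{1,0}+\lambda^{-1}\mathcal N^{0,1}+(\lambda^2-1)q^{1,0}+(\lambda^{-2}-1)q^{0,1}.$$ A *polynomial conserved quantity of type $d\in\mathbb{N}_0$* of $(\Lambda,q)$ is a Laurent polynomial $p(\lambda)=\sum_{k=-d}^d p_k\lambda^k$ with smooth sections $p_k$ of $\underline{\mathbb C}^{n+2}$ as coefficients such that $p_{-k}=\overline{p_k}$ for all $k$; $p_k\in\Gamma(S^\perp)$ if $k$ and $d$ have the same parity (in particular $p_d\in\Gamma(S^\perp)$), and $p_k\in\Gamma(S)$ otherwise; $p(1)\ne0$ (as a section); and $d^\lambda_q\,p(\lambda)=0$ for all $\lambda\in\mathbb{C}\setminus\{0\}$. **Theorem.** Let $(\Lambda,q)$ be a constrained Willmore surface and $p(\lambda)$ a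 polynomial conserved quantity of type $d$ of $(\Lambda,q)$. Let $\mu\in S^1$, let $\phi=\phi^\mu_q:(\underline{\mathbb R}^{n+1,1},d^\mu_q)\to(\underline{\mathbb R}^{n+1,1},d)$ be a smooth isometry of bundles preserving connections, that is, $d\circ\phi=\phi\circ d^\mu_q$, and put $q_\mu=\mu^2q^{1,0}+\mu^{-2}q^{0,1}$. Suppose that $p(\mu)\neq0$ (as a section). Then the spectral deformation $(\phi\Lambda,\mathrm{Ad}_\phi(q_\mu))$, where $\mathrm{Ad}_\phi(q_\mu)=\phi\circ q_\mu\circ\phi^{-1}$, is a constrained Willmore surface (with the same complex structure on $\Sigma$), and $$\phi\,p(\mu\lambda)=\sum_{k=-d}^d(\mu^k\phi\,p_k)\lambda^k$$ is a polynomial conserved quantity of type $d$ of it. -/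

import Mathlib

open scoped Manifold ContDiff InnerProductSpace

noncomputable section

namespace CWillmore

/-! ### The Lorentzian space and its complexification -/

/-- The real vector space underlying `ℝ^{n+1,1}`. -/
abbrev RV (n : ℕ) : Type := Fin (n + 2) → ℝ

/-- The complexification `ℂ^{n+2}` of `ℝ^{n+1,1}`; complex conjugation is `star`. -/
abbrev CV (n : ℕ) : Type := Fin (n + 2) → ℂ

/-- The form `x₀y₀ + ⋯ + xₙyₙ - xₙ₊₁yₙ₊₁`: over `ℝ` it is the Lorentzian inner product,
over `ℂ` its complex bilinear extension. -/
def lorentz (R : Type) [CommRing R] (n : ℕ) : LinearMap.BilinForm R (Fin (n + 2) → R) :=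
  Matrix.toBilin' (Matrix.diagonal fun i => if i = Fin.last (n + 1) then -1 else 1)

/-- The inclusion of `ℝ^{n+1,1}` in its complexification. -/
def toC {n : ℕ} (v : RV n) : CV n := fun i => (v i : ℂ)

/-- The complex linear extension of a real linear endomorphism. -/
def cx {n : ℕ} (T : RV n →ₗ[ℝ] RV n) : CV n →ₗ[ℂ] CV n :=
  Matrix.toLin' ((LinearMap.toMatrix' T).map Complex.ofReal)

/-- `u ∧ v` as a skew endomorphism, `(u ∧ v) w = (u, w) v - (v, w) u`. -/
def wedge {n : ℕ} (u v : CV n) : Module.End ℂ (CV n) :=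
  (lorentz ℂ n u).smulRight v - (lorentz ℂ n v).smulRight u

/-- The orthogonal complement of a subspace of `ℂ^{n+2}` for the complex bilinear form. -/
def perp {n : ℕ} (W : Submodule ℂ (CV n)) : Submodule ℂ (CV n) := (lorentz ℂ n).orthogonal W

open Classical in
/-- The orthogonal projection onto a non-degenerate subspace `W`, that is, the projection
with kernel `W^⊥` (the value `0` is used for degenerate `W` only). -/
def orthProj {n : ℕ} (W : Submodule ℂ (CV n)) : CV n →ₗ[ℂ] CV n :=
  if h : IsCompl W (perp W) then W.projection (perp W) h else 0

/-! ### Types of one-forms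

The complex structure of a tangent space enters as a real linear map `J`. -/

section Types

variable {T W : Type} [AddCommGroup T] [Module ℝ T] [AddCommGroup W] [Module ℂ W] [Module ℝ W]
  [IsScalarTower ℝ ℂ W] [SMulCommClass ℝ ℂ W]

/-- The `(1,0)`-part of a one-form with complex values. -/
def part10 (J : T →ₗ[ℝ] T) (α : T →ₗ[ℝ] W) : T →ₗ[ℝ] W :=
  (1 / 2 : ℂ) • (α - Complex.I • α.comp J)

/-- The `(0,1)`-part of a one-form with complex values. -/
def part01 (J : T →ₗ[ℝ] T) (α : T →ₗ[ℝ] W) : T →ₗ[ℝ] W :=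
  (1 / 2 : ℂ) • (α + Complex.I • α.comp J)

end Types

/-- Multiplication by `i` on `ℂ`. -/
def mulI : ℂ →ₗ[ℝ] ℂ := LinearMap.mulLeft ℝ Complex.I

/-! ### Surfaces in a holomorphic coordinate

Here `Λ` is a family of lines in `ℝ^{n+1,1}` depending on a complex coordinate `z = x + i y`.
All notions at `z` depend on the germ of `Λ` at `z` only. Tangent vectors are elements of `ℂ`,
with `∂/∂x = 1` and `∂/∂y = i`. -/

/-- `σ` is a smooth never-zero section of `Λ` near `z`. -/
def IsLiftAt {n : ℕ} (Λ : ℂ → Submodule ℝ (RV n)) (σ : ℂ → RV n) (z : ℂ) : Prop :=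
  ContDiffAt ℝ ∞ σ z ∧ ∀ᶠ y in nhds z, σ y ≠ 0 ∧ Λ y = Submodule.span ℝ {σ y}

/-- `Λ` is a conformal immersion of the open set `U` of `ℂ` in the projectivised light-cone:
a smooth null line bundle with a lift `σ` around each point for which
`g_σ = (dσ, dσ)` is a positive multiple of the Euclidean metric. -/
def IsConformalOn {n : ℕ} (U : Set ℂ) (Λ : ℂ → Submodule ℝ (RV n)) : Prop :=
  ∀ z ∈ U, (∀ u ∈ Λ z, lorentz ℝ n u u = 0) ∧
    ∃ σ, IsLiftAt Λ σ z ∧ ∃ r : ℝ, 0 < r ∧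
      ∀ v w : ℂ, lorentz ℝ n (fderiv ℝ σ z v) (fderiv ℝ σ z w) = r * ⟪v, w⟫_ℝ

/-- The Laplacian of `σ` with respect to the metric `g_σ`, which is
`(σ_x, σ_x) (dx² + dy²)` in a holomorphic coordinate. -/
def metricLaplacian {n : ℕ} (σ : ℂ → RV n) (z : ℂ) : RV n :=
  (lorentz ℝ n (fderiv ℝ σ z 1) (fderiv ℝ σ z 1))⁻¹ • Laplacian.laplacian σ z

/-- The complexification of `Λ^{(1)}`, spanned by `σ` and its first derivatives. -/
def firstBundle {n : ℕ} (Λ : ℂ → Submodule ℝ (RV n)) (z : ℂ) : Submodule ℂ (CV n) :=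
  Submodule.span ℂ {w | ∃ σ, IsLiftAt Λ σ z ∧
    (w = toC (σ z) ∨ ∃ v : ℂ, w = toC (fderiv ℝ σ z v))}

/-- The complexification of the central sphere congruence `S = Λ^{(1)} ⊕ ⟨Δσ⟩`. -/
def centralSphere {n : ℕ} (Λ : ℂ → Submodule ℝ (RV n)) (z : ℂ) : Submodule ℂ (CV n) :=
  firstBundle Λ z ⊔
    Submodule.span ℂ {w | ∃ σ, IsLiftAt Λ σ z ∧ w = toC (metricLaplacian σ z)}

/-- The orthogonal projection onto `S`. -/
def projS {n : ℕ} (Λ : ℂ → Submodule ℝ (RV n)) (z : ℂ) : CV n →ₗ[ℂ] CV n :=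
  orthProj (centralSphere Λ z)

/-- The orthogonal projection onto `S^⊥`. -/
def projPerp {n : ℕ} (Λ : ℂ → Submodule ℝ (RV n)) (z : ℂ) : CV n →ₗ[ℂ] CV n :=
  LinearMap.id - projS Λ z

/-- The derivative `dξ` of a section `ξ` of the trivial bundle. -/
def flatD {n : ℕ} (ξ : ℂ → CV n) (z : ℂ) : ℂ →ₗ[ℝ] CV n := (fderiv ℝ ξ z : ℂ →ₗ[ℝ] CV n)

/-- `𝒟ξ`, for `𝒟` the sum of the connections induced by `d` on `S` and on `S^⊥`. -/
def connD {n : ℕ} (Λ : ℂ → Submodule ℝ (RV n)) (ξ : ℂ → CV n) (z : ℂ) : ℂ →ₗ[ℝ] CV n :=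
  ((projS Λ z).restrictScalars ℝ).comp (flatD (fun y => projS Λ y (ξ y)) z) +
    ((projPerp Λ z).restrictScalars ℝ).comp (flatD (fun y => projPerp Λ y (ξ y)) z)

/-- `𝒩ξ`, for `𝒩 = d - 𝒟`. -/
def connN {n : ℕ} (Λ : ℂ → Submodule ℝ (RV n)) (ξ : ℂ → CV n) (z : ℂ) : ℂ →ₗ[ℝ] CV n :=
  flatD ξ z - connD Λ ξ z

/-- The `ℂ^{n+2}`-valued one-form `qξ`. -/
def formApply {n : ℕ} (q : ℂ → ℂ →ₗ[ℝ] Module.End ℂ (CV n)) (ξ : ℂ → CV n) (z : ℂ) :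
    ℂ →ₗ[ℝ] CV n :=
  ((LinearMap.applyₗ (ξ z) : Module.End ℂ (CV n) →ₗ[ℂ] CV n).restrictScalars ℝ).comp (q z)

/-- The connection
`d^l_q = 𝒟 + l 𝒩^{1,0} + l⁻¹ 𝒩^{0,1} + (l² - 1) q^{1,0} + (l⁻² - 1) q^{0,1}`. -/
def dSpec {n : ℕ} (Λ : ℂ → Submodule ℝ (RV n)) (q : ℂ → ℂ →ₗ[ℝ] Module.End ℂ (CV n)) (l : ℂ)
    (ξ : ℂ → CV n) (z : ℂ) : ℂ →ₗ[ℝ] CV n :=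
  connD Λ ξ z + l • part10 mulI (connN Λ ξ z) + l⁻¹ • part01 mulI (connN Λ ξ z) +
    (l ^ 2 - 1) • part10 mulI (formApply q ξ z) + ((l⁻¹) ^ 2 - 1) • part01 mulI (formApply q ξ z)

/-! Endomorphism-valued forms: `α z v w` is the value at the point `z` of `α` on the tangent
vector `v`, applied to the vector `w`. Two-forms are given by their value on `(∂/∂x, ∂/∂y)`. -/

/-- `(𝒟_v A) w = 𝒟_v (A w) - A (𝒟_v w)` for an endomorphism field `A`; here `w` is extended
as a constant section. -/
def covEnd {n : ℕ} (Λ : ℂ → Submodule ℝ (RV n)) (A : ℂ → CV n → CV n) (z v : ℂ) (w : CV n) :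
    CV n :=
  connD Λ (fun y => A y w) z v - A z (connD Λ (fun _ => w) z v)

/-- The exterior covariant derivative,
`(d^𝒟 α)(∂/∂x, ∂/∂y) = 𝒟_{∂/∂x} (α (∂/∂y)) - 𝒟_{∂/∂y} (α (∂/∂x))`. -/
def extD {n : ℕ} (Λ : ℂ → Submodule ℝ (RV n)) (α : ℂ → ℂ → CV n → CV n) (z : ℂ) (w : CV n) :
    CV n :=
  covEnd Λ (fun y => α y Complex.I) z 1 w - covEnd Λ (fun y => α y 1) z Complex.I w

/-- `[α ∧ β](X, Y) = [α X, β Y] - [α Y, β X]` for `X = ∂/∂x` and `Y = ∂/∂y`. -/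
def bracketWedge {n : ℕ} (α β : ℂ → ℂ → CV n → CV n) (z : ℂ) (w : CV n) : CV n :=
  (α z 1 (β z Complex.I w) - β z Complex.I (α z 1 w)) -
    (α z Complex.I (β z 1 w) - β z 1 (α z Complex.I w))

/-- The Hodge star on one-forms, `*α = -α ∘ J`, so that `*dx = dy`. -/
def hodge {n : ℕ} (α : ℂ → ℂ → CV n → CV n) : ℂ → ℂ → CV n → CV n :=
  fun z v w => -α z (Complex.I * v) w

/-- `𝒩` as an endomorphism-valued one-form. -/
def formN {n : ℕ} (Λ : ℂ → Submodule ℝ (RV n)) : ℂ → ℂ → CV n → CV n :=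
  fun z v w => connN Λ (fun _ => w) z v

/-- `q` as a function of the point, the tangent vector and the vector. -/
def formFun {n : ℕ} (q : ℂ → ℂ →ₗ[ℝ] Module.End ℂ (CV n)) : ℂ → ℂ → CV n → CV n :=
  fun z v w => q z v w

/-- On the open set `U` of `ℂ`, `Λ` is a conformal immersion and `q` is a smooth real one-form
with values in `Λ ∧ Λ^{(1)}` with `d^𝒟 q = 0` and `d^𝒟 *𝒩 = 2 [q ∧ *𝒩]`. -/
structure IsConstrainedWillmoreOn {n : ℕ} (U : Set ℂ) (Λ : ℂ → Submodule ℝ (RV n))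
    (q : ℂ → ℂ →ₗ[ℝ] Module.End ℂ (CV n)) : Prop where
  conformal : IsConformalOn U Λ
  smooth : ∀ (v : ℂ) (w : CV n), ContDiffOn ℝ ∞ (fun z => q z v w) U
  real : ∀ z ∈ U, ∀ (v : ℂ) (w : CV n), q z v (star w) = star (q z v w)
  values : ∀ z ∈ U, ∀ v : ℂ, q z v ∈ Submodule.span ℂ
    {A : Module.End ℂ (CV n) | ∃ u ∈ Λ z, ∃ w ∈ firstBundle Λ z, A = wedge (toC u) w}
  closed : ∀ z ∈ U, ∀ w : CV n, extD Λ (formFun q) z w = 0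
  willmore : ∀ z ∈ U, ∀ w : CV n,
    extD Λ (hodge (formN Λ)) z w = (2 : ℂ) • bracketWedge (formFun q) (hodge (formN Λ)) z w

/-! ### Surfaces over a Riemann surface

`M` is a Riemann surface, which is a surface with the complex structure given by an orientation
and a conformal structure. Local conditions are imposed in the holomorphic charts of `M`. -/

section Global

variable {n : ℕ} {M : Type*} [TopologicalSpace M] [ChartedSpace ℂ M]

/-- One-forms on `M` with values in the endomorphisms of `ℂ^{n+2}`. -/
abbrev EndForm (n : ℕ) (M : Type*) [TopologicalSpace M] [ChartedSpace ℂ M] :=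
  (x : M) → TangentSpace 𝓘(ℝ, ℂ) x →ₗ[ℝ] Module.End ℂ (CV n)

/-- The complex structure of the tangent space at `x`, which is multiplication by `i` in the
preferred chart at `x`. -/
def tangentJ (x : M) : TangentSpace 𝓘(ℝ, ℂ) x →ₗ[ℝ] TangentSpace 𝓘(ℝ, ℂ) x := mulI

/-- The pull-back of a one-form by the inverse of a chart. -/
def pullForm (q : EndForm n M) (e : OpenPartialHomeomorph M ℂ) :
    ℂ → ℂ →ₗ[ℝ] Module.End ℂ (CV n) :=
  fun z => (q (e.symm z)).comp (mfderiv 𝓘(ℝ, ℂ) 𝓘(ℝ, ℂ) e.symm z).toLinearMap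

/-- `(Λ, q)` is a constrained Willmore surface. -/
def IsConstrainedWillmore (Λ : M → Submodule ℝ (RV n)) (q : EndForm n M) : Prop :=
  ∀ e ∈ atlas ℂ M, IsConstrainedWillmoreOn e.target (fun z => Λ (e.symm z)) (pullForm q e)

/-- The value `p(l) = ∑_{k=-d}^d p_k l^k`, a section of the trivial bundle. -/
def evalL (d : ℕ) (p : ℤ → M → CV n) (l : ℂ) : M → CV n :=
  fun x => ∑ k ∈ Finset.Icc (-(d : ℤ)) d, l ^ k • p k x

/-- The Laurent polynomial `∑_{k=-d}^d p_k l^k` is a polynomial conserved quantity of type `d`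
of `(Λ, q)`. -/
structure IsPCQ (Λ : M → Submodule ℝ (RV n)) (q : EndForm n M) (d : ℕ) (p : ℤ → M → CV n) :
    Prop where
  degree : ∀ k : ℤ, (d : ℤ) < |k| → p k = 0
  smooth : ∀ k : ℤ, ContMDiff 𝓘(ℝ, ℂ) 𝓘(ℝ, CV n) ∞ (p k)
  real : ∀ (k : ℤ) (x : M), p (-k) x = star (p k x)
  top : ∀ e ∈ atlas ℂ M, ∀ z ∈ e.target,
    p d (e.symm z) ∈ perp (centralSphere (fun y => Λ (e.symm y)) z)
  same_parity : ∀ k : ℤ, Even (k - d) → ∀ e ∈ atlas ℂ M, ∀ z ∈ e.target,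
    p k (e.symm z) ∈ perp (centralSphere (fun y => Λ (e.symm y)) z)
  other_parity : ∀ k : ℤ, ¬ Even (k - d) → ∀ e ∈ atlas ℂ M, ∀ z ∈ e.target,
    p k (e.symm z) ∈ centralSphere (fun y => Λ (e.symm y)) z
  nonzero : evalL d p 1 ≠ 0
  parallel : ∀ l : ℂ, l ≠ 0 → ∀ e ∈ atlas ℂ M, ∀ z ∈ e.target,
    dSpec (fun y => Λ (e.symm y)) (pullForm q e) l (fun y => evalL d p l (e.symm y)) z = 0

/-- `φ` is a smooth isometry of the trivial bundle `ℝ^{n+1,1}`, and it intertwines the connection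
`d^l_q` with the trivial connection: `d (φ ξ) = φ (d^l_q ξ)` for all sections `ξ`. -/
structure IsConnectionIsometry (Λ : M → Submodule ℝ (RV n)) (q : EndForm n M) (l : ℂ)
    (φ : M → RV n ≃ₗ[ℝ] RV n) : Prop where
  smooth : ∀ w : RV n, ContMDiff 𝓘(ℝ, ℂ) 𝓘(ℝ, RV n) ∞ (fun x => φ x w)
  isometry : ∀ (x : M) (u v : RV n), lorentz ℝ n (φ x u) (φ x v) = lorentz ℝ n u v
  intertwines : ∀ ξ : M → RV n, ContMDiff 𝓘(ℝ, ℂ) 𝓘(ℝ, RV n) ∞ ξ →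
    ∀ e ∈ atlas ℂ M, ∀ z ∈ e.target, ∀ v : ℂ,
      toC (fderiv ℝ (fun y => φ (e.symm y) (ξ (e.symm y))) z v) =
        cx (φ (e.symm z)).toLinearMap
          (dSpec (fun y => Λ (e.symm y)) (pullForm q e) l (fun y => toC (ξ (e.symm y))) z v)

/-- The line bundle `φ Λ`. -/
def mapBundle (φ : M → RV n ≃ₗ[ℝ] RV n) (Λ : M → Submodule ℝ (RV n)) :
    M → Submodule ℝ (RV n) :=
  fun x => (Λ x).map (φ x).toLinearMap

/-- The form `q_m = m² q^{1,0} + m⁻² q^{0,1}`. -/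
def spectralForm (m : ℂ) (q : EndForm n M) : EndForm n M :=
  fun x => m ^ 2 • part10 (tangentJ x) (q x) + (m⁻¹) ^ 2 • part01 (tangentJ x) (q x)

/-- The form `Ad_φ q = φ ∘ q ∘ φ⁻¹`. -/
def adForm (φ : M → RV n ≃ₗ[ℝ] RV n) (q : EndForm n M) : EndForm n M :=
  fun x =>
    ((LinearMap.mulLeft ℝ (cx (φ x).toLinearMap : Module.End ℂ (CV n))).comp
      (LinearMap.mulRight ℝ (cx (φ x).symm.toLinearMap : Module.End ℂ (CV n)))).comp (q x)

/-- The coefficients `m^k φ p_k` of the Laurent polynomial `l ↦ φ p(m l)`. -/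
def spectralPoly (m : ℂ) (φ : M → RV n ≃ₗ[ℝ] RV n) (p : ℤ → M → CV n) : ℤ → M → CV n :=
  fun k x => m ^ k • cx (φ x).toLinearMap (p k x)

end Global

end CWillmore

end

open CWillmore

namespace CWillmore

/-! ### Linear algebra of the Lorentzian form -/

/-! The isometry `φ` gauges `d^μ_q` to the trivial connection, so `φΛ` seen with `d` is `Λ` seen
with `d^μ_q`. Both `𝒩` and `q` annihilate `Λ`, hence `d(φσ) = φ(dσ)` for a lift `σ`
(`fderiv_map_lift`), and `φσ` induces the same metric as `σ`. In the Laplacian the correction is a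
trace: the trace of `𝒩(dσ)` vanishes because `Δσ` lies in `S`, and `q` maps `Λ^{(1)}` to `Λ`. So
`Δ(φσ)` agrees with `φΔσ` modulo `φΛ` (`lapC_map`), and the central sphere congruence of `φΛ` is
`φS` (`centralSphere_map`).

Writing `P` for the projection onto `S`, one has `𝒩 = (1 - 2P) dP`. Conjugating `P` by `φ` gives `𝒩'
= φ(μ𝒩^{1,0} + μ⁻¹𝒩^{0,1})φ⁻¹` (`formNL_map`) and `𝒟' = φ(𝒟 + (μ² - 1)q^{1,0} + (μ⁻² -
1)q^{0,1})φ⁻¹` (`covL_map`). With `q' = Ad_φ(q_μ)` the connection of the deformed surface with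
parameter `λ` is therefore `φ ∘ d^{μλ}_q ∘ φ⁻¹` (`dSpec_map`), which makes `φp(μλ)` parallel. The
parity conditions hold because `φ` maps `S` and `S^⊥` to their new versions, the reality condition
because `|μ| = 1`, and the value at `1` is `φp(μ) ≠ 0`.

It remains to verify the constrained Willmore equations. The values of `q` commute, so `d^{𝒟'}q' =
0` reduces to `q` being closed and coclosed; coclosedness follows from closedness because `q` takes
values in `Λ ∧ Λ^{(1)}` (`covL_coclosed`). The equation for `*𝒩'` is a combination of the Codazzi
equation (`codazzi`) and the original equation for `*𝒩`, whose coefficients match by addition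
formulas (`cosL_sq_mul_add`, `cosL_sq_mul_sub`). -/

theorem lorentz_apply {R : Type} [CommRing R] {n : ℕ} (x y : Fin (n + 2) → R) :
    lorentz R n x y = ∑ i, (if i = Fin.last (n + 1) then -1 else 1) * (x i * y i) := by
  rw [lorentz, Matrix.toBilin'_apply]
  refine Finset.sum_congr rfl fun i _ => ?_
  rw [Finset.sum_eq_single i]
  · rw [Matrix.diagonal_apply_eq]; ring
  · intro j _ hj
    rw [Matrix.diagonal_apply_ne _ (Ne.symm hj)]; ring
  · simp

theorem lorentz_comm {R : Type} [CommRing R] {n : ℕ} (x y : Fin (n + 2) → R) :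
    lorentz R n x y = lorentz R n y x := by
  simp only [lorentz_apply, mul_comm]

/-- The inclusion of `ℝ^{n+1,1}` in `ℂ^{n+2}` as a continuous real linear map. -/
noncomputable def toCL (n : ℕ) : RV n →L[ℝ] CV n :=
  LinearMap.toContinuousLinearMap
    { toFun := toC
      map_add' := fun u v => by ext i; simp [toC]
      map_smul' := fun r v => by ext i; simp [toC] }

theorem toC_add {n : ℕ} (u v : RV n) : toC (u + v) = toC u + toC v := map_add (toCL n) u v

theorem toC_smul {n : ℕ} (r : ℝ) (v : RV n) : toC (r • v) = (r : ℂ) • toC v := by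
  ext i; simp [toC]

theorem toC_injective {n : ℕ} : Function.Injective (toC : RV n → CV n) := fun u v h => by
  ext i; exact Complex.ofReal_injective (congrFun h i)

theorem star_toC {n : ℕ} (v : RV n) : star (toC v) = toC v := by
  ext i; simp [toC]

theorem lorentz_toC {n : ℕ} (u v : RV n) :
    lorentz ℂ n (toC u) (toC v) = (lorentz ℝ n u v : ℂ) := by
  simp only [lorentz_apply, toC]
  push_cast
  refine Finset.sum_congr rfl fun i _ => ?_
  split_ifs <;> simp

theorem exists_toC_add_smul {n : ℕ} (w : CV n) : ∃ a b : RV n, w = toC a + Complex.I • toC b :=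
  ⟨fun i => (w i).re, fun i => (w i).im, by
    ext i
    simp only [toC, Pi.add_apply, Pi.smul_apply, smul_eq_mul]
    rw [mul_comm, Complex.re_add_im]⟩

theorem cx_toC {n : ℕ} (T : RV n →ₗ[ℝ] RV n) (v : RV n) : cx T (toC v) = toC (T v) := by
  have h : T v = (LinearMap.toMatrix' T).mulVec v := (LinearMap.toMatrix'_mulVec T v).symm
  rw [h]
  ext i
  simp [cx, toC, Matrix.mulVec, dotProduct]

/-- A complex linear map is determined by its values on real vectors. -/
theorem ext_toC {n : ℕ} {W : Type*} [AddCommGroup W] [Module ℂ W] {f g : CV n →ₗ[ℂ] W}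
    (h : ∀ v : RV n, f (toC v) = g (toC v)) : f = g := by
  refine LinearMap.ext fun w => ?_
  obtain ⟨a, b, rfl⟩ := exists_toC_add_smul w
  simp [h]

theorem cx_comp {n : ℕ} (S T : RV n →ₗ[ℝ] RV n) : cx (S ∘ₗ T) = cx S ∘ₗ cx T :=
  ext_toC fun v => by simp [cx_toC]

theorem cx_id {n : ℕ} : cx (LinearMap.id : RV n →ₗ[ℝ] RV n) = LinearMap.id :=
  ext_toC fun v => by simp [cx_toC]

theorem cx_apply_symm {n : ℕ} (φ : RV n ≃ₗ[ℝ] RV n) (w : CV n) :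
    cx φ.toLinearMap (cx φ.symm.toLinearMap w) = w := by
  rw [← LinearMap.comp_apply, ← cx_comp]
  simp [cx_id]

theorem cx_symm_apply {n : ℕ} (φ : RV n ≃ₗ[ℝ] RV n) (w : CV n) :
    cx φ.symm.toLinearMap (cx φ.toLinearMap w) = w := cx_apply_symm φ.symm w

theorem cx_star {n : ℕ} (T : RV n →ₗ[ℝ] RV n) (w : CV n) : cx T (star w) = star (cx T w) := by
  obtain ⟨a, b, rfl⟩ := exists_toC_add_smul w
  simp [star_add, star_smul, star_toC, cx_toC]

theorem lorentz_cx {n : ℕ} {T : RV n →ₗ[ℝ] RV n}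
    (hT : ∀ u v, lorentz ℝ n (T u) (T v) = lorentz ℝ n u v) (u v : CV n) :
    lorentz ℂ n (cx T u) (cx T v) = lorentz ℂ n u v := by
  obtain ⟨a, b, rfl⟩ := exists_toC_add_smul u
  obtain ⟨a', b', rfl⟩ := exists_toC_add_smul v
  simp only [map_add, map_smul, LinearMap.add_apply, LinearMap.smul_apply, cx_toC, lorentz_toC, hT]

theorem wedge_apply {n : ℕ} (u v w : CV n) :
    wedge u v w = lorentz ℂ n u w • v - lorentz ℂ n v w • u := rfl

theorem wedge_add {n : ℕ} (u v w : CV n) : wedge u (v + w) = wedge u v + wedge u w := by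
  refine LinearMap.ext fun x => ?_
  simp only [wedge_apply, LinearMap.add_apply, map_add, add_smul, smul_add]
  abel

theorem wedge_smul {n : ℕ} (c : ℂ) (u v : CV n) : wedge u (c • v) = c • wedge u v := by
  refine LinearMap.ext fun x => ?_
  simp only [wedge_apply, LinearMap.smul_apply, map_smul, smul_sub, smul_eq_mul, mul_smul]
  rw [smul_comm]

theorem wedge_smul_left {n : ℕ} (c : ℂ) (u v : CV n) : wedge (c • u) v = c • wedge u v := by
  refine LinearMap.ext fun x => ?_
  simp only [wedge_apply, LinearMap.smul_apply, map_smul, smul_sub, smul_eq_mul, mul_smul]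
  rw [smul_comm (lorentz ℂ n v x) c u]

theorem cx_wedge {n : ℕ} {φ : RV n ≃ₗ[ℝ] RV n}
    (hφ : ∀ u v, lorentz ℝ n (φ u) (φ v) = lorentz ℝ n u v) (u v : CV n) :
    cx φ.toLinearMap ∘ₗ wedge u v ∘ₗ cx φ.symm.toLinearMap =
      wedge (cx φ.toLinearMap u) (cx φ.toLinearMap v) := by
  refine LinearMap.ext fun w => ?_
  obtain ⟨w, rfl⟩ : ∃ w', w = cx φ.toLinearMap w' := ⟨_, (cx_apply_symm φ w).symm⟩
  simp only [LinearMap.comp_apply, cx_symm_apply, wedge_apply, map_sub, map_smul,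
    lorentz_cx (T := φ.toLinearMap) hφ]

theorem mem_perp {n : ℕ} {W : Submodule ℂ (CV n)} {w : CV n} :
    w ∈ perp W ↔ ∀ u ∈ W, lorentz ℂ n u w = 0 :=
  LinearMap.BilinForm.mem_orthogonal_iff

/-- The orthogonal projection is characterised by its image and its kernel. -/
theorem orthProj_eq {n : ℕ} {W : Submodule ℂ (CV n)} {P : CV n →ₗ[ℂ] CV n}
    (hP : ∀ w, P w ∈ W) (hid : ∀ w ∈ W, P w = w) (hsub : ∀ w, w - P w ∈ perp W) :
    orthProj W = P ∧ IsCompl W (perp W) := by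
  have hW : ∀ w ∈ perp W, P w = 0 := by
    intro w hw
    have hPw : P w ∈ perp W := by
      have := (perp W).sub_mem hw (hsub w)
      simpa using this
    -- Splitting `u` as `P u + (u - P u)` makes both pairings with `P w` vanish. Non-degeneracy of
    -- the form, tested on the standard basis, then gives `P w = 0`.
    have key : ∀ u, lorentz ℂ n u (P w) = 0 := by
      intro u
      have h1 := mem_perp.1 hPw (P u) (hP u)
      have h2 := mem_perp.1 (hsub u) (P w) (hP w)
      rw [lorentz_comm, map_sub, LinearMap.sub_apply, h1, sub_zero] at h2
      exact h2
    ext i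
    have := key (Pi.single i 1)
    rw [lorentz_apply, Finset.sum_eq_single i] at this
    · simp only [Pi.single_eq_same, one_mul] at this
      split_ifs at this <;> simpa using this
    · intro j _ hj
      simp [hj]
    · simp
  have hc : IsCompl W (perp W) := by
    constructor
    · rw [Submodule.disjoint_def]
      intro w h1 h2
      rw [← hid w h1, hW w h2]
    · rw [codisjoint_iff, eq_top_iff]
      intro w _
      have := Submodule.add_mem_sup (hP w) (hsub w)
      simpa using this
  refine ⟨?_, hc⟩
  rw [orthProj, dif_pos hc]
  refine LinearMap.ext fun w => ?_
  have h1 := Submodule.projection_apply_of_mem_left hc (hP w)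
  have h2 := Submodule.projection_apply_of_mem_right hc (hsub w)
  rw [map_sub, h1, sub_eq_zero] at h2
  exact h2

/-! ### Calculus of fields of vectors and endomorphisms -/

/-- The normed algebra of continuous endomorphisms of `ℂ^{n+2}`. -/
def EndC (n : ℕ) : Type := CV n →L[ℂ] CV n

namespace EndC

variable {n : ℕ}

noncomputable instance : NormedRing (EndC n) := inferInstanceAs (NormedRing (CV n →L[ℂ] CV n))

noncomputable instance : NormedAlgebra ℂ (EndC n) :=
  inferInstanceAs (NormedAlgebra ℂ (CV n →L[ℂ] CV n))

instance : CompleteSpace (EndC n) := inferInstanceAs (CompleteSpace (CV n →L[ℂ] CV n))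

instance : FunLike (EndC n) (CV n) (CV n) := inferInstanceAs (FunLike (CV n →L[ℂ] CV n) _ _)

instance : LinearMapClass (EndC n) ℂ (CV n) (CV n) :=
  inferInstanceAs (LinearMapClass (CV n →L[ℂ] CV n) ℂ (CV n) (CV n))

@[ext] theorem ext {A B : EndC n} (h : ∀ w, A w = B w) : A = B := ContinuousLinearMap.ext h

@[simp] theorem add_apply (A B : EndC n) (w : CV n) : (A + B) w = A w + B w := rfl
@[simp] theorem sub_apply (A B : EndC n) (w : CV n) : (A - B) w = A w - B w := rfl
@[simp] theorem neg_apply (A : EndC n) (w : CV n) : (-A) w = -A w := rfl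
@[simp] theorem zero_apply (w : CV n) : (0 : EndC n) w = 0 := rfl
@[simp] theorem one_apply (w : CV n) : (1 : EndC n) w = w := rfl
@[simp] theorem mul_apply (A B : EndC n) (w : CV n) : (A * B) w = A (B w) := rfl
@[simp] theorem smul_apply (c : ℂ) (A : EndC n) (w : CV n) : (c • A) w = c • A w := rfl

/-- An endomorphism as an element of the normed algebra `EndC n`. -/
noncomputable def ofLin (T : Module.End ℂ (CV n)) : EndC n :=
  (LinearMap.toContinuousLinearMap T : CV n →L[ℂ] CV n)

@[simp] theorem ofLin_apply (T : Module.End ℂ (CV n)) (w : CV n) : ofLin T w = T w := rfl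

end EndC

section Calculus

variable {n : ℕ} {X : Type*} [NormedAddCommGroup X] [NormedSpace ℝ X]

/-- The real Lorentzian form as a continuous bilinear map. -/
noncomputable def lorentzRL (n : ℕ) : RV n →L[ℝ] RV n →L[ℝ] ℝ :=
  LinearMap.toContinuousBilinearMap (lorentz ℝ n)

/-- The complex bilinear form as a continuous real bilinear map. -/
noncomputable def lorentzCL (n : ℕ) : CV n →L[ℝ] CV n →L[ℝ] ℂ :=
  (LinearMap.toContinuousBilinearMap (lorentz ℂ n)).bilinearRestrictScalars ℝ

theorem fderiv_lorentz_real {f g : X → RV n} {z : X} (hf : DifferentiableAt ℝ f z)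
    (hg : DifferentiableAt ℝ g z) (v : X) :
    fderiv ℝ (fun y => lorentz ℝ n (f y) (g y)) z v =
      lorentz ℝ n (f z) (fderiv ℝ g z v) + lorentz ℝ n (fderiv ℝ f z v) (g z) := by
  have := (lorentzRL n).fderiv_of_bilinear hf hg
  exact congrArg (fun T => T v) this

theorem fderiv_lorentz {f g : X → CV n} {z : X} (hf : DifferentiableAt ℝ f z)
    (hg : DifferentiableAt ℝ g z) (v : X) :
    fderiv ℝ (fun y => lorentz ℂ n (f y) (g y)) z v =
      lorentz ℂ n (f z) (fderiv ℝ g z v) + lorentz ℂ n (fderiv ℝ f z v) (g z) := by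
  have := (lorentzCL n).fderiv_of_bilinear hf hg
  exact congrArg (fun T => T v) this

theorem contDiffOn_lorentz_real {f g : X → RV n} {U : Set X} {k : ℕ∞ω} (hf : ContDiffOn ℝ k f U)
    (hg : ContDiffOn ℝ k g U) : ContDiffOn ℝ k (fun y => lorentz ℝ n (f y) (g y)) U :=
  (((lorentzRL n).contDiff.comp_contDiffOn hf).clm_apply hg :)

theorem contDiffOn_lorentz {f g : X → CV n} {U : Set X} {k : ℕ∞ω} (hf : ContDiffOn ℝ k f U)
    (hg : ContDiffOn ℝ k g U) : ContDiffOn ℝ k (fun y => lorentz ℂ n (f y) (g y)) U :=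
  (((lorentzCL n).contDiff.comp_contDiffOn hf).clm_apply hg :)

theorem contDiffOn_toC {f : X → RV n} {U : Set X} {k : ℕ∞ω} (hf : ContDiffOn ℝ k f U) :
    ContDiffOn ℝ k (fun y => toC (f y)) U :=
  (toCL n).contDiff.comp_contDiffOn hf

theorem fderiv_toC {f : X → RV n} {z : X} (hf : DifferentiableAt ℝ f z) (v : X) :
    fderiv ℝ (fun y => toC (f y)) z v = toC (fderiv ℝ f z v) := by
  have := ((toCL n).hasFDerivAt.comp z hf.hasFDerivAt).fderiv
  exact congrArg (fun T => T v) this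

/-- Application of an endomorphism to a vector as a continuous real bilinear map. -/
noncomputable def evalRL (n : ℕ) : EndC n →L[ℝ] CV n →L[ℝ] CV n :=
  (ContinuousLinearMap.id ℂ (CV n →L[ℂ] CV n)).bilinearRestrictScalars ℝ

theorem fderiv_apply {A : X → EndC n} {ξ : X → CV n} {z : X} (hA : DifferentiableAt ℝ A z)
    (hξ : DifferentiableAt ℝ ξ z) (v : X) :
    fderiv ℝ (fun y => A y (ξ y)) z v = A z (fderiv ℝ ξ z v) + fderiv ℝ A z v (ξ z) := by
  have := (evalRL n).fderiv_of_bilinear hA hξ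
  exact congrArg (fun T => T v) this

theorem differentiableAt_apply {A : X → EndC n} {ξ : X → CV n} {z : X}
    (hA : DifferentiableAt ℝ A z) (hξ : DifferentiableAt ℝ ξ z) :
    DifferentiableAt ℝ (fun y => A y (ξ y)) z :=
  ((evalRL n).hasFDerivAt_of_bilinear hA.hasFDerivAt hξ.hasFDerivAt).differentiableAt

theorem fderiv_apply_const {A : X → EndC n} {z : X} (hA : DifferentiableAt ℝ A z) (w : CV n)
    (v : X) : fderiv ℝ (fun y => A y w) z v = fderiv ℝ A z v w := by
  rw [fderiv_apply hA (differentiableAt_const w)]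
  simp

theorem contDiffOn_apply {A : X → EndC n} {ξ : X → CV n} {U : Set X} {k : ℕ∞ω}
    (hA : ContDiffOn ℝ k A U) (hξ : ContDiffOn ℝ k ξ U) :
    ContDiffOn ℝ k (fun y => A y (ξ y)) U :=
  (((evalRL n).contDiff.comp_contDiffOn hA).clm_apply hξ :)

theorem fderiv_mul_apply {A B : X → EndC n} {z : X} (hA : DifferentiableAt ℝ A z)
    (hB : DifferentiableAt ℝ B z) (v : X) :
    fderiv ℝ (fun y => A y * B y) z v = A z * fderiv ℝ B z v + fderiv ℝ A z v * B z := by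
  rw [fderiv_fun_mul' hA hB]; rfl

/-- The endomorphism with prescribed values on the standard basis. -/
noncomputable def ofColumns (n : ℕ) : (Fin (n + 2) → CV n) →L[ℝ] EndC n :=
  LinearMap.toContinuousLinearMap
    { toFun := fun c => EndC.ofLin (∑ j, (LinearMap.proj (R := ℂ) (φ := fun _ => ℂ) j).smulRight (c j))
      map_add' := fun c c' => by
        ext1 w; simp [Finset.sum_add_distrib]
      map_smul' := fun r c => by
        ext1 w
        change _ = (r : ℂ) • (∑ j, (LinearMap.proj (R := ℂ) (φ := fun _ => ℂ) j).smulRight (c j)) w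
        simp [Finset.smul_sum, smul_comm r] }

theorem ofColumns_single (A : EndC n) : ofColumns n (fun j => A (Pi.single j 1)) = A := by
  ext1 w
  change (∑ j, (LinearMap.proj (R := ℂ) (φ := fun _ => ℂ) j).smulRight (A (Pi.single j 1))) w = A w
  conv_rhs => rw [pi_eq_sum_univ' w]
  simp

/-- A field of endomorphisms is smooth if its values on fixed vectors are. -/
theorem contDiffOn_of_apply {A : X → EndC n} {U : Set X} {k : ℕ∞ω}
    (hA : ∀ w, ContDiffOn ℝ k (fun y => A y w) U) : ContDiffOn ℝ k A U := by
  have h : A = fun y => ofColumns n (fun j => A y (Pi.single j 1)) :=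
    funext fun y => (ofColumns_single (A y)).symm
  rw [h]
  exact (ofColumns n).contDiff.comp_contDiffOn (contDiffOn_pi.2 fun j => hA _)

end Calculus

/-! ### Normalised lifts -/

/-- The form is positive definite on the hyperplane where the last coordinate vanishes. This
coordinate therefore provides a canonical scale on null lines. -/
theorem last_ne_zero_of_null {n : ℕ} {v : RV n} (hv : v ≠ 0) (h : lorentz ℝ n v v = 0) :
    v (Fin.last (n + 1)) ≠ 0 := by
  intro h0
  apply hv
  rw [lorentz_apply] at h
  have h1 : ∀ i, (if i = Fin.last (n + 1) then (-1 : ℝ) else 1) * (v i * v i) = v i * v i := by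
    intro i
    split_ifs with hi
    · subst hi; simp [h0]
    · simp
  simp only [h1] at h
  rw [Finset.sum_eq_zero_iff_of_nonneg fun i _ => mul_self_nonneg _] at h
  ext i
  exact mul_self_eq_zero.1 (h i (Finset.mem_univ i))

theorem mem_of_eq_span_singleton {n : ℕ} {Λ : Submodule ℝ (RV n)} {v : RV n}
    (h : Λ = Submodule.span ℝ {v}) : v ∈ Λ := h ▸ Submodule.mem_span_singleton_self v

theorem lorentz_fderiv_self_eq_zero {n : ℕ} {σ : ℂ → RV n} {z : ℂ}
    (hσ : DifferentiableAt ℝ σ z) (hnull : ∀ᶠ y in nhds z, lorentz ℝ n (σ y) (σ y) = 0) (v : ℂ) :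
    lorentz ℝ n (σ z) (fderiv ℝ σ z v) = 0 := by
  have h1 := fderiv_lorentz_real hσ hσ v
  have h2 : (fun y => lorentz ℝ n (σ y) (σ y)) =ᶠ[nhds z] fun _ => (0 : ℝ) := hnull
  rw [h2.fderiv_eq, fderiv_fun_const, lorentz_comm (fderiv ℝ σ z v)] at h1
  simp only [Pi.zero_apply, _root_.zero_apply] at h1
  linarith

theorem fderiv_smul_apply {n : ℕ} {f : ℂ → ℝ} {σ : ℂ → RV n} {z : ℂ}
    (hf : DifferentiableAt ℝ f z) (hσ : DifferentiableAt ℝ σ z) (v : ℂ) :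
    fderiv ℝ (fun y => f y • σ y) z v = f z • fderiv ℝ σ z v + fderiv ℝ f z v • σ z := by
  rw [fderiv_fun_smul hf hσ]; rfl

/-- Rescaling a null section rescales the induced metric. -/
theorem lorentz_fderiv_smul {n : ℕ} {f : ℂ → ℝ} {σ : ℂ → RV n} {z : ℂ}
    (hf : DifferentiableAt ℝ f z) (hσ : DifferentiableAt ℝ σ z)
    (hnull : ∀ᶠ y in nhds z, lorentz ℝ n (σ y) (σ y) = 0) (v w : ℂ) :
    lorentz ℝ n (fderiv ℝ (fun y => f y • σ y) z v) (fderiv ℝ (fun y => f y • σ y) z w) =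
      f z ^ 2 * lorentz ℝ n (fderiv ℝ σ z v) (fderiv ℝ σ z w) := by
  have h0 := lorentz_fderiv_self_eq_zero hσ hnull
  have h1 : lorentz ℝ n (σ z) (σ z) = 0 := hnull.self_of_nhds
  have h2 : ∀ v, lorentz ℝ n (fderiv ℝ σ z v) (σ z) = 0 := fun v => by rw [lorentz_comm, h0]
  simp only [fderiv_smul_apply hf hσ, map_add, map_smul, LinearMap.add_apply, LinearMap.smul_apply,
    h0, h1, h2, smul_eq_mul]
  ring

/-- `σ` is a lift of `Λ` over `U` whose induced metric is the Euclidean metric. -/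
structure IsNormalLift {n : ℕ} (U : Set ℂ) (Λ : ℂ → Submodule ℝ (RV n)) (σ : ℂ → RV n) : Prop where
  smooth : ContDiffOn ℝ ∞ σ U
  ne_zero : ∀ z ∈ U, σ z ≠ 0
  span : ∀ z ∈ U, Λ z = Submodule.span ℝ {σ z}
  null : ∀ z ∈ U, lorentz ℝ n (σ z) (σ z) = 0
  metric : ∀ z ∈ U, ∀ v w : ℂ, lorentz ℝ n (fderiv ℝ σ z v) (fderiv ℝ σ z w) = ⟪v, w⟫_ℝ

theorem eq_smul_of_span_eq {n : ℕ} {a b : RV n}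
    (h : Submodule.span ℝ {a} = Submodule.span ℝ {b}) (hb : b (Fin.last (n + 1)) ≠ 0) :
    a = (a (Fin.last (n + 1)) / b (Fin.last (n + 1))) • b := by
  have : a ∈ Submodule.span ℝ {b} := h ▸ Submodule.mem_span_singleton_self a
  obtain ⟨c, rfl⟩ := Submodule.mem_span_singleton.1 this
  congr 1
  simp [hb]

theorem contDiffAt_coord {n : ℕ} {σ : ℂ → RV n} {z : ℂ} {k : ℕ∞ω} (h : ContDiffAt ℝ k σ z)
    (i : Fin (n + 2)) : ContDiffAt ℝ k (fun y => σ y i) z :=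
  contDiffAt_pi.1 h i

theorem contDiffOn_fderiv_apply {F : Type*} [NormedAddCommGroup F] [NormedSpace ℝ F] {f : ℂ → F}
    {U : Set ℂ} (hU : IsOpen U) (hf : ContDiffOn ℝ ∞ f U) (v : ℂ) :
    ContDiffOn ℝ ∞ (fun y => fderiv ℝ f y v) U :=
  (hf.fderiv_of_isOpen hU (m := ∞) (by simp)).clm_apply contDiffOn_const

theorem differentiableAt_of_contDiffOn {F : Type*} [NormedAddCommGroup F] [NormedSpace ℝ F]
    {f : ℂ → F} {U : Set ℂ} (hU : IsOpen U) (hf : ContDiffOn ℝ ∞ f U) {z : ℂ} (hz : z ∈ U) :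
    DifferentiableAt ℝ f z :=
  (hf.contDiffAt (hU.mem_nhds hz)).differentiableAt (by simp)

/-- A conformal immersion has a normalised lift. -/
theorem IsConformalOn.exists_normalLift {n : ℕ} {U : Set ℂ} (hU : IsOpen U)
    {Λ : ℂ → Submodule ℝ (RV n)} (h : IsConformalOn U Λ) : ∃ σ, IsNormalLift U Λ σ := by
  classical
  choose! hnull s hs r hr hm using h
  have hsp : ∀ z ∈ U, s z z ≠ 0 ∧ Λ z = Submodule.span ℝ {s z z} := fun z hz =>
    (hs z hz).2.self_of_nhds
  have hlast : ∀ z ∈ U, ∀ v : RV n, v ≠ 0 → Λ z = Submodule.span ℝ {v} →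
      v (Fin.last (n + 1)) ≠ 0 := fun z hz v hv hsp =>
    last_ne_zero_of_null hv (hnull z hz v (mem_of_eq_span_singleton hsp))
  -- The diagonal choice `s y y` need not be continuous in `y`. Scaling the last coordinate to `1`
  -- removes the choice, so `τ` agrees near each `z` with the smooth lift `f z • s z`.
  set τ : ℂ → RV n := fun y => (s y y (Fin.last (n + 1)))⁻¹ • s y y with hτ
  set f : ℂ → ℂ → ℝ := fun z y => (s z y (Fin.last (n + 1)))⁻¹ with hf
  have hev : ∀ z ∈ U, τ =ᶠ[nhds z] fun y => f z y • s z y := by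
    intro z hz
    filter_upwards [(hs z hz).2, hU.mem_nhds hz] with y hy hyU
    have h1 := hlast y hyU _ hy.1 hy.2
    have h2 := hlast y hyU _ (hsp y hyU).1 (hsp y hyU).2
    have h3 := eq_smul_of_span_eq ((hsp y hyU).2.symm.trans hy.2) h1
    simp only [hτ, hf]
    conv_lhs => rw [h3]
    rw [smul_smul]
    congr 1
    simp only [Pi.smul_apply, smul_eq_mul]
    field_simp
  have hfs : ∀ z ∈ U, ContDiffAt ℝ ∞ (f z) z := fun z hz =>
    (contDiffAt_coord (hs z hz).1 _).inv (hlast z hz _ (hsp z hz).1 (hsp z hz).2)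
  have hτs : ContDiffOn ℝ ∞ τ U := fun z hz =>
    (((hfs z hz).smul (hs z hz).1).congr_of_eventuallyEq (hev z hz)).contDiffWithinAt
  have hτ0 : ∀ z ∈ U, lorentz ℝ n (τ z) (τ z) = 0 := by
    intro z hz
    apply hnull z hz
    exact (Λ z).smul_mem _ (mem_of_eq_span_singleton (hsp z hz).2)
  have hsd : ∀ z ∈ U, DifferentiableAt ℝ (s z) z := fun z hz =>
    (hs z hz).1.differentiableAt (by simp)
  have hfd : ∀ z ∈ U, DifferentiableAt ℝ (f z) z := fun z hz =>
    (hfs z hz).differentiableAt (by simp)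
  have hτm : ∀ z ∈ U, ∀ v w, lorentz ℝ n (fderiv ℝ τ z v) (fderiv ℝ τ z w) =
      f z z ^ 2 * (r z * ⟪v, w⟫_ℝ) := by
    intro z hz v w
    rw [(hev z hz).fderiv_eq, lorentz_fderiv_smul (hfd z hz) (hsd z hz), hm z hz]
    filter_upwards [(hs z hz).2, hU.mem_nhds hz] with y hy hyU
    exact hnull y hyU _ (mem_of_eq_span_singleton hy.2)
  have hfne : ∀ z ∈ U, f z z ≠ 0 := fun z hz =>
    inv_ne_zero (hlast z hz _ (hsp z hz).1 (hsp z hz).2)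
  -- The conformal factor of `τ`; dividing `τ` by its square root makes the induced metric
  -- Euclidean.
  set g : ℂ → ℝ := fun y => lorentz ℝ n (fderiv ℝ τ y 1) (fderiv ℝ τ y 1) with hg
  have hgv : ∀ z ∈ U, g z = f z z ^ 2 * r z := fun z hz => by
    simp only [hg, hτm z hz]; simp
  have hgpos : ∀ z ∈ U, 0 < g z := fun z hz => by
    rw [hgv z hz]
    exact mul_pos (sq_pos_of_ne_zero (hfne z hz)) (hr z hz)
  have hgs : ContDiffOn ℝ ∞ g U :=
    contDiffOn_lorentz_real (contDiffOn_fderiv_apply hU hτs 1) (contDiffOn_fderiv_apply hU hτs 1)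
  have hks : ContDiffOn ℝ ∞ (fun y => (Real.sqrt (g y))⁻¹) U :=
    (hgs.sqrt fun z hz => (hgpos z hz).ne').inv fun z hz => (Real.sqrt_pos.2 (hgpos z hz)).ne'
  have hkne : ∀ z ∈ U, (Real.sqrt (g z))⁻¹ ≠ 0 := fun z hz =>
    inv_ne_zero (Real.sqrt_pos.2 (hgpos z hz)).ne'
  refine ⟨fun y => (Real.sqrt (g y))⁻¹ • τ y, hks.smul hτs, ?_, ?_, ?_, ?_⟩
  · intro z hz
    exact smul_ne_zero (hkne z hz) (smul_ne_zero (hfne z hz) (hsp z hz).1)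
  · intro z hz
    rw [(hsp z hz).2]
    simp only [hτ]
    rw [smul_smul]
    exact (Submodule.span_singleton_smul_eq
      (IsUnit.mk0 _ (mul_ne_zero (hkne z hz) (hfne z hz))) _).symm
  · intro z hz
    simp [hτ0 z hz]
  · intro z hz v w
    rw [lorentz_fderiv_smul (differentiableAt_of_contDiffOn hU hks hz)
      (differentiableAt_of_contDiffOn hU hτs hz), hτm z hz, inv_pow, Real.sq_sqrt (hgpos z hz).le,
      ← mul_assoc (f z z ^ 2), ← hgv z hz, ← mul_assoc, inv_mul_cancel₀ (hgpos z hz).ne', one_mul]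
    filter_upwards [hU.mem_nhds hz] with y hy using hτ0 y hy

/-! ### Second derivatives of a lift -/

/-- The second derivative of `σ` at `z` in the directions `v` and `w`. -/
noncomputable def deriv₂ {F : Type*} [NormedAddCommGroup F] [NormedSpace ℝ F] (σ : ℂ → F)
    (v w z : ℂ) : F :=
  fderiv ℝ (fun y => fderiv ℝ σ y v) z w

theorem deriv₂_eq {F : Type*} [NormedAddCommGroup F] [NormedSpace ℝ F] {σ : ℂ → F} {z : ℂ}
    (hσ : ContDiffAt ℝ ∞ σ z) (v w : ℂ) : deriv₂ σ v w z = fderiv ℝ (fderiv ℝ σ) z w v := by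
  have h : DifferentiableAt ℝ (fderiv ℝ σ) z :=
    (hσ.fderiv_right (m := ∞) (by simp)).differentiableAt (by simp)
  rw [deriv₂, fderiv_clm_apply h (differentiableAt_const v)]
  simp

theorem deriv₂_comm {F : Type*} [NormedAddCommGroup F] [NormedSpace ℝ F] {σ : ℂ → F} {z : ℂ}
    (hσ : ContDiffAt ℝ ∞ σ z) (v w : ℂ) : deriv₂ σ v w z = deriv₂ σ w v z := by
  rw [deriv₂_eq hσ, deriv₂_eq hσ]
  exact hσ.isSymmSndFDerivAt (by simpa using WithTop.coe_le_coe.2 (le_top : (2 : ℕ∞) ≤ ⊤)) w v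

theorem laplacian_eq_deriv₂ {n : ℕ} {σ : ℂ → RV n} {z : ℂ} (hσ : ContDiffAt ℝ ∞ σ z) :
    Laplacian.laplacian σ z = deriv₂ σ 1 1 z + deriv₂ σ Complex.I Complex.I z := by
  rw [InnerProductSpace.laplacian_eq_iteratedFDeriv_complexPlane, deriv₂_eq hσ, deriv₂_eq hσ]
  simp [iteratedFDeriv_two_apply]

theorem contDiffAt_eventually_differentiableAt {F : Type*} [NormedAddCommGroup F] [NormedSpace ℝ F]
    {σ : ℂ → F} {z : ℂ} (hσ : ContDiffAt ℝ ∞ σ z) : ∀ᶠ y in nhds z, DifferentiableAt ℝ σ y := by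
  have h : ContDiffAt ℝ 1 σ z := hσ.of_le (by simp)
  filter_upwards [h.eventually (by simp)] with y hy using hy.differentiableAt (by simp)

theorem deriv₂_smul {n : ℕ} {f : ℂ → ℝ} {σ : ℂ → RV n} {z : ℂ} (hf : ContDiffAt ℝ ∞ f z)
    (hσ : ContDiffAt ℝ ∞ σ z) (v w : ℂ) :
    deriv₂ (fun y => f y • σ y) v w z = f z • deriv₂ σ v w z + fderiv ℝ f z w • fderiv ℝ σ z v +
      (fderiv ℝ f z v • fderiv ℝ σ z w + deriv₂ f v w z • σ z) := by
  have hd : ∀ {F : Type} [NormedAddCommGroup F] [NormedSpace ℝ F] {g : ℂ → F},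
      ContDiffAt ℝ ∞ g z → DifferentiableAt ℝ (fun y => fderiv ℝ g y v) z := fun hg =>
    ((hg.fderiv_right (m := ∞) (by simp)).clm_apply contDiffAt_const).differentiableAt (by simp)
  have hev : (fun y => fderiv ℝ (fun y => f y • σ y) y v) =ᶠ[nhds z]
      fun y => f y • fderiv ℝ σ y v + fderiv ℝ f y v • σ y := by
    filter_upwards [contDiffAt_eventually_differentiableAt hf,
      contDiffAt_eventually_differentiableAt hσ] with y h1 h2 using fderiv_smul_apply h1 h2 v
  have hf1 := hf.differentiableAt (by simp)
  have hσ1 := hσ.differentiableAt (by simp)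
  rw [deriv₂, hev.fderiv_eq, fderiv_fun_add (hf1.fun_smul (hd hσ)) ((hd hf).fun_smul hσ1),
    _root_.add_apply, fderiv_smul_apply hf1 (hd hσ), fderiv_smul_apply (hd hf) hσ1]
  rfl

namespace IsNormalLift

variable {n : ℕ} {U : Set ℂ} {Λ : ℂ → Submodule ℝ (RV n)} {σ : ℂ → RV n}

theorem contDiffAt (h : IsNormalLift U Λ σ) (hU : IsOpen U) {z : ℂ} (hz : z ∈ U) :
    ContDiffAt ℝ ∞ σ z := h.smooth.contDiffAt (hU.mem_nhds hz)

theorem isLiftAt (h : IsNormalLift U Λ σ) (hU : IsOpen U) {z : ℂ} (hz : z ∈ U) :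
    IsLiftAt Λ σ z :=
  ⟨h.contDiffAt hU hz, by
    filter_upwards [hU.mem_nhds hz] with y hy using ⟨h.ne_zero y hy, h.span y hy⟩⟩

theorem lorentz_fderiv (h : IsNormalLift U Λ σ) (hU : IsOpen U) {z : ℂ} (hz : z ∈ U) (v : ℂ) :
    lorentz ℝ n (σ z) (fderiv ℝ σ z v) = 0 :=
  lorentz_fderiv_self_eq_zero (differentiableAt_of_contDiffOn hU h.smooth hz)
    (by filter_upwards [hU.mem_nhds hz] with y hy using h.null y hy) v

/-- Differentiate `(σ, ∂_vσ) = 0` in the direction `w`. -/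
theorem lorentz_deriv₂ (h : IsNormalLift U Λ σ) (hU : IsOpen U) {z : ℂ} (hz : z ∈ U) (v w : ℂ) :
    lorentz ℝ n (σ z) (deriv₂ σ v w z) = -⟪v, w⟫_ℝ := by
  have h1 := fderiv_lorentz_real (differentiableAt_of_contDiffOn hU h.smooth hz)
    (differentiableAt_of_contDiffOn hU (contDiffOn_fderiv_apply hU h.smooth v) hz) w
  have h2 : (fun y => lorentz ℝ n (σ y) (fderiv ℝ σ y v)) =ᶠ[nhds z] fun _ => (0 : ℝ) := by
    filter_upwards [hU.mem_nhds hz] with y hy using h.lorentz_fderiv hU hy v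
  rw [h2.fderiv_eq, fderiv_fun_const, h.metric z hz, real_inner_comm] at h1
  simp only [Pi.zero_apply, _root_.zero_apply] at h1
  rw [deriv₂]
  linarith

theorem lorentz_fderiv_deriv₂_add (h : IsNormalLift U Λ σ) (hU : IsOpen U) {z : ℂ} (hz : z ∈ U)
    (v w t : ℂ) : lorentz ℝ n (fderiv ℝ σ z v) (deriv₂ σ w t z) +
      lorentz ℝ n (fderiv ℝ σ z w) (deriv₂ σ v t z) = 0 := by
  have hd := fun v =>
    differentiableAt_of_contDiffOn hU (contDiffOn_fderiv_apply hU h.smooth v) hz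
  have h1 := fderiv_lorentz_real (hd v) (hd w) t
  have h2 : (fun y => lorentz ℝ n (fderiv ℝ σ y v) (fderiv ℝ σ y w)) =ᶠ[nhds z]
      fun _ => ⟪v, w⟫_ℝ := by
    filter_upwards [hU.mem_nhds hz] with y hy using h.metric y hy v w
  rw [h2.fderiv_eq, fderiv_fun_const, lorentz_comm _ (fderiv ℝ σ z w)] at h1
  simp only [Pi.zero_apply, _root_.zero_apply] at h1
  exact h1.symm

/-- The second derivatives are orthogonal to the tangent vectors. -/
theorem lorentz_fderiv_deriv₂ (h : IsNormalLift U Λ σ) (hU : IsOpen U) {z : ℂ} (hz : z ∈ U)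
    (v w t : ℂ) : lorentz ℝ n (fderiv ℝ σ z v) (deriv₂ σ w t z) = 0 := by
  -- As in the uniqueness of the Levi-Civita connection: the trilinear expression is skew in its
  -- first two arguments, because the metric is constant, and symmetric in its last two, hence zero.
  have h1 := h.lorentz_fderiv_deriv₂_add hU hz v w t
  have h2 := h.lorentz_fderiv_deriv₂_add hU hz w t v
  have h3 := h.lorentz_fderiv_deriv₂_add hU hz t v w
  have hc := deriv₂_comm (h.contDiffAt hU hz)
  rw [hc v t] at h1
  rw [hc t v, hc w v] at h2
  rw [hc t w] at h3
  rw [hc v t] at h2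
  linarith

/-- Any other lift is a smooth multiple of the normalised one. -/
theorem eventuallyEq_smul (h : IsNormalLift U Λ σ) (hU : IsOpen U) {z : ℂ} (hz : z ∈ U)
    {τ : ℂ → RV n} (hτ : IsLiftAt Λ τ z) :
    ∃ f : ℂ → ℝ, ContDiffAt ℝ ∞ f z ∧ τ =ᶠ[nhds z] fun y => f y • σ y := by
  have hl : ∀ y ∈ U, σ y (Fin.last (n + 1)) ≠ 0 := fun y hy =>
    last_ne_zero_of_null (h.ne_zero y hy) (h.null y hy)
  refine ⟨fun y => τ y (Fin.last (n + 1)) / σ y (Fin.last (n + 1)),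
    (contDiffAt_coord hτ.1 _).div (contDiffAt_coord (h.contDiffAt hU hz) _) (hl z hz), ?_⟩
  filter_upwards [hτ.2, hU.mem_nhds hz] with y hy hyU
  exact eq_smul_of_span_eq (hy.2.symm.trans (h.span y hyU)) (hl y hyU)

end IsNormalLift

/-! ### Frames of `Λ^{(1)}` and of the central sphere congruence -/

/-- The Laplacian of a lift, as a complex vector. -/
noncomputable def lapC {n : ℕ} (σ : ℂ → RV n) (z : ℂ) : CV n :=
  toC (deriv₂ σ 1 1 z + deriv₂ σ Complex.I Complex.I z)

namespace IsNormalLift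

variable {n : ℕ} {U : Set ℂ} {Λ : ℂ → Submodule ℝ (RV n)} {σ : ℂ → RV n}

theorem fderiv_eq_add (σ : ℂ → RV n) (z v : ℂ) :
    fderiv ℝ σ z v = v.re • fderiv ℝ σ z 1 + v.im • fderiv ℝ σ z Complex.I := by
  rw [← map_smul, ← map_smul, ← map_add]
  congr 1
  apply Complex.ext <;> simp

/-- The definition ranges over all lifts; each of them is `f • σ` near `z`, so its derivatives add
only multiples of `σ`. -/
theorem firstBundle_eq (h : IsNormalLift U Λ σ) (hU : IsOpen U) {z : ℂ} (hz : z ∈ U) :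
    firstBundle Λ z = Submodule.span ℂ
      {toC (σ z), toC (fderiv ℝ σ z 1), toC (fderiv ℝ σ z Complex.I)} := by
  have hl := h.isLiftAt hU hz
  apply le_antisymm
  · refine Submodule.span_le.2 ?_
    rintro w ⟨τ, hτ, hw⟩
    obtain ⟨f, hf, hev⟩ := h.eventuallyEq_smul hU hz hτ
    have m0 := Submodule.subset_span (R := ℂ) (show toC (σ z) ∈ ({toC (σ z),
      toC (fderiv ℝ σ z 1), toC (fderiv ℝ σ z Complex.I)} : Set (CV n)) by simp)
    have m1 := Submodule.subset_span (R := ℂ) (show toC (fderiv ℝ σ z 1) ∈ ({toC (σ z),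
      toC (fderiv ℝ σ z 1), toC (fderiv ℝ σ z Complex.I)} : Set (CV n)) by simp)
    have m2 := Submodule.subset_span (R := ℂ) (show toC (fderiv ℝ σ z Complex.I) ∈ ({toC (σ z),
      toC (fderiv ℝ σ z 1), toC (fderiv ℝ σ z Complex.I)} : Set (CV n)) by simp)
    rcases hw with rfl | ⟨v, rfl⟩
    · rw [hev.self_of_nhds, toC_smul]
      exact Submodule.smul_mem _ _ m0
    · rw [hev.fderiv_eq, fderiv_smul_apply (hf.differentiableAt (by simp))
        (hl.1.differentiableAt (by simp)), fderiv_eq_add σ z v]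
      simp only [toC_add, toC_smul, smul_add]
      exact Submodule.add_mem _ (Submodule.add_mem _
        (Submodule.smul_mem _ _ (Submodule.smul_mem _ _ m1))
        (Submodule.smul_mem _ _ (Submodule.smul_mem _ _ m2))) (Submodule.smul_mem _ _ m0)
  · refine Submodule.span_mono ?_
    rintro w (rfl | rfl | rfl)
    · exact ⟨σ, hl, Or.inl rfl⟩
    · exact ⟨σ, hl, Or.inr ⟨1, rfl⟩⟩
    · exact ⟨σ, hl, Or.inr ⟨Complex.I, rfl⟩⟩

theorem metricLaplacian_eq (h : IsNormalLift U Λ σ) (hU : IsOpen U) {z : ℂ} (hz : z ∈ U) :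
    toC (metricLaplacian σ z) = lapC σ z := by
  rw [metricLaplacian, h.metric z hz, laplacian_eq_deriv₂ (h.contDiffAt hU hz), lapC]
  simp

theorem centralSphere_eq (h : IsNormalLift U Λ σ) (hU : IsOpen U) {z : ℂ} (hz : z ∈ U) :
    centralSphere Λ z = Submodule.span ℂ
      {toC (σ z), toC (fderiv ℝ σ z 1), toC (fderiv ℝ σ z Complex.I), lapC σ z} := by
  have hl := h.isLiftAt hU hz
  set F : Set (CV n) :=
    {toC (σ z), toC (fderiv ℝ σ z 1), toC (fderiv ℝ σ z Complex.I), lapC σ z} with hF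
  have m0 : toC (σ z) ∈ Submodule.span ℂ F := Submodule.subset_span (by simp [hF])
  have m1 : toC (fderiv ℝ σ z 1) ∈ Submodule.span ℂ F := Submodule.subset_span (by simp [hF])
  have m2 : toC (fderiv ℝ σ z Complex.I) ∈ Submodule.span ℂ F :=
    Submodule.subset_span (by simp [hF])
  have m3 : lapC σ z ∈ Submodule.span ℂ F := Submodule.subset_span (by simp [hF])
  rw [centralSphere]
  apply le_antisymm
  · refine sup_le ?_ (Submodule.span_le.2 ?_)
    · rw [h.firstBundle_eq hU hz, Submodule.span_le]
      rintro w (rfl | rfl | rfl) <;> assumption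
    · rintro w ⟨τ, hτ, rfl⟩
      obtain ⟨f, hf, hev⟩ := h.eventuallyEq_smul hU hz hτ
      have hev' : ∀ v, (fun y => fderiv ℝ τ y v) =ᶠ[nhds z]
          fun y => fderiv ℝ (fun y => f y • σ y) y v := fun v => by
        filter_upwards [hev.fderiv (𝕜 := ℝ)] with y hy using by rw [hy]
      have h2 : ∀ v w, deriv₂ τ v w z = deriv₂ (fun y => f y • σ y) v w z := fun v w => by
        rw [deriv₂, (hev' v).fderiv_eq, deriv₂]
      rw [metricLaplacian, toC_smul, laplacian_eq_deriv₂ hτ.1, h2, h2, deriv₂_smul hf hl.1,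
        deriv₂_smul hf hl.1]
      refine Submodule.smul_mem _ _ ?_
      -- The product rule `Δ(fσ) = fΔσ + 2(f_x σ_x + f_y σ_y) + (Δf)σ`: changing the lift stays
      -- within the span of the frame.
      have key : toC (f z • deriv₂ σ 1 1 z + (fderiv ℝ f z 1 : ℝ) • fderiv ℝ σ z 1 +
          ((fderiv ℝ f z 1 : ℝ) • fderiv ℝ σ z 1 + (deriv₂ f 1 1 z : ℝ) • σ z) +
          (f z • deriv₂ σ Complex.I Complex.I z +
            (fderiv ℝ f z Complex.I : ℝ) • fderiv ℝ σ z Complex.I +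
          ((fderiv ℝ f z Complex.I : ℝ) • fderiv ℝ σ z Complex.I +
            (deriv₂ f Complex.I Complex.I z : ℝ) • σ z))) =
          (f z : ℂ) • lapC σ z + (2 * ((fderiv ℝ f z 1 : ℝ) : ℂ)) • toC (fderiv ℝ σ z 1) +
          (2 * ((fderiv ℝ f z Complex.I : ℝ) : ℂ)) • toC (fderiv ℝ σ z Complex.I) +
          (((deriv₂ f 1 1 z : ℝ) : ℂ) + ((deriv₂ f Complex.I Complex.I z : ℝ) : ℂ)) • toC (σ z) := by
        simp only [lapC, toC_add, toC_smul]
        match_scalars <;> ring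
      rw [key]
      exact Submodule.add_mem _ (Submodule.add_mem _ (Submodule.add_mem _
        (Submodule.smul_mem _ _ m3) (Submodule.smul_mem _ _ m1)) (Submodule.smul_mem _ _ m2))
        (Submodule.smul_mem _ _ m0)
  · rw [Submodule.span_le, h.firstBundle_eq hU hz]
    rintro w (rfl | rfl | rfl | rfl)
    · exact Submodule.mem_sup_left (Submodule.subset_span (by simp))
    · exact Submodule.mem_sup_left (Submodule.subset_span (by simp))
    · exact Submodule.mem_sup_left (Submodule.subset_span (by simp))
    · exact Submodule.mem_sup_right (Submodule.subset_span ⟨σ, hl, (h.metricLaplacian_eq hU hz).symm⟩)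

end IsNormalLift

/-! ### The projection onto the central sphere congruence -/

/-- The products of the vectors of the frame `σ, σ_x, σ_y, Δσ` of a normalised lift. -/
structure IsSphereFrame {n : ℕ} (s u v L : CV n) : Prop where
  ss : lorentz ℂ n s s = 0
  su : lorentz ℂ n s u = 0
  sv : lorentz ℂ n s v = 0
  sL : lorentz ℂ n s L = -2
  uu : lorentz ℂ n u u = 1
  uv : lorentz ℂ n u v = 0
  uL : lorentz ℂ n u L = 0
  vv : lorentz ℂ n v v = 1
  vL : lorentz ℂ n v L = 0

/-- The orthogonal projection onto the span of a frame. -/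
noncomputable def frameProj {n : ℕ} (s u v L : CV n) : CV n →ₗ[ℂ] CV n :=
  (lorentz ℂ n u).smulRight u + (lorentz ℂ n v).smulRight v -
    (1 / 2 : ℂ) • ((lorentz ℂ n L).smulRight s + (lorentz ℂ n s).smulRight L) -
    (lorentz ℂ n L L / 4) • (lorentz ℂ n s).smulRight s

/-- The coefficients are those of the inverse Gram matrix. On the span of `s` and `L` the Gram
matrix has entries `0`, `-2`, `-2`, `(L, L)`, with inverse entries `-(L, L)/4`, `-1/2`, `-1/2`, `0`;
no value of `(L, L)` is prescribed. -/
theorem frameProj_apply {n : ℕ} (s u v L w : CV n) :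
    frameProj s u v L w = lorentz ℂ n u w • u + lorentz ℂ n v w • v -
      (1 / 2 : ℂ) • (lorentz ℂ n L w • s + lorentz ℂ n s w • L) -
      (lorentz ℂ n L L / 4) • lorentz ℂ n s w • s := rfl

namespace IsSphereFrame

variable {n : ℕ} {s u v L : CV n}

theorem us (h : IsSphereFrame s u v L) : lorentz ℂ n u s = 0 := by rw [lorentz_comm, h.su]
theorem vs (h : IsSphereFrame s u v L) : lorentz ℂ n v s = 0 := by rw [lorentz_comm, h.sv]
theorem Ls (h : IsSphereFrame s u v L) : lorentz ℂ n L s = -2 := by rw [lorentz_comm, h.sL]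
theorem vu (h : IsSphereFrame s u v L) : lorentz ℂ n v u = 0 := by rw [lorentz_comm, h.uv]
theorem Lu (h : IsSphereFrame s u v L) : lorentz ℂ n L u = 0 := by rw [lorentz_comm, h.uL]
theorem Lv (h : IsSphereFrame s u v L) : lorentz ℂ n L v = 0 := by rw [lorentz_comm, h.vL]

theorem frameProj_s (h : IsSphereFrame s u v L) : frameProj s u v L s = s := by
  rw [frameProj_apply, h.us, h.vs, h.Ls, h.ss]; module

theorem frameProj_u (h : IsSphereFrame s u v L) : frameProj s u v L u = u := by
  rw [frameProj_apply, h.uu, h.vu, h.Lu, h.su]; module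

theorem frameProj_v (h : IsSphereFrame s u v L) : frameProj s u v L v = v := by
  rw [frameProj_apply, h.uv, h.vv, h.Lv, h.sv]; module

theorem frameProj_L (h : IsSphereFrame s u v L) : frameProj s u v L L = L := by
  rw [frameProj_apply, h.uL, h.vL, h.sL]; module

theorem frameProj_mem (s u v L w : CV n) :
    frameProj s u v L w ∈ Submodule.span ℂ {s, u, v, L} := by
  have m0 : s ∈ Submodule.span ℂ {s, u, v, L} := Submodule.subset_span (by simp)
  have m1 : u ∈ Submodule.span ℂ {s, u, v, L} := Submodule.subset_span (by simp)
  have m2 : v ∈ Submodule.span ℂ {s, u, v, L} := Submodule.subset_span (by simp)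
  have m3 : L ∈ Submodule.span ℂ {s, u, v, L} := Submodule.subset_span (by simp)
  rw [frameProj_apply]
  exact Submodule.sub_mem _ (Submodule.sub_mem _ (Submodule.add_mem _ (Submodule.smul_mem _ _ m1)
    (Submodule.smul_mem _ _ m2)) (Submodule.smul_mem _ _ (Submodule.add_mem _
    (Submodule.smul_mem _ _ m0) (Submodule.smul_mem _ _ m3))))
    (Submodule.smul_mem _ _ (Submodule.smul_mem _ _ m0))

theorem orthProj_eq (h : IsSphereFrame s u v L) :
    orthProj (Submodule.span ℂ {s, u, v, L}) = frameProj s u v L ∧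
      IsCompl (Submodule.span ℂ {s, u, v, L}) (perp (Submodule.span ℂ {s, u, v, L})) := by
  refine CWillmore.orthProj_eq (frameProj_mem s u v L) ?_ ?_
  · intro w hw
    induction hw using Submodule.span_induction with
    | mem x hx =>
      rcases hx with rfl | rfl | rfl | rfl
      exacts [h.frameProj_s, h.frameProj_u, h.frameProj_v, h.frameProj_L]
    | zero => simp
    | add x y _ _ hx hy => rw [map_add, hx, hy]
    | smul c x _ hx => rw [map_smul, hx]
  · intro w
    rw [mem_perp]
    intro x hx
    induction hx using Submodule.span_induction with
    | mem x hx =>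
      rcases hx with rfl | rfl | rfl | rfl <;>
      simp only [frameProj_apply, map_sub, map_add, map_smul, smul_eq_mul, h.ss, h.su, h.sv, h.sL,
        h.uu, h.uv, h.uL, h.vv, h.vL, h.us, h.vs, h.Ls, h.vu, h.Lu, h.Lv] <;> ring
    | zero => simp
    | add x y _ _ hx hy => rw [map_add, LinearMap.add_apply, hx, hy, add_zero]
    | smul c x _ hx => rw [map_smul, LinearMap.smul_apply, hx, smul_zero]

end IsSphereFrame

/-- The formula for `frameProj` is symmetric in its vector pairs, so no relation between the frame
vectors is needed. -/
theorem lorentz_frameProj {n : ℕ} (s u v L w x : CV n) :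
    lorentz ℂ n (frameProj s u v L w) x = lorentz ℂ n w (frameProj s u v L x) := by
  simp only [frameProj_apply, map_sub, map_add, map_smul, smul_eq_mul, LinearMap.add_apply,
    LinearMap.sub_apply, LinearMap.smul_apply]
  rw [lorentz_comm w u, lorentz_comm w v, lorentz_comm w s, lorentz_comm w L]
  ring

namespace IsNormalLift

variable {n : ℕ} {U : Set ℂ} {Λ : ℂ → Submodule ℝ (RV n)} {σ : ℂ → RV n}

theorem isSphereFrame (h : IsNormalLift U Λ σ) (hU : IsOpen U) {z : ℂ} (hz : z ∈ U) :
    IsSphereFrame (toC (σ z)) (toC (fderiv ℝ σ z 1)) (toC (fderiv ℝ σ z Complex.I)) (lapC σ z) where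
  ss := by rw [lorentz_toC, h.null z hz]; simp
  su := by rw [lorentz_toC, h.lorentz_fderiv hU hz]; simp
  sv := by rw [lorentz_toC, h.lorentz_fderiv hU hz]; simp
  sL := by
    rw [lapC, lorentz_toC, map_add, h.lorentz_deriv₂ hU hz, h.lorentz_deriv₂ hU hz]
    simp; norm_num
  uu := by rw [lorentz_toC, h.metric z hz]; simp
  uv := by rw [lorentz_toC, h.metric z hz]; simp
  uL := by
    rw [lapC, lorentz_toC, map_add, h.lorentz_fderiv_deriv₂ hU hz, h.lorentz_fderiv_deriv₂ hU hz]
    simp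
  vv := by rw [lorentz_toC, h.metric z hz]; simp
  vL := by
    rw [lapC, lorentz_toC, map_add, h.lorentz_fderiv_deriv₂ hU hz, h.lorentz_fderiv_deriv₂ hU hz]
    simp

theorem projS_eq (h : IsNormalLift U Λ σ) (hU : IsOpen U) {z : ℂ} (hz : z ∈ U) :
    projS Λ z = frameProj (toC (σ z)) (toC (fderiv ℝ σ z 1)) (toC (fderiv ℝ σ z Complex.I))
      (lapC σ z) := by
  rw [projS, h.centralSphere_eq hU hz, (h.isSphereFrame hU hz).orthProj_eq.1]

theorem contDiffOn_deriv (h : IsNormalLift U Λ σ) (hU : IsOpen U) (v : ℂ) :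
    ContDiffOn ℝ ∞ (fun y => toC (fderiv ℝ σ y v)) U :=
  contDiffOn_toC (contDiffOn_fderiv_apply hU h.smooth v)

theorem contDiffOn_lapC (h : IsNormalLift U Λ σ) (hU : IsOpen U) :
    ContDiffOn ℝ ∞ (lapC σ) U :=
  contDiffOn_toC ((contDiffOn_fderiv_apply hU (contDiffOn_fderiv_apply hU h.smooth 1) 1).add
    (contDiffOn_fderiv_apply hU (contDiffOn_fderiv_apply hU h.smooth Complex.I) Complex.I))

end IsNormalLift

/-- The projection onto `S` as a field of continuous endomorphisms. -/
noncomputable def projL {n : ℕ} (Λ : ℂ → Submodule ℝ (RV n)) (z : ℂ) : EndC n :=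
  EndC.ofLin (projS Λ z)

@[simp] theorem projL_apply {n : ℕ} (Λ : ℂ → Submodule ℝ (RV n)) (z : ℂ) (w : CV n) :
    projL Λ z w = projS Λ z w := rfl

/-- The form `𝒩` as a field of continuous endomorphisms, `𝒩_v = (1 - 2 P) ∂_v P` for the
projection `P` onto `S`. -/
noncomputable def formNL {n : ℕ} (Λ : ℂ → Submodule ℝ (RV n)) (v z : ℂ) : EndC n :=
  (1 - (2 : ℂ) • projL Λ z) * fderiv ℝ (projL Λ) z v

/-- `Λ` is a conformal immersion of the open set `U`; the data of its central sphere congruence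
are then smooth. -/
structure IsSurface {n : ℕ} (U : Set ℂ) (Λ : ℂ → Submodule ℝ (RV n)) : Prop where
  isOpen : IsOpen U
  exists_lift : ∃ σ, IsNormalLift U Λ σ

namespace IsSurface

variable {n : ℕ} {U : Set ℂ} {Λ : ℂ → Submodule ℝ (RV n)}

/-- Smoothness is read off from the explicit projection formula in the frame of a normalised lift.
-/
theorem contDiffOn_projL (h : IsSurface U Λ) : ContDiffOn ℝ ∞ (projL Λ) U := by
  obtain ⟨hU, σ, hσ⟩ := h
  refine contDiffOn_of_apply fun w => ?_
  have hs := contDiffOn_toC hσ.smooth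
  have hu := hσ.contDiffOn_deriv hU 1
  have hv := hσ.contDiffOn_deriv hU Complex.I
  have hL := hσ.contDiffOn_lapC hU
  have hw : ContDiffOn ℝ ∞ (fun _ : ℂ => w) U := contDiffOn_const
  refine ContDiffOn.congr (f := fun y => frameProj (toC (σ y)) (toC (fderiv ℝ σ y 1))
    (toC (fderiv ℝ σ y Complex.I)) (lapC σ y) w) ?_ fun y hy => by
      rw [projL_apply, hσ.projS_eq hU hy]
  simp only [frameProj_apply]
  exact ((((contDiffOn_lorentz hu hw).smul hu).add ((contDiffOn_lorentz hv hw).smul hv)).sub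
    ((contDiffOn_const (c := (1 / 2 : ℂ))).smul (((contDiffOn_lorentz hL hw).smul hs).add
      ((contDiffOn_lorentz hs hw).smul hL)))).sub
    (((contDiffOn_lorentz hL hL).div_const 4).smul ((contDiffOn_lorentz hs hw).smul hs))

theorem differentiableAt_projL (h : IsSurface U Λ) {z : ℂ} (hz : z ∈ U) :
    DifferentiableAt ℝ (projL Λ) z :=
  differentiableAt_of_contDiffOn h.isOpen h.contDiffOn_projL hz

theorem isCompl (h : IsSurface U Λ) {z : ℂ} (hz : z ∈ U) :
    IsCompl (centralSphere Λ z) (perp (centralSphere Λ z)) := by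
  obtain ⟨hU, σ, hσ⟩ := h
  rw [hσ.centralSphere_eq hU hz]
  exact (hσ.isSphereFrame hU hz).orthProj_eq.2

theorem projS_eq_projection (h : IsSurface U Λ) {z : ℂ} (hz : z ∈ U) :
    projS Λ z = (centralSphere Λ z).projection (perp (centralSphere Λ z)) (h.isCompl hz) := by
  rw [projS, orthProj, dif_pos (h.isCompl hz)]

theorem projL_of_mem (h : IsSurface U Λ) {z : ℂ} (hz : z ∈ U) {w : CV n}
    (hw : w ∈ centralSphere Λ z) : projL Λ z w = w := by
  rw [projL_apply, h.projS_eq_projection hz, Submodule.projection_apply_of_mem_left _ hw]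

theorem projL_mem (h : IsSurface U Λ) {z : ℂ} (hz : z ∈ U) (w : CV n) :
    projL Λ z w ∈ centralSphere Λ z := by
  rw [projL_apply, h.projS_eq_projection hz]
  exact Submodule.projection_apply_mem _ _

theorem lorentz_projL (h : IsSurface U Λ) {z : ℂ} (hz : z ∈ U) (w x : CV n) :
    lorentz ℂ n (projL Λ z w) x = lorentz ℂ n w (projL Λ z x) := by
  obtain ⟨hU, σ, hσ⟩ := h
  simp only [projL_apply, hσ.projS_eq hU hz, lorentz_frameProj]

theorem projL_mul_self (h : IsSurface U Λ) {z : ℂ} (hz : z ∈ U) :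
    projL Λ z * projL Λ z = projL Λ z :=
  EndC.ext fun w => h.projL_of_mem hz (h.projL_mem hz w)

/-- The derivative of the projection exchanges `S` and `S^⊥`. -/
theorem fderiv_projL (h : IsSurface U Λ) {z : ℂ} (hz : z ∈ U) (v : ℂ) :
    projL Λ z * fderiv ℝ (projL Λ) z v + fderiv ℝ (projL Λ) z v * projL Λ z =
      fderiv ℝ (projL Λ) z v := by
  have hd := h.differentiableAt_projL hz
  rw [← fderiv_mul_apply hd hd]
  have : (fun y => projL Λ y * projL Λ y) =ᶠ[nhds z] projL Λ := by
    filter_upwards [h.isOpen.mem_nhds hz] with y hy using h.projL_mul_self hy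
  rw [this.fderiv_eq]

theorem lorentz_fderiv_projL (h : IsSurface U Λ) {z : ℂ} (hz : z ∈ U) (v : ℂ) (w x : CV n) :
    lorentz ℂ n (fderiv ℝ (projL Λ) z v w) x = lorentz ℂ n w (fderiv ℝ (projL Λ) z v x) := by
  have hd := h.differentiableAt_projL hz
  have hd' := fun w : CV n => differentiableAt_apply hd (differentiableAt_const w)
  have h1 := fderiv_lorentz (hd' w) (differentiableAt_const x) v
  have h2 := fderiv_lorentz (differentiableAt_const w) (hd' x) v
  have hev : (fun y => lorentz ℂ n (projL Λ y w) x) =ᶠ[nhds z]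
      fun y => lorentz ℂ n w (projL Λ y x) := by
    filter_upwards [h.isOpen.mem_nhds hz] with y hy using h.lorentz_projL hy w x
  rw [hev.fderiv_eq, h2, fderiv_apply_const hd, fderiv_apply_const hd] at h1
  simpa using h1.symm

/-- Expanding `P d P + (1 - P) d (1 - P)` with `P² = P` leaves `d - (1 - 2P) dP`. Thus `𝒩` is of
order zero and given by `formNL`. -/
theorem connD_apply (h : IsSurface U Λ) {z : ℂ} (hz : z ∈ U) {ξ : ℂ → CV n}
    (hξ : DifferentiableAt ℝ ξ z) (v : ℂ) :
    connD Λ ξ z v = fderiv ℝ ξ z v - formNL Λ v z (ξ z) := by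
  have hd := h.differentiableAt_projL hz
  have h1 : fderiv ℝ (fun y => projS Λ y (ξ y)) z v =
      projL Λ z (fderiv ℝ ξ z v) + fderiv ℝ (projL Λ) z v (ξ z) := fderiv_apply hd hξ v
  have h2 : fderiv ℝ (fun y => projPerp Λ y (ξ y)) z v =
      fderiv ℝ ξ z v - (projL Λ z (fderiv ℝ ξ z v) + fderiv ℝ (projL Λ) z v (ξ z)) := by
    rw [← h1]
    have := fderiv_fun_sub hξ (differentiableAt_apply hd hξ)
    exact congrArg (fun T => T v) this
  have hP : ∀ w, projL Λ z (projL Λ z w) = projL Λ z w := fun w =>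
    congrArg (fun T : EndC n => T w) (h.projL_mul_self hz)
  change projL Λ z (fderiv ℝ (fun y => projS Λ y (ξ y)) z v) +
    (fderiv ℝ (fun y => projPerp Λ y (ξ y)) z v -
      projL Λ z (fderiv ℝ (fun y => projPerp Λ y (ξ y)) z v)) = _
  have h3 : formNL Λ v z (ξ z) = fderiv ℝ (projL Λ) z v (ξ z) -
      (2 : ℂ) • projL Λ z (fderiv ℝ (projL Λ) z v (ξ z)) := rfl
  rw [h1, h2, h3]
  simp only [map_add, map_sub, hP]
  module

theorem connN_apply (h : IsSurface U Λ) {z : ℂ} (hz : z ∈ U) {ξ : ℂ → CV n}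
    (hξ : DifferentiableAt ℝ ξ z) (v : ℂ) : connN Λ ξ z v = formNL Λ v z (ξ z) := by
  change fderiv ℝ ξ z v - connD Λ ξ z v = _
  rw [h.connD_apply hz hξ, sub_sub_cancel]

theorem formN_apply (h : IsSurface U Λ) {z : ℂ} (hz : z ∈ U) (v : ℂ) (w : CV n) :
    formN Λ z v w = formNL Λ v z w := h.connN_apply hz (differentiableAt_const w) v

theorem contDiffOn_formNL (h : IsSurface U Λ) (v : ℂ) : ContDiffOn ℝ ∞ (formNL Λ v) U := by
  have h1 : ContDiffOn ℝ ∞ (fun y => (2 : ℂ) • projL Λ y) U := h.contDiffOn_projL.const_smul (2 : ℂ)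
  have h2 : ContDiffOn ℝ ∞ (fun y => (1 : EndC n) - (2 : ℂ) • projL Λ y) U :=
    ContDiffOn.sub contDiffOn_const h1
  exact h2.mul (contDiffOn_fderiv_apply h.isOpen h.contDiffOn_projL v)

/-- `P` and `∂_vP` are self-adjoint and `1 - 2P` anticommutes with `∂_vP`, so their product is skew.
-/
theorem lorentz_formNL (h : IsSurface U Λ) {z : ℂ} (hz : z ∈ U) (v : ℂ) (w x : CV n) :
    lorentz ℂ n (formNL Λ v z w) x = -lorentz ℂ n w (formNL Λ v z x) := by
  have h3 : ∀ w, formNL Λ v z w = fderiv ℝ (projL Λ) z v w -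
      (2 : ℂ) • projL Λ z (fderiv ℝ (projL Λ) z v w) := fun _ => rfl
  have h4 := congrArg (fun T : EndC n => T x) (h.fderiv_projL hz v)
  have h5 : projL Λ z (fderiv ℝ (projL Λ) z v x) + fderiv ℝ (projL Λ) z v (projL Λ z x) =
    fderiv ℝ (projL Λ) z v x := h4
  rw [h3, h3, map_sub, LinearMap.sub_apply, map_smul, LinearMap.smul_apply, h.lorentz_projL hz,
    h.lorentz_fderiv_projL hz, h.lorentz_fderiv_projL hz, ← h5]
  simp only [map_sub, map_add, map_smul, smul_eq_mul]
  -- Applying `P` to `h5` yields `P (∂_vP) P = 0`, the relation that closes the computation.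
  have h6 := congrArg (fun T => lorentz ℂ n w T) (congrArg (projL Λ z) h5)
  have hP : ∀ w, projL Λ z (projL Λ z w) = projL Λ z w := fun w =>
    congrArg (fun T : EndC n => T w) (h.projL_mul_self hz)
  simp only [map_add, hP] at h6 ⊢
  linear_combination -2 * h6

end IsSurface

/-! ### The covariant derivative of fields of endomorphisms -/

/-- `𝒟_v A = ∂_v A - [𝒩_v, A]` for a field `A` of continuous endomorphisms. -/
noncomputable def covL {n : ℕ} (Λ : ℂ → Submodule ℝ (RV n)) (v : ℂ) (A : ℂ → EndC n) (z : ℂ) :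
    EndC n :=
  fderiv ℝ A z v - (formNL Λ v z * A z - A z * formNL Λ v z)

theorem connD_congr {n : ℕ} (Λ : ℂ → Submodule ℝ (RV n)) {ξ η : ℂ → CV n} {z : ℂ}
    (h : ξ =ᶠ[nhds z] η) : connD Λ ξ z = connD Λ η z := by
  have h1 : (fun y => projS Λ y (ξ y)) =ᶠ[nhds z] fun y => projS Λ y (η y) := by
    filter_upwards [h] with y hy using by rw [hy]
  have h2 : (fun y => projPerp Λ y (ξ y)) =ᶠ[nhds z] fun y => projPerp Λ y (η y) := by
    filter_upwards [h] with y hy using by rw [hy]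
  simp only [connD, flatD, h1.fderiv_eq, h2.fderiv_eq]

theorem formNL_neg {n : ℕ} (Λ : ℂ → Submodule ℝ (RV n)) (v z : ℂ) :
    formNL Λ (-v) z = -formNL Λ v z := by
  simp [formNL]

theorem covL_smul {n : ℕ} (Λ : ℂ → Submodule ℝ (RV n)) (v : ℂ) {A : ℂ → EndC n} {a : ℂ → ℂ}
    {z : ℂ} (ha : DifferentiableAt ℝ a z) (hA : DifferentiableAt ℝ A z) :
    covL Λ v (fun y => a y • A y) z = a z • covL Λ v A z + fderiv ℝ a z v • A z := by
  have h : fderiv ℝ (fun y => a y • A y) z v = a z • fderiv ℝ A z v + fderiv ℝ a z v • A z := by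
    rw [fderiv_fun_smul ha hA]; rfl
  simp only [covL, h, mul_smul_comm, smul_mul_assoc]
  module

theorem covL_const_smul {n : ℕ} (Λ : ℂ → Submodule ℝ (RV n)) (v : ℂ) {A : ℂ → EndC n} (c : ℂ)
    {z : ℂ} (hA : DifferentiableAt ℝ A z) :
    covL Λ v (fun y => c • A y) z = c • covL Λ v A z := by
  rw [covL_smul Λ v (differentiableAt_const c) hA]
  simp

theorem covL_add {n : ℕ} (Λ : ℂ → Submodule ℝ (RV n)) (v : ℂ) {A B : ℂ → EndC n}
    {z : ℂ} (hA : DifferentiableAt ℝ A z) (hB : DifferentiableAt ℝ B z) :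
    covL Λ v (fun y => A y + B y) z = covL Λ v A z + covL Λ v B z := by
  simp only [covL, fderiv_fun_add hA hB, _root_.add_apply, mul_add, add_mul]
  abel

theorem covL_neg {n : ℕ} (Λ : ℂ → Submodule ℝ (RV n)) (v : ℂ) (A : ℂ → EndC n) (z : ℂ) :
    covL Λ v (fun y => -A y) z = -covL Λ v A z := by
  simp only [covL, fderiv_fun_neg, _root_.neg_apply, mul_neg, neg_mul]
  abel

theorem covL_congr {n : ℕ} (Λ : ℂ → Submodule ℝ (RV n)) (v : ℂ) {A B : ℂ → EndC n} {z : ℂ}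
    (h : A =ᶠ[nhds z] B) : covL Λ v A z = covL Λ v B z := by
  simp only [covL, h.fderiv_eq, h.self_of_nhds]

namespace IsSurface

variable {n : ℕ} {U : Set ℂ} {Λ : ℂ → Submodule ℝ (RV n)}

/-- On a constant section `𝒟_v w = -𝒩_v w`, which supplies the term `A𝒩_v` of the commutator in
`covL`. From here on the calculus takes place in the normed algebra `EndC n`. -/
theorem covEnd_eq (h : IsSurface U Λ) {z : ℂ} (hz : z ∈ U) {A : ℂ → CV n → CV n}
    {B : ℂ → EndC n} (hAB : ∀ y ∈ U, ∀ w, A y w = B y w) (hB : DifferentiableAt ℝ B z)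
    (v : ℂ) (w : CV n) : covEnd Λ A z v w = covL Λ v B z w := by
  have hev : (fun y => A y w) =ᶠ[nhds z] fun y => B y w := by
    filter_upwards [h.isOpen.mem_nhds hz] with y hy using hAB y hy w
  rw [covEnd, connD_congr Λ hev,
    h.connD_apply hz (differentiableAt_apply hB (differentiableAt_const w)),
    h.connD_apply hz (differentiableAt_const w), hAB z hz, fderiv_apply_const hB]
  simp only [covL, fderiv_fun_const, Pi.zero_apply, _root_.zero_apply, zero_sub, map_neg,
    EndC.sub_apply, EndC.mul_apply]
  abel

theorem extD_eq (h : IsSurface U Λ) {z : ℂ} (hz : z ∈ U) {α : ℂ → ℂ → CV n → CV n}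
    {β : ℂ → ℂ → EndC n} (hαβ : ∀ v, ∀ y ∈ U, ∀ w, α y v w = β v y w)
    (hβ : ∀ v, DifferentiableAt ℝ (β v) z) (w : CV n) :
    extD Λ α z w = (covL Λ 1 (β Complex.I) z - covL Λ Complex.I (β 1) z) w := by
  rw [extD, h.covEnd_eq hz (hαβ _) (hβ _), h.covEnd_eq hz (hαβ _) (hβ _)]
  rfl

theorem differentiableAt_formNL (h : IsSurface U Λ) {z : ℂ} (hz : z ∈ U) (v : ℂ) :
    DifferentiableAt ℝ (formNL Λ v) z :=
  differentiableAt_of_contDiffOn h.isOpen (h.contDiffOn_formNL v) hz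

/-- The reflection `1 - 2P` anticommutes with the derivatives of `P`. -/
theorem reflection_mul_fderiv (h : IsSurface U Λ) {z : ℂ} (hz : z ∈ U) (v : ℂ) :
    (1 - (2 : ℂ) • projL Λ z) * fderiv ℝ (projL Λ) z v =
      -(fderiv ℝ (projL Λ) z v * (1 - (2 : ℂ) • projL Λ z)) := by
  have h1 := h.fderiv_projL hz v
  simp only [sub_mul, mul_sub, one_mul, mul_one, smul_mul_assoc, mul_smul_comm]
  rw [← sub_eq_zero] at h1
  rw [← sub_eq_zero]
  have h2 := congrArg (fun T : EndC n => (-2 : ℂ) • T) h1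
  simp only [smul_zero] at h2
  rw [← h2]
  module

theorem reflection_mul_reflection (h : IsSurface U Λ) {z : ℂ} (hz : z ∈ U) :
    (1 - (2 : ℂ) • projL Λ z) * (1 - (2 : ℂ) • projL Λ z) = 1 := by
  simp only [sub_mul, mul_sub, one_mul, mul_one, smul_mul_assoc, mul_smul_comm,
    h.projL_mul_self hz]
  module

/-- Moving one reflection `1 - 2P` past `∂_vP` costs a sign, and the two reflections then cancel. -/
theorem formNL_mul_formNL (h : IsSurface U Λ) {z : ℂ} (hz : z ∈ U) (v w : ℂ) :
    formNL Λ v z * formNL Λ w z = -(fderiv ℝ (projL Λ) z v * fderiv ℝ (projL Λ) z w) := by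
  rw [formNL, formNL, h.reflection_mul_fderiv hz v, neg_mul, mul_assoc, ← mul_assoc _ _
    (fderiv ℝ (projL Λ) z w), h.reflection_mul_reflection hz, one_mul]

theorem fderiv_formNL (h : IsSurface U Λ) {z : ℂ} (hz : z ∈ U) (v w : ℂ) :
    fderiv ℝ (formNL Λ v) z w = (1 - (2 : ℂ) • projL Λ z) * deriv₂ (projL Λ) v w z -
      (2 : ℂ) • (fderiv ℝ (projL Λ) z w * fderiv ℝ (projL Λ) z v) := by
  have hd := h.differentiableAt_projL hz
  have h1 : DifferentiableAt ℝ (fun y => (2 : ℂ) • projL Λ y) z := hd.const_smul (2 : ℂ)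
  have h2 : DifferentiableAt ℝ (fun y => (1 : EndC n) - (2 : ℂ) • projL Λ y) z :=
    (differentiableAt_const _).sub h1
  have h3 := differentiableAt_of_contDiffOn h.isOpen
    (contDiffOn_fderiv_apply h.isOpen h.contDiffOn_projL v) hz
  have h4 : fderiv ℝ (fun y => (1 : EndC n) - (2 : ℂ) • projL Λ y) z w =
      -((2 : ℂ) • fderiv ℝ (projL Λ) z w) := by
    rw [fderiv_fun_sub (differentiableAt_const _) h1, fderiv_fun_const, fderiv_fun_const_smul hd]
    simp
  have h5 := fderiv_mul_apply h2 h3 w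
  rw [h4] at h5
  rw [sub_eq_add_neg, ← smul_mul_assoc, ← neg_mul]
  exact h5

/-- The Codazzi equation `d^𝒟 𝒩 = 0`. -/
theorem codazzi (h : IsSurface U Λ) {z : ℂ} (hz : z ∈ U) (v w : ℂ) :
    covL Λ v (formNL Λ w) z - covL Λ w (formNL Λ v) z = 0 := by
  -- Second derivatives of `P` cancel by symmetry. What is left of `d𝒩` is `-2[∂_vP, ∂_wP]`, and
  -- `-2[𝒩_v, 𝒩_w] = 2[∂_vP, ∂_wP]` cancels it.
  have hc := deriv₂_comm (h.contDiffOn_projL.contDiffAt (h.isOpen.mem_nhds hz)) v w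
  simp only [covL, h.fderiv_formNL hz, h.formNL_mul_formNL hz, hc]
  module

/-- `𝒩` is the second fundamental form of `S`. -/
theorem formNL_apply_section (h : IsSurface U Λ) {z : ℂ} (hz : z ∈ U) {ξ : ℂ → CV n}
    (hξ : DifferentiableAt ℝ ξ z) (hS : ∀ y ∈ U, ξ y ∈ centralSphere Λ y) (v : ℂ) :
    formNL Λ v z (ξ z) = fderiv ℝ ξ z v - projL Λ z (fderiv ℝ ξ z v) := by
  have hd := h.differentiableAt_projL hz
  have hev : (fun y => projL Λ y (ξ y)) =ᶠ[nhds z] ξ := by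
    filter_upwards [h.isOpen.mem_nhds hz] with y hy using h.projL_of_mem hy (hS y hy)
  have h1 := fderiv_apply hd hξ v
  rw [hev.fderiv_eq] at h1
  have h2 : fderiv ℝ (projL Λ) z v (ξ z) = fderiv ℝ ξ z v - projL Λ z (fderiv ℝ ξ z v) :=
    eq_sub_of_add_eq' h1.symm
  have h3 : formNL Λ v z (ξ z) = fderiv ℝ (projL Λ) z v (ξ z) -
      (2 : ℂ) • projL Λ z (fderiv ℝ (projL Λ) z v (ξ z)) := rfl
  have hP : projL Λ z (projL Λ z (fderiv ℝ ξ z v)) = projL Λ z (fderiv ℝ ξ z v) :=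
    congrArg (fun T : EndC n => T _) (h.projL_mul_self hz)
  rw [h3, h2, map_sub, hP, sub_self, smul_zero, sub_zero]

end IsSurface

/-! ### The form `q` -/

/-- `u ∧ v` as a continuous endomorphism. -/
noncomputable def wedgeL {n : ℕ} (u v : CV n) : EndC n :=
  EndC.ofLin (wedge u v)

theorem wedgeL_apply {n : ℕ} (u v w : CV n) :
    wedgeL u v w = lorentz ℂ n u w • v - lorentz ℂ n v w • u := rfl

theorem wedgeL_self {n : ℕ} (u : CV n) : wedgeL u u = 0 := by
  ext1 w; simp [wedgeL_apply]

theorem wedgeL_swap {n : ℕ} (u v : CV n) : wedgeL u v = -wedgeL v u := by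
  ext1 w; simp [wedgeL_apply]

/-- Both products are `w ↦ -(a, b)(s, w) s`, which is symmetric in `a` and `b`. -/
theorem wedgeL_mul_wedgeL {n : ℕ} {s a b : CV n} (hs : lorentz ℂ n s s = 0)
    (ha : lorentz ℂ n s a = 0) (hb : lorentz ℂ n s b = 0) :
    wedgeL s a * wedgeL s b = wedgeL s b * wedgeL s a := by
  ext1 w
  rw [lorentz_comm] at ha hb
  simp only [EndC.mul_apply, wedgeL_apply, map_sub, map_smul, hs, lorentz_comm s a,
    lorentz_comm s b, ha, hb, lorentz_comm b a]
  module

section Wedge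

variable {n : ℕ} {U : Set ℂ} {Λ : ℂ → Submodule ℝ (RV n)}

theorem contDiffOn_wedgeL {a b : ℂ → CV n} (ha : ContDiffOn ℝ ∞ a U) (hb : ContDiffOn ℝ ∞ b U) :
    ContDiffOn ℝ ∞ (fun y => wedgeL (a y) (b y)) U :=
  contDiffOn_of_apply fun w =>
    ((contDiffOn_lorentz ha (contDiffOn_const (c := w))).smul hb).sub
      ((contDiffOn_lorentz hb (contDiffOn_const (c := w))).smul ha)

/-- A Leibniz rule for `𝒟`: skewness of `𝒩` turns `[𝒩_v, a ∧ b]` into `𝒩_v a ∧ b + a ∧ 𝒩_v b`. -/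
theorem covL_wedgeL (h : IsSurface U Λ) {a b : ℂ → CV n} (ha : ContDiffOn ℝ ∞ a U)
    (hb : ContDiffOn ℝ ∞ b U) {z : ℂ} (hz : z ∈ U) (v : ℂ) :
    covL Λ v (fun y => wedgeL (a y) (b y)) z =
      wedgeL (fderiv ℝ a z v - formNL Λ v z (a z)) (b z) +
        wedgeL (a z) (fderiv ℝ b z v - formNL Λ v z (b z)) := by
  have hda := differentiableAt_of_contDiffOn h.isOpen ha hz
  have hdb := differentiableAt_of_contDiffOn h.isOpen hb hz
  have hw := differentiableAt_of_contDiffOn h.isOpen (contDiffOn_wedgeL ha hb) hz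
  ext1 w
  have hl : ∀ {c : ℂ → CV n}, DifferentiableAt ℝ c z →
      DifferentiableAt ℝ (fun y => lorentz ℂ n (c y) w) z := fun hc =>
    ((lorentzCL n).hasFDerivAt_of_bilinear hc.hasFDerivAt
      (hasFDerivAt_const w z)).differentiableAt
  have hl' : ∀ {c : ℂ → CV n}, DifferentiableAt ℝ c z →
      fderiv ℝ (fun y => lorentz ℂ n (c y) w) z v = lorentz ℂ n (fderiv ℝ c z v) w := fun hc => by
    rw [fderiv_lorentz hc (differentiableAt_const w)]; simp
  have hs : ∀ {c d : ℂ → CV n}, DifferentiableAt ℝ c z → DifferentiableAt ℝ d z →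
      fderiv ℝ (fun y => lorentz ℂ n (c y) w • d y) z v =
        lorentz ℂ n (c z) w • fderiv ℝ d z v + lorentz ℂ n (fderiv ℝ c z v) w • d z := by
    intro c d hc hd
    rw [fderiv_fun_smul (hl hc) hd, ← hl' hc]; rfl
  have h1 : fderiv ℝ (fun y => wedgeL (a y) (b y)) z v w =
      lorentz ℂ n (a z) w • fderiv ℝ b z v + lorentz ℂ n (fderiv ℝ a z v) w • b z -
      (lorentz ℂ n (b z) w • fderiv ℝ a z v + lorentz ℂ n (fderiv ℝ b z v) w • a z) := by
    rw [← fderiv_apply_const hw, ← hs hda hdb, ← hs hdb hda]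
    simp only [wedgeL_apply]
    rw [fderiv_fun_sub ((hl hda).fun_smul hdb) ((hl hdb).fun_smul hda)]
    rfl
  have h2 : ∀ x, lorentz ℂ n (formNL Λ v z x) w = -lorentz ℂ n x (formNL Λ v z w) := fun x =>
    h.lorentz_formNL hz v x w
  simp only [covL, EndC.sub_apply, EndC.add_apply, EndC.mul_apply, h1,
    wedgeL_apply, map_sub, map_smul, LinearMap.sub_apply, h2]
  module

end Wedge

namespace IsNormalLift

variable {n : ℕ} {U : Set ℂ} {Λ : ℂ → Submodule ℝ (RV n)} {σ : ℂ → RV n}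

theorem isSurface (h : IsNormalLift U Λ σ) (hU : IsOpen U) : IsSurface U Λ := ⟨hU, σ, h⟩

theorem toC_mem (h : IsNormalLift U Λ σ) (hU : IsOpen U) {z : ℂ} (hz : z ∈ U) :
    toC (σ z) ∈ centralSphere Λ z := by
  rw [h.centralSphere_eq hU hz]; exact Submodule.subset_span (by simp)

theorem toC_fderiv_mem (h : IsNormalLift U Λ σ) (hU : IsOpen U) {z : ℂ} (hz : z ∈ U) (v : ℂ) :
    toC (fderiv ℝ σ z v) ∈ centralSphere Λ z := by
  rw [h.centralSphere_eq hU hz, fderiv_eq_add σ z v, toC_add, toC_smul, toC_smul]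
  exact Submodule.add_mem _ (Submodule.smul_mem _ _ (Submodule.subset_span (by simp)))
    (Submodule.smul_mem _ _ (Submodule.subset_span (by simp)))

theorem lapC_mem (h : IsNormalLift U Λ σ) (hU : IsOpen U) {z : ℂ} (hz : z ∈ U) :
    lapC σ z ∈ centralSphere Λ z := by
  rw [h.centralSphere_eq hU hz]; exact Submodule.subset_span (by simp)

theorem fderiv_toC_lift (h : IsNormalLift U Λ σ) (hU : IsOpen U) {z : ℂ} (hz : z ∈ U) (v : ℂ) :
    fderiv ℝ (fun y => toC (σ y)) z v = toC (fderiv ℝ σ z v) :=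
  fderiv_toC (differentiableAt_of_contDiffOn hU h.smooth hz) v

theorem fderiv_toC_fderiv (h : IsNormalLift U Λ σ) (hU : IsOpen U) {z : ℂ} (hz : z ∈ U) (v w : ℂ) :
    fderiv ℝ (fun y => toC (fderiv ℝ σ y v)) z w = toC (deriv₂ σ v w z) :=
  fderiv_toC (differentiableAt_of_contDiffOn hU (contDiffOn_fderiv_apply hU h.smooth v) hz) w

/-- Both `σ` and `dσ` are sections of `S`, so `dσ` has no component in `S^⊥`. -/
theorem formNL_lift (h : IsNormalLift U Λ σ) (hU : IsOpen U) {z : ℂ} (hz : z ∈ U) (v : ℂ) :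
    formNL Λ v z (toC (σ z)) = 0 := by
  rw [(h.isSurface hU).formNL_apply_section hz
    (differentiableAt_of_contDiffOn hU (contDiffOn_toC h.smooth) hz)
    (fun y hy => h.toC_mem hU hy), h.fderiv_toC_lift hU hz,
    (h.isSurface hU).projL_of_mem hz (h.toC_fderiv_mem hU hz v), sub_self]

theorem formNL_fderiv (h : IsNormalLift U Λ σ) (hU : IsOpen U) {z : ℂ} (hz : z ∈ U) (v w : ℂ) :
    formNL Λ w z (toC (fderiv ℝ σ z v)) =
      toC (deriv₂ σ v w z) - projL Λ z (toC (deriv₂ σ v w z)) := by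
  rw [(h.isSurface hU).formNL_apply_section (ξ := fun y => toC (fderiv ℝ σ y v)) hz
    (differentiableAt_of_contDiffOn hU (h.contDiffOn_deriv hU v) hz)
    (fun y hy => h.toC_fderiv_mem hU hy v), h.fderiv_toC_fderiv hU hz]

/-- The Gauss formula for a normalised lift. -/
theorem wedgeL_projL_deriv₂ (h : IsNormalLift U Λ σ) (hU : IsOpen U) {z : ℂ} (hz : z ∈ U)
    (v w : ℂ) : wedgeL (toC (σ z)) (projL Λ z (toC (deriv₂ σ v w z))) =
      ((⟪v, w⟫_ℝ / 2 : ℝ) : ℂ) • wedgeL (toC (σ z)) (lapC σ z) := by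
  have h1 : ∀ t, lorentz ℂ n (toC (fderiv ℝ σ z t)) (toC (deriv₂ σ v w z)) = 0 := fun t => by
    rw [lorentz_toC, h.lorentz_fderiv_deriv₂ hU hz, Complex.ofReal_zero]
  have h2 : lorentz ℂ n (toC (σ z)) (toC (deriv₂ σ v w z)) = -((⟪v, w⟫_ℝ : ℝ) : ℂ) := by
    rw [lorentz_toC, h.lorentz_deriv₂ hU hz, Complex.ofReal_neg]
  ext1 x
  -- The tangential components vanish and multiples of `σ` die in `σ ∧ ·`; only `-(σ, ∂_v∂_wσ)/2`
  -- times `Δσ` survives.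
  rw [projL_apply, h.projS_eq hU hz, frameProj_apply, h1, h1, h2]
  simp only [wedgeL_apply, map_sub, map_add, map_smul, LinearMap.sub_apply, LinearMap.add_apply,
    LinearMap.smul_apply, EndC.smul_apply, Complex.ofReal_div, Complex.ofReal_ofNat]
  module

/-- The covariant derivatives of `σ ∧ dσ`. -/
theorem covL_wedgeL_lift (h : IsNormalLift U Λ σ) (hU : IsOpen U) {z : ℂ} (hz : z ∈ U)
    (v w : ℂ) : covL Λ w (fun y => wedgeL (toC (σ y)) (toC (fderiv ℝ σ y v))) z =
      wedgeL (toC (fderiv ℝ σ z w)) (toC (fderiv ℝ σ z v)) +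
        ((⟪v, w⟫_ℝ / 2 : ℝ) : ℂ) • wedgeL (toC (σ z)) (lapC σ z) := by
  rw [covL_wedgeL (h.isSurface hU) (contDiffOn_toC h.smooth) (h.contDiffOn_deriv hU v) hz,
    h.formNL_lift hU hz, h.formNL_fderiv hU hz, h.fderiv_toC_lift hU hz,
    h.fderiv_toC_fderiv hU hz, sub_zero, sub_sub_cancel, h.wedgeL_projL_deriv₂ hU hz]

end IsNormalLift

/-- `q` as a field of continuous endomorphisms. -/
noncomputable def formL {n : ℕ} (q : ℂ → ℂ →ₗ[ℝ] Module.End ℂ (CV n)) (v z : ℂ) : EndC n :=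
  EndC.ofLin (q z v)

@[simp] theorem formL_apply {n : ℕ} (q : ℂ → ℂ →ₗ[ℝ] Module.End ℂ (CV n)) (v z : ℂ) (w : CV n) :
    formL q v z w = q z v w := rfl

theorem formL_neg {n : ℕ} (q : ℂ → ℂ →ₗ[ℝ] Module.End ℂ (CV n)) (v z : ℂ) :
    formL q (-v) z = -formL q v z := by
  ext1 w; simp

namespace IsConstrainedWillmoreOn

variable {n : ℕ} {U : Set ℂ} {Λ : ℂ → Submodule ℝ (RV n)} {σ : ℂ → RV n}
  {q : ℂ → ℂ →ₗ[ℝ] Module.End ℂ (CV n)}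

theorem contDiffOn_formL (h : IsConstrainedWillmoreOn U Λ q) (v : ℂ) :
    ContDiffOn ℝ ∞ (formL q v) U :=
  contDiffOn_of_apply (h.smooth v)

/-- Since `σ ∧ σ = 0`, only the two tangential directions of `Λ^{(1)}` contribute. -/
theorem formL_eq (h : IsConstrainedWillmoreOn U Λ q) (hU : IsOpen U) (hσ : IsNormalLift U Λ σ)
    {z : ℂ} (hz : z ∈ U) (v : ℂ) : ∃ a b : ℂ,
    formL q v z = a • wedgeL (toC (σ z)) (toC (fderiv ℝ σ z 1)) +
      b • wedgeL (toC (σ z)) (toC (fderiv ℝ σ z Complex.I)) := by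
  have h1 : Submodule.span ℂ {A : Module.End ℂ (CV n) | ∃ u ∈ Λ z, ∃ w ∈ firstBundle Λ z,
      A = wedge (toC u) w} ≤ Submodule.span ℂ {wedge (toC (σ z)) (toC (fderiv ℝ σ z 1)),
        wedge (toC (σ z)) (toC (fderiv ℝ σ z Complex.I))} := by
    rw [Submodule.span_le]
    rintro A ⟨u, hu, w, hw, rfl⟩
    rw [hσ.span z hz, Submodule.mem_span_singleton] at hu
    obtain ⟨r, rfl⟩ := hu
    rw [hσ.firstBundle_eq hU hz, Submodule.mem_span_triple] at hw
    obtain ⟨a, b, c, rfl⟩ := hw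
    have h0 : wedge (toC (σ z)) (toC (σ z)) = 0 := by
      refine LinearMap.ext fun x => ?_
      simp [wedge_apply]
    simp only [toC_smul, wedge_smul_left, wedge_add, wedge_smul, h0, smul_zero, zero_add]
    exact Submodule.mem_span_pair.2 ⟨r * b, r * c, by module⟩
  obtain ⟨a, b, hab⟩ := Submodule.mem_span_pair.1 (h1 (h.values z hz v))
  refine ⟨a, b, EndC.ext fun w => ?_⟩
  rw [formL_apply, ← hab]
  rfl

/-- The coefficient functions of `q` with respect to `σ ∧ σ_x` and `σ ∧ σ_y` are smooth. -/
theorem exists_coeff (h : IsConstrainedWillmoreOn U Λ q) (hU : IsOpen U)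
    (hσ : IsNormalLift U Λ σ) (v : ℂ) : ∃ a b : ℂ → ℂ,
    ContDiffOn ℝ ∞ a U ∧ ContDiffOn ℝ ∞ b U ∧ ∀ z ∈ U,
    formL q v z = a z • wedgeL (toC (σ z)) (toC (fderiv ℝ σ z 1)) +
      b z • wedgeL (toC (σ z)) (toC (fderiv ℝ σ z Complex.I)) := by
  -- The factor `-1/2` inverts `(σ, Δσ) = -2`: applying `σ ∧ σ_x` to `Δσ` gives `-2σ_x`, and pairing
  -- with a unit tangent vector reads off the coefficient.
  have hs : ∀ t : ℂ, ContDiffOn ℝ ∞ (fun z => (-1 / 2 : ℂ) *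
      lorentz ℂ n (toC (fderiv ℝ σ z t)) (formL q v z (lapC σ z))) U := fun t =>
    contDiffOn_const.mul (contDiffOn_lorentz (hσ.contDiffOn_deriv hU t)
      (contDiffOn_apply (h.contDiffOn_formL v) (hσ.contDiffOn_lapC hU)))
  refine ⟨_, _, hs 1, hs Complex.I, fun z hz => ?_⟩
  obtain ⟨a, b, hab⟩ := h.formL_eq hU hσ hz v
  have hf := hσ.isSphereFrame hU hz
  have e1 : (-1 / 2 : ℂ) * lorentz ℂ n (toC (fderiv ℝ σ z 1)) (formL q v z (lapC σ z)) = a := by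
    simp only [hab, EndC.add_apply, EndC.smul_apply, wedgeL_apply, map_add, map_sub, map_smul,
      smul_eq_mul, hf.sL, hf.uL, hf.vL, hf.us, hf.uu, hf.uv]
    ring
  have e2 : (-1 / 2 : ℂ) * lorentz ℂ n (toC (fderiv ℝ σ z Complex.I))
      (formL q v z (lapC σ z)) = b := by
    simp only [hab, EndC.add_apply, EndC.smul_apply, wedgeL_apply, map_add, map_sub, map_smul,
      smul_eq_mul, hf.sL, hf.uL, hf.vL, hf.vs, hf.vu, hf.vv]
    ring
  rw [e1, e2]
  exact hab

/-- Hence `[q ∧ q] = 0`, and terms quadratic in `q` drop out of the deformed closedness equation. -/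
theorem formL_mul_comm (h : IsConstrainedWillmoreOn U Λ q) (hU : IsOpen U)
    (hσ : IsNormalLift U Λ σ) {z : ℂ} (hz : z ∈ U) (v w : ℂ) :
    formL q v z * formL q w z = formL q w z * formL q v z := by
  obtain ⟨a, b, hab⟩ := h.formL_eq hU hσ hz v
  obtain ⟨a', b', hab'⟩ := h.formL_eq hU hσ hz w
  have hf := hσ.isSphereFrame hU hz
  rw [hab, hab']
  simp only [mul_add, add_mul, smul_mul_smul_comm]
  rw [wedgeL_mul_wedgeL hf.ss hf.sv hf.su, mul_comm a a', mul_comm a b', mul_comm b a',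
    mul_comm b b']
  abel

theorem formL_lift (h : IsConstrainedWillmoreOn U Λ q) (hU : IsOpen U)
    (hσ : IsNormalLift U Λ σ) {z : ℂ} (hz : z ∈ U) (v : ℂ) : formL q v z (toC (σ z)) = 0 := by
  obtain ⟨a, b, hab⟩ := h.formL_eq hU hσ hz v
  have hf := hσ.isSphereFrame hU hz
  simp [hab, wedgeL_apply, hf.ss, hf.us, hf.vs]

/-- Together with `formL_lift` this says that `q` lowers the filtration `Λ ⊂ Λ^{(1)}`, so it changes
the Laplacian of a transported lift only by a section of the line bundle. -/
theorem formL_fderiv (h : IsConstrainedWillmoreOn U Λ q) (hU : IsOpen U)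
    (hσ : IsNormalLift U Λ σ) {z : ℂ} (hz : z ∈ U) (v w : ℂ) :
    ∃ c : ℂ, formL q v z (toC (fderiv ℝ σ z w)) = c • toC (σ z) := by
  obtain ⟨a, b, hab⟩ := h.formL_eq hU hσ hz v
  have h0 : lorentz ℂ n (toC (σ z)) (toC (fderiv ℝ σ z w)) = 0 := by
    rw [lorentz_toC, hσ.lorentz_fderiv hU hz, Complex.ofReal_zero]
  refine ⟨-(a * lorentz ℂ n (toC (fderiv ℝ σ z 1)) (toC (fderiv ℝ σ z w)) +
    b * lorentz ℂ n (toC (fderiv ℝ σ z Complex.I)) (toC (fderiv ℝ σ z w))), ?_⟩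
  simp only [hab, EndC.add_apply, EndC.smul_apply, wedgeL_apply, h0]
  module

/-- For `a` and `b` in `S`, the endomorphism `a ∧ b` preserves `S` and annihilates `S^⊥`. -/
theorem formL_mul_projL (h : IsConstrainedWillmoreOn U Λ q) (hU : IsOpen U)
    (hσ : IsNormalLift U Λ σ) {z : ℂ} (hz : z ∈ U) (v : ℂ) :
    formL q v z * projL Λ z = projL Λ z * formL q v z := by
  have hΛ := hσ.isSurface hU
  have hw : ∀ a ∈ centralSphere Λ z, ∀ b ∈ centralSphere Λ z,
      wedgeL a b * projL Λ z = projL Λ z * wedgeL a b := by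
    intro a ha b hb
    ext1 w
    simp only [EndC.mul_apply, wedgeL_apply, map_sub, map_smul, hΛ.projL_of_mem hz ha,
      hΛ.projL_of_mem hz hb]
    rw [← hΛ.lorentz_projL hz, ← hΛ.lorentz_projL hz, hΛ.projL_of_mem hz ha,
      hΛ.projL_of_mem hz hb]
  obtain ⟨a, b, hab⟩ := h.formL_eq hU hσ hz v
  have h0 := hσ.toC_mem hU hz
  rw [hab, add_mul, mul_add, smul_mul_assoc, smul_mul_assoc, mul_smul_comm, mul_smul_comm,
    hw _ h0 _ (hσ.toC_fderiv_mem hU hz _), hw _ h0 _ (hσ.toC_fderiv_mem hU hz _)]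

theorem covL_closed (h : IsConstrainedWillmoreOn U Λ q) (hΛ : IsSurface U Λ) {z : ℂ}
    (hz : z ∈ U) : covL Λ 1 (formL q Complex.I) z - covL Λ Complex.I (formL q 1) z = 0 := by
  ext1 w
  rw [← hΛ.extD_eq hz (α := formFun q) (fun v y _ w => rfl)
    (fun v => differentiableAt_of_contDiffOn hΛ.isOpen (h.contDiffOn_formL v) hz), h.closed z hz]
  rfl

/-- A closed form `q` with values in `Λ ∧ Λ^{(1)}` is also coclosed. -/
theorem covL_coclosed (h : IsConstrainedWillmoreOn U Λ q) (hU : IsOpen U)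
    (hσ : IsNormalLift U Λ σ) {z : ℂ} (hz : z ∈ U) :
    covL Λ 1 (formL q 1) z + covL Λ Complex.I (formL q Complex.I) z = 0 := by
  obtain ⟨α, β, hα, hβ, hx⟩ := h.exists_coeff hU hσ 1
  obtain ⟨γ, δ, hγ, hδ, hy⟩ := h.exists_coeff hU hσ Complex.I
  have hΛ := hσ.isSurface hU
  have hcov : ∀ {a b : ℂ → ℂ} {t : ℂ}, ContDiffOn ℝ ∞ a U → ContDiffOn ℝ ∞ b U →
      (∀ z ∈ U, formL q t z = a z • wedgeL (toC (σ z)) (toC (fderiv ℝ σ z 1)) +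
        b z • wedgeL (toC (σ z)) (toC (fderiv ℝ σ z Complex.I))) → ∀ z ∈ U, ∀ v : ℂ,
      covL Λ v (formL q t) z =
        a z • (wedgeL (toC (fderiv ℝ σ z v)) (toC (fderiv ℝ σ z 1)) +
          ((⟪(1 : ℂ), v⟫_ℝ / 2 : ℝ) : ℂ) • wedgeL (toC (σ z)) (lapC σ z)) +
        fderiv ℝ a z v • wedgeL (toC (σ z)) (toC (fderiv ℝ σ z 1)) +
        (b z • (wedgeL (toC (fderiv ℝ σ z v)) (toC (fderiv ℝ σ z Complex.I)) +
          ((⟪Complex.I, v⟫_ℝ / 2 : ℝ) : ℂ) • wedgeL (toC (σ z)) (lapC σ z)) +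
        fderiv ℝ b z v • wedgeL (toC (σ z)) (toC (fderiv ℝ σ z Complex.I))) := by
    intro a b t ha hb hq z hz v
    have hev : formL q t =ᶠ[nhds z] fun z =>
        a z • wedgeL (toC (σ z)) (toC (fderiv ℝ σ z 1)) +
        b z • wedgeL (toC (σ z)) (toC (fderiv ℝ σ z Complex.I)) := by
      filter_upwards [hU.mem_nhds hz] with y hy using hq y hy
    have hda := differentiableAt_of_contDiffOn hU ha hz
    have hdb := differentiableAt_of_contDiffOn hU hb hz
    have hW : ∀ t, DifferentiableAt ℝ (fun z => wedgeL (toC (σ z)) (toC (fderiv ℝ σ z t))) z :=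
      fun t => differentiableAt_of_contDiffOn hU
        (contDiffOn_wedgeL (contDiffOn_toC hσ.smooth) (hσ.contDiffOn_deriv hU t)) hz
    rw [covL_congr Λ v hev, covL_add Λ v (hda.fun_smul (hW 1)) (hdb.fun_smul (hW Complex.I)),
      covL_smul Λ v hda (hW 1), covL_smul Λ v hdb (hW Complex.I), hσ.covL_wedgeL_lift hU hz,
      hσ.covL_wedgeL_lift hU hz]
  have i1 : ⟪(1 : ℂ), (1 : ℂ)⟫_ℝ = 1 := by simp
  have i2 : ⟪(1 : ℂ), Complex.I⟫_ℝ = 0 := by simp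
  have i3 : ⟪Complex.I, (1 : ℂ)⟫_ℝ = 0 := by simp
  have i4 : ⟪Complex.I, Complex.I⟫_ℝ = 1 := by simp
  -- The four equations are the coefficients in `d^𝒟 q = 0` of `σ ∧ Δσ`, `σ_x ∧ σ_y`, `σ ∧ σ_x` and
  -- `σ ∧ σ_y`; pairing with frame vectors isolates each. Together they say that `α - iβ` is
  -- holomorphic and determines `q`.
  have key : ∀ z ∈ U, γ z = β z ∧ δ z = -α z ∧ fderiv ℝ γ z 1 = fderiv ℝ α z Complex.I ∧
      fderiv ℝ δ z 1 = fderiv ℝ β z Complex.I := by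
    intro z hz
    have hf := hσ.isSphereFrame hU hz
    have h0 := h.covL_closed hΛ hz
    rw [hcov hγ hδ hy z hz, hcov hα hβ hx z hz, i1, i2, i3, i4] at h0
    set s := toC (σ z)
    set u := toC (fderiv ℝ σ z 1)
    set v := toC (fderiv ℝ σ z Complex.I)
    set L := lapC σ z
    have hp : ∀ a b, lorentz ℂ n a ((0 : EndC n) b) = 0 := fun a b => by simp
    rw [← h0] at hp
    simp only [EndC.sub_apply, EndC.add_apply, EndC.smul_apply, wedgeL_apply, map_add, map_sub,
      map_smul, smul_eq_mul] at hp
    have e1 := hp L s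
    have e2 := hp v u
    have e3 := hp L u
    have e4 := hp L v
    simp only [hf.ss, hf.su, hf.sv, hf.uu, hf.uv, hf.vv, hf.vL, hf.us, hf.vs, hf.Ls, hf.vu, hf.Lu,
      hf.Lv] at e1 e2 e3 e4
    push_cast at e1 e2 e3 e4
    refine ⟨?_, ?_, ?_, ?_⟩
    · linear_combination (-1 / 2 : ℂ) * e1
    · linear_combination e2
    · linear_combination (1 / 2 : ℂ) * e3
    · linear_combination (1 / 2 : ℂ) * e4
  obtain ⟨k1, k2, k3, k4⟩ := key z hz
  -- The algebraic relations hold throughout the open set `U`, so they may be differentiated.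
  have g1 : ∀ v, fderiv ℝ γ z v = fderiv ℝ β z v := fun v => by
    have : γ =ᶠ[nhds z] β := by
      filter_upwards [hU.mem_nhds hz] with y hy using (key y hy).1
    rw [this.fderiv_eq]
  have g2 : ∀ v, fderiv ℝ δ z v = -fderiv ℝ α z v := fun v => by
    have : δ =ᶠ[nhds z] fun y => -α y := by
      filter_upwards [hU.mem_nhds hz] with y hy using (key y hy).2.1
    rw [this.fderiv_eq, fderiv_fun_neg]
    rfl
  rw [hcov hγ hδ hy z hz, hcov hα hβ hx z hz, i1, i2, i3, i4, k1, k2]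
  simp only [g1, g2, wedgeL_self] at k3 k4 ⊢
  rw [← k3, ← k4, wedgeL_swap (toC (fderiv ℝ σ z Complex.I))]
  push_cast
  module

end IsConstrainedWillmoreOn

/-! ### The spectral deformation in a holomorphic coordinate -/

/-- The coefficient `(l + l⁻¹) / 2`. -/
noncomputable def cosL (l : ℂ) : ℂ := (l + l⁻¹) / 2

/-- The coefficient `i (l⁻¹ - l) / 2`. -/
noncomputable def sinL (l : ℂ) : ℂ := Complex.I * (l⁻¹ - l) / 2

/-- The form `l α^{1,0} + l⁻¹ α^{0,1}`. -/
noncomputable def rot {F : Type*} [AddCommGroup F] [Module ℂ F] (l : ℂ) (α : ℂ → F) (v : ℂ) : F :=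
  cosL l • α v + sinL l • α (Complex.I * v)

theorem part_eq_rot {F : Type} [AddCommGroup F] [Module ℂ F] [Module ℝ F] [IsScalarTower ℝ ℂ F]
    [SMulCommClass ℝ ℂ F] (α : ℂ →ₗ[ℝ] F) (l : ℂ) (v : ℂ) :
    l • part10 mulI α v + l⁻¹ • part01 mulI α v = rot l α v := by
  have h : mulI v = Complex.I * v := rfl
  simp only [part10, part01, rot, cosL, sinL, LinearMap.smul_apply, LinearMap.sub_apply,
    LinearMap.add_apply, LinearMap.comp_apply, h]
  module

theorem part_add_part {F : Type} [AddCommGroup F] [Module ℂ F] [Module ℝ F] [IsScalarTower ℝ ℂ F]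
    [SMulCommClass ℝ ℂ F] (α : ℂ →ₗ[ℝ] F) (v : ℂ) :
    part10 mulI α v + part01 mulI α v = α v := by
  simp only [part10, part01, LinearMap.smul_apply, LinearMap.sub_apply, LinearMap.add_apply]
  module

/-- Each rotation scales the `(1,0)`-part by its parameter and the `(0,1)`-part by the inverse, so
parameters multiply. -/
theorem rot_rot {F : Type*} [AddCommGroup F] [Module ℂ F] {l m : ℂ} (hl : l ≠ 0) (hm : m ≠ 0)
    {α : ℂ → F} (hα : ∀ v, α (Complex.I * (Complex.I * v)) = -α v) (v : ℂ) :
    rot l (rot m α) v = rot (m * l) α v := by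
  simp only [rot, hα, cosL, sinL]
  match_scalars
  · field_simp
    ring_nf
    simp only [Complex.I_sq]
    ring
  · field_simp
    ring

/-- For `l = e^{iθ}` the coefficients `cosL l` and `sinL l` are `cos θ` and `sin θ`, and this is the
addition formula for `cos(2θ - θ)`. The next lemma is the one for `sin(θ - 2θ)`. -/
theorem cosL_sq_mul_add {l : ℂ} (hl : l ≠ 0) :
    cosL (l ^ 2) * cosL l + sinL (l ^ 2) * sinL l = cosL l := by
  simp only [cosL, sinL]
  field_simp
  ring_nf
  simp only [Complex.I_sq]
  ring

theorem cosL_sq_mul_sub {l : ℂ} (hl : l ≠ 0) :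
    cosL (l ^ 2) * sinL l - sinL (l ^ 2) * cosL l = -sinL l := by
  simp only [cosL, sinL]
  field_simp
  ring

theorem formNL_I_mul_I_mul {n : ℕ} (Λ : ℂ → Submodule ℝ (RV n)) (z v : ℂ) :
    formNL Λ (Complex.I * (Complex.I * v)) z = -formNL Λ v z := by
  rw [← mul_assoc, Complex.I_mul_I, neg_one_mul, formNL_neg]

theorem formL_I_mul_I_mul {n : ℕ} (q : ℂ → ℂ →ₗ[ℝ] Module.End ℂ (CV n)) (z v : ℂ) :
    formL q (Complex.I * (Complex.I * v)) z = -formL q v z := by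
  rw [← mul_assoc, Complex.I_mul_I, neg_one_mul, formL_neg]

/-- The difference of the connection `d^l_q` and the trivial connection. -/
noncomputable def dSpecForm {n : ℕ} (Λ : ℂ → Submodule ℝ (RV n))
    (q : ℂ → ℂ →ₗ[ℝ] Module.End ℂ (CV n)) (l : ℂ) (v z : ℂ) : EndC n :=
  rot l (fun t => formNL Λ t z) v - formNL Λ v z +
    (rot (l ^ 2) (fun t => formL q t z) v - formL q v z)

theorem IsSurface.dSpec_apply {n : ℕ} {U : Set ℂ} {Λ : ℂ → Submodule ℝ (RV n)}
    (h : IsSurface U Λ) {z : ℂ} (hz : z ∈ U) (q : ℂ → ℂ →ₗ[ℝ] Module.End ℂ (CV n)) (l : ℂ)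
    {ξ : ℂ → CV n} (hξ : DifferentiableAt ℝ ξ z) (v : ℂ) :
    dSpec Λ q l ξ z v = fderiv ℝ ξ z v + dSpecForm Λ q l v z (ξ z) := by
  have h1 : dSpec Λ q l ξ z v = connD Λ ξ z v + rot l (connN Λ ξ z) v +
      (rot (l ^ 2) (formApply q ξ z) v - formApply q ξ z v) := by
    rw [← part_eq_rot, ← part_eq_rot, ← part_add_part (formApply q ξ z) v]
    simp only [dSpec, LinearMap.add_apply, LinearMap.smul_apply, inv_pow]
    module
  rw [h1]
  have h2 : ∀ v, formApply q ξ z v = formL q v z (ξ z) := fun _ => rfl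
  simp only [rot, h.connD_apply hz hξ, h.connN_apply hz hξ, h2, dSpecForm, EndC.add_apply,
    EndC.sub_apply, EndC.smul_apply]
  abel

/-- The complex linear extension of an isometry, as a field of continuous endomorphisms. -/
noncomputable def cxL {n : ℕ} (φ : ℂ → RV n ≃ₗ[ℝ] RV n) (z : ℂ) : EndC n :=
  EndC.ofLin (cx (φ z).toLinearMap)

/-- The inverse of `cxL`. -/
noncomputable def cxInvL {n : ℕ} (φ : ℂ → RV n ≃ₗ[ℝ] RV n) (z : ℂ) : EndC n :=
  EndC.ofLin (cx (φ z).symm.toLinearMap)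

section

variable {n : ℕ} (φ : ℂ → RV n ≃ₗ[ℝ] RV n) (z : ℂ)

theorem cxL_apply (w : CV n) : cxL φ z w = cx (φ z).toLinearMap w := rfl

theorem cxL_toC (w : RV n) : cxL φ z (toC w) = toC (φ z w) := cx_toC _ w

theorem cxL_mul_cxInvL : cxL φ z * cxInvL φ z = 1 := EndC.ext fun w => cx_apply_symm (φ z) w

theorem cxInvL_mul_cxL : cxInvL φ z * cxL φ z = 1 := EndC.ext fun w => cx_symm_apply (φ z) w

end

/-- In a coordinate, `φ` intertwines `d^μ_q` with the trivial connection. -/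
structure IsLocalIsometry {n : ℕ} (U : Set ℂ) (Λ : ℂ → Submodule ℝ (RV n))
    (q : ℂ → ℂ →ₗ[ℝ] Module.End ℂ (CV n)) (μ : ℂ) (φ : ℂ → RV n ≃ₗ[ℝ] RV n) : Prop where
  smooth : ∀ w : RV n, ContDiffOn ℝ ∞ (fun z => φ z w) U
  isometry : ∀ z ∈ U, ∀ u v : RV n, lorentz ℝ n (φ z u) (φ z v) = lorentz ℝ n u v
  intertwines : ∀ w : RV n, ∀ z ∈ U, ∀ v : ℂ, toC (fderiv ℝ (fun y => φ y w) z v) =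
    cx (φ z).toLinearMap (dSpec Λ q μ (fun _ => toC w) z v)

/-- The bundle `φ Λ` in a coordinate. -/
def mapLocal {n : ℕ} (φ : ℂ → RV n ≃ₗ[ℝ] RV n) (Λ : ℂ → Submodule ℝ (RV n)) :
    ℂ → Submodule ℝ (RV n) :=
  fun z => (Λ z).map (φ z).toLinearMap

/-! ### Differentiating the gauge `φ` -/

namespace IsLocalIsometry

variable {n : ℕ} {U : Set ℂ} {Λ : ℂ → Submodule ℝ (RV n)} {σ : ℂ → RV n}
  {q : ℂ → ℂ →ₗ[ℝ] Module.End ℂ (CV n)} {μ : ℂ} {φ : ℂ → RV n ≃ₗ[ℝ] RV n}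

theorem contDiffOn_cxL (h : IsLocalIsometry U Λ q μ φ) : ContDiffOn ℝ ∞ (cxL φ) U := by
  refine contDiffOn_of_apply fun w => ?_
  obtain ⟨a, b, rfl⟩ := exists_toC_add_smul w
  simp only [map_add, map_smul, cxL_toC]
  have hb : ContDiffOn ℝ ∞ (fun y => Complex.I • toC (φ y b)) U :=
    (contDiffOn_toC (h.smooth b)).const_smul Complex.I
  exact (contDiffOn_toC (h.smooth a)).add hb

theorem contDiffOn_cxInvL (h : IsLocalIsometry U Λ q μ φ) : ContDiffOn ℝ ∞ (cxInvL φ) U := by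
  intro z hz
  let e : ∀ y, (EndC n)ˣ := fun y => ⟨cxL φ y, cxInvL φ y, cxL_mul_cxInvL φ y, cxInvL_mul_cxL φ y⟩
  -- Smoothness of `φ⁻¹` comes from smoothness of inversion at units of the Banach algebra.
  have h1 : cxInvL φ = Ring.inverse ∘ cxL φ := funext fun y => (Ring.inverse_unit (e y)).symm
  rw [h1]
  exact (contDiffAt_ringInverse ℝ (e z)).comp_contDiffWithinAt z (h.contDiffOn_cxL z hz)

theorem differentiableAt_cxL (h : IsLocalIsometry U Λ q μ φ) (hU : IsOpen U) {z : ℂ}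
    (hz : z ∈ U) : DifferentiableAt ℝ (cxL φ) z :=
  differentiableAt_of_contDiffOn hU h.contDiffOn_cxL hz

theorem differentiableAt_cxInvL (h : IsLocalIsometry U Λ q μ φ) (hU : IsOpen U) {z : ℂ}
    (hz : z ∈ U) : DifferentiableAt ℝ (cxInvL φ) z :=
  differentiableAt_of_contDiffOn hU h.contDiffOn_cxInvL hz

/-- On constant sections the intertwining property reads `dφ = φ(d^μ_q - d)`; real constants
determine a complex linear map. -/
theorem fderiv_cxL (h : IsLocalIsometry U Λ q μ φ) (hΛ : IsSurface U Λ) {z : ℂ} (hz : z ∈ U)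
    (v : ℂ) : fderiv ℝ (cxL φ) z v = cxL φ z * dSpecForm Λ q μ v z := by
  have h1 : ∀ w : RV n, fderiv ℝ (cxL φ) z v (toC w) =
      (cxL φ z * dSpecForm Λ q μ v z) (toC w) := by
    intro w
    have h2 := h.intertwines w z hz v
    rw [hΛ.dSpec_apply hz q μ (differentiableAt_const _), fderiv_fun_const,
      ← fderiv_toC (differentiableAt_of_contDiffOn hΛ.isOpen (h.smooth w) hz)] at h2
    rw [← fderiv_apply_const (h.differentiableAt_cxL hΛ.isOpen hz)]
    simp only [cxL_toC, h2]
    simp [cxL_apply]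
  ext1 w
  obtain ⟨a, b, rfl⟩ := exists_toC_add_smul w
  simp only [map_add, map_smul, h1]

theorem fderiv_cxInvL (h : IsLocalIsometry U Λ q μ φ) (hΛ : IsSurface U Λ) {z : ℂ} (hz : z ∈ U)
    (v : ℂ) : fderiv ℝ (cxInvL φ) z v = -(dSpecForm Λ q μ v z * cxInvL φ z) := by
  have h1 := fderiv_mul_apply (h.differentiableAt_cxL hΛ.isOpen hz)
    (h.differentiableAt_cxInvL hΛ.isOpen hz) v
  simp only [cxL_mul_cxInvL, fderiv_fun_const, h.fderiv_cxL hΛ hz] at h1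
  have h2 := congrArg (fun T => cxInvL φ z * T) h1
  simp only [mul_add, ← mul_assoc, cxInvL_mul_cxL, one_mul] at h2
  rw [eq_neg_iff_add_eq_zero, ← h2]
  simp

theorem fderiv_conj (h : IsLocalIsometry U Λ q μ φ) (hΛ : IsSurface U Λ) {z : ℂ} (hz : z ∈ U)
    {A : ℂ → EndC n} (hA : DifferentiableAt ℝ A z) (v : ℂ) :
    fderiv ℝ (fun y => cxL φ y * A y * cxInvL φ y) z v = cxL φ z *
      (fderiv ℝ A z v + (dSpecForm Λ q μ v z * A z - A z * dSpecForm Λ q μ v z)) *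
        cxInvL φ z := by
  have h1 := h.differentiableAt_cxL hΛ.isOpen hz
  have h2 := h.differentiableAt_cxInvL hΛ.isOpen hz
  rw [fderiv_mul_apply (h1.fun_mul hA) h2, fderiv_mul_apply h1 hA, h.fderiv_cxL hΛ hz,
    h.fderiv_cxInvL hΛ hz]
  noncomm_ring

end IsLocalIsometry

/-- The hypothesis says that `X` exchanges image and kernel of `P`, so `P X P = 0`. With `X = 𝒩_v`,
this recovers `𝒩` from the change of `dP` under a gauge. -/
theorem reflection_mul_commutator {A : Type*} [Ring A] [Algebra ℂ A] {P X : A} (hP : P * P = P)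
    (hX : P * X + X * P = X) : (1 - (2 : ℂ) • P) * (X * P - P * X) = X := by
  have h1 : P * X * P = 0 := by
    have := congrArg (fun T => P * T) hX
    simp only [mul_add, ← mul_assoc, hP] at this
    exact left_eq_add.1 this.symm
  have h2 : (1 - (2 : ℂ) • P) * (X * P - P * X) = X * P - P * X - (2 : ℂ) • (P * X * P) +
      (2 : ℂ) • (P * P * X) := by
    simp only [sub_mul, one_mul, mul_sub, smul_mul_assoc, mul_assoc]
    abel
  rw [h2, h1, hP]
  conv_rhs => rw [← hX]
  module

theorem IsSurface.projL_mul_formNL_add {n : ℕ} {U : Set ℂ} {Λ : ℂ → Submodule ℝ (RV n)}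
    (h : IsSurface U Λ) {z : ℂ} (hz : z ∈ U) (v : ℂ) :
    projL Λ z * formNL Λ v z + formNL Λ v z * projL Λ z = formNL Λ v z := by
  have hX := h.fderiv_projL hz v
  have hP := h.projL_mul_self hz
  set P := projL Λ z
  set X := fderiv ℝ (projL Λ) z v
  have h1 : P * X * P = 0 := by
    have := congrArg (fun T => P * T) hX
    simp only [mul_add, ← mul_assoc, hP] at this
    exact left_eq_add.1 this.symm
  have h2 : formNL Λ v z = X - (2 : ℂ) • (P * X) := by
    change (1 - (2 : ℂ) • P) * X = _
    rw [sub_mul, one_mul, smul_mul_assoc]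
  rw [h2, mul_sub, sub_mul, mul_smul_comm, smul_mul_assoc, h1, ← mul_assoc, hP]
  conv_rhs => rw [← hX]
  simp only [mul_add, ← mul_assoc, hP, h1]
  module

/-- `𝒟 + (l² - 1) q^{1,0} + (l⁻² - 1) q^{0,1}` differs from `𝒟` by this form. -/
noncomputable def shiftForm {n : ℕ} (q : ℂ → ℂ →ₗ[ℝ] Module.End ℂ (CV n)) (l v z : ℂ) : EndC n :=
  rot (l ^ 2) (fun t => formL q t z) v - formL q v z

theorem rot_conj {n : ℕ} (l : ℂ) (A B : EndC n) (α : ℂ → EndC n) (v : ℂ) :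
    rot l (fun t => A * α t * B) v = A * rot l α v * B := by
  simp only [rot, mul_add, add_mul, mul_smul_comm, smul_mul_assoc]

theorem conj_mul_conj {n : ℕ} (φ : ℂ → RV n ≃ₗ[ℝ] RV n) (z : ℂ) (A B : EndC n) :
    cxL φ z * A * cxInvL φ z * (cxL φ z * B * cxInvL φ z) = cxL φ z * (A * B) * cxInvL φ z := by
  rw [mul_assoc (cxL φ z) B, ← mul_assoc _ (cxL φ z), mul_assoc _ (cxInvL φ z) (cxL φ z),
    cxInvL_mul_cxL, mul_one]
  simp only [mul_assoc]

/-! ### Transport of lifts, central spheres and connections -/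

namespace IsLocalIsometry

variable {n : ℕ} {U : Set ℂ} {Λ : ℂ → Submodule ℝ (RV n)} {σ : ℂ → RV n}
  {q : ℂ → ℂ →ₗ[ℝ] Module.End ℂ (CV n)} {μ : ℂ} {φ : ℂ → RV n ≃ₗ[ℝ] RV n}

theorem contDiffOn_map (h : IsLocalIsometry U Λ q μ φ) {ξ : ℂ → RV n}
    (hξ : ContDiffOn ℝ ∞ ξ U) : ContDiffOn ℝ ∞ (fun y => φ y (ξ y)) U := by
  have h1 : (fun y => φ y (ξ y)) = fun y => ∑ j, ξ y j • φ y (Pi.single j 1) := by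
    funext y
    conv_lhs => rw [pi_eq_sum_univ' (ξ y)]
    simp
  rw [h1]
  exact ContDiffOn.sum fun j _ => (contDiffOn_pi.1 hξ j).smul (h.smooth _)

/-- `d (φ ξ) = φ (d^μ_q ξ)` for real sections. -/
theorem toC_fderiv_map (h : IsLocalIsometry U Λ q μ φ) (hΛ : IsSurface U Λ) {ξ : ℂ → RV n}
    (hξ : ContDiffOn ℝ ∞ ξ U) {z : ℂ} (hz : z ∈ U) (v : ℂ) :
    toC (fderiv ℝ (fun y => φ y (ξ y)) z v) =
      cxL φ z (toC (fderiv ℝ ξ z v) + dSpecForm Λ q μ v z (toC (ξ z))) := by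
  have hU := hΛ.isOpen
  rw [← fderiv_toC (differentiableAt_of_contDiffOn hU (h.contDiffOn_map hξ) hz)]
  simp only [← cxL_toC]
  rw [fderiv_apply (h.differentiableAt_cxL hU hz)
    (differentiableAt_of_contDiffOn hU (contDiffOn_toC hξ) hz), h.fderiv_cxL hΛ hz,
    fderiv_toC (differentiableAt_of_contDiffOn hU hξ hz), map_add]
  rfl

/-- Both `𝒩` and `q` annihilate `Λ`, so every `d^l_q` differentiates `σ` as `d` does. -/
theorem dSpecForm_lift (hq : IsConstrainedWillmoreOn U Λ q) (hU : IsOpen U)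
    (hσ : IsNormalLift U Λ σ) {z : ℂ} (hz : z ∈ U) (l v : ℂ) :
    dSpecForm Λ q l v z (toC (σ z)) = 0 := by
  simp [dSpecForm, rot, hσ.formNL_lift hU hz, hq.formL_lift hU hσ hz]

theorem fderiv_map_lift (h : IsLocalIsometry U Λ q μ φ) (hq : IsConstrainedWillmoreOn U Λ q)
    (hU : IsOpen U) (hσ : IsNormalLift U Λ σ) {z : ℂ} (hz : z ∈ U) (v : ℂ) :
    fderiv ℝ (fun y => φ y (σ y)) z v = φ z (fderiv ℝ σ z v) := by
  apply toC_injective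
  rw [h.toC_fderiv_map (hσ.isSurface hU) hσ.smooth hz, dSpecForm_lift hq hU hσ hz, add_zero,
    cxL_toC]

/-- A normalised lift of `Λ` is mapped to a normalised lift of `φ Λ`. -/
theorem normalLift_map (h : IsLocalIsometry U Λ q μ φ) (hq : IsConstrainedWillmoreOn U Λ q)
    (hU : IsOpen U) (hσ : IsNormalLift U Λ σ) :
    IsNormalLift U (mapLocal φ Λ) (fun y => φ y (σ y)) where
  smooth := h.contDiffOn_map hσ.smooth
  ne_zero z hz := by simpa using hσ.ne_zero z hz
  span z hz := by
    rw [mapLocal, hσ.span z hz, Submodule.map_span, Set.image_singleton]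
    rfl
  null z hz := by rw [h.isometry z hz, hσ.null z hz]
  metric z hz v w := by
    rw [h.fderiv_map_lift hq hU hσ hz, h.fderiv_map_lift hq hU hσ hz, h.isometry z hz,
      hσ.metric z hz]

theorem toC_deriv₂_map (h : IsLocalIsometry U Λ q μ φ) (hq : IsConstrainedWillmoreOn U Λ q)
    (hU : IsOpen U) (hσ : IsNormalLift U Λ σ) {z : ℂ} (hz : z ∈ U) (v w : ℂ) :
    toC (deriv₂ (fun y => φ y (σ y)) v w z) =
      cxL φ z (toC (deriv₂ σ v w z) + dSpecForm Λ q μ w z (toC (fderiv ℝ σ z v))) := by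
  have hev : (fun y => fderiv ℝ (fun y => φ y (σ y)) y v) =ᶠ[nhds z]
      fun y => φ y (fderiv ℝ σ y v) := by
    filter_upwards [hU.mem_nhds hz] with y hy using h.fderiv_map_lift hq hU hσ hy v
  rw [deriv₂, hev.fderiv_eq, h.toC_fderiv_map (hσ.isSurface hU)
    (contDiffOn_fderiv_apply hU hσ.smooth v) hz, deriv₂]

theorem lapC_map (h : IsLocalIsometry U Λ q μ φ) (hq : IsConstrainedWillmoreOn U Λ q)
    (hU : IsOpen U) (hσ : IsNormalLift U Λ σ) {z : ℂ} (hz : z ∈ U) :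
    ∃ c : ℂ, lapC (fun y => φ y (σ y)) z = cxL φ z (lapC σ z) + c • cxL φ z (toC (σ z)) := by
  have hΛ := hσ.isSurface hU
  -- `𝒩(dσ)` is the normal part of the second derivatives: trace-free since `Δσ` lies in `S`, and
  -- symmetric by `n2`. Hence its rotation is trace-free too, and only the contribution of `q`, a
  -- multiple of `σ`, remains in `hs`.
  have n1 : formNL Λ 1 z (toC (fderiv ℝ σ z 1)) +
      formNL Λ Complex.I z (toC (fderiv ℝ σ z Complex.I)) = 0 := by
    have h1 := hΛ.projL_of_mem hz (hσ.lapC_mem hU hz)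
    rw [hσ.formNL_fderiv hU hz, hσ.formNL_fderiv hU hz]
    rw [lapC, toC_add, map_add] at h1
    rw [sub_add_sub_comm, h1, sub_self]
  have n2 : formNL Λ Complex.I z (toC (fderiv ℝ σ z 1)) =
      formNL Λ 1 z (toC (fderiv ℝ σ z Complex.I)) := by
    rw [hσ.formNL_fderiv hU hz, hσ.formNL_fderiv hU hz, deriv₂_comm (hσ.contDiffAt hU hz)]
  have n3 := eq_neg_of_add_eq_zero_right n1
  obtain ⟨c1, e1⟩ := hq.formL_fderiv hU hσ hz 1 1
  obtain ⟨c2, e2⟩ := hq.formL_fderiv hU hσ hz Complex.I 1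
  obtain ⟨c3, e3⟩ := hq.formL_fderiv hU hσ hz 1 Complex.I
  obtain ⟨c4, e4⟩ := hq.formL_fderiv hU hσ hz Complex.I Complex.I
  have hs : dSpecForm Λ q μ 1 z (toC (fderiv ℝ σ z 1)) +
      dSpecForm Λ q μ Complex.I z (toC (fderiv ℝ σ z Complex.I)) =
      (cosL (μ ^ 2) * c1 + sinL (μ ^ 2) * c2 - c1 + (cosL (μ ^ 2) * c4 - sinL (μ ^ 2) * c3 - c4)) •
        toC (σ z) := by
    simp only [dSpecForm, rot, EndC.add_apply, EndC.sub_apply, EndC.smul_apply, mul_one,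
      Complex.I_mul_I, formNL_neg, formL_neg, EndC.neg_apply, n2, n3, e1, e2, e3, e4]
    module
  refine ⟨cosL (μ ^ 2) * c1 + sinL (μ ^ 2) * c2 - c1 +
    (cosL (μ ^ 2) * c4 - sinL (μ ^ 2) * c3 - c4), ?_⟩
  rw [lapC, toC_add, h.toC_deriv₂_map hq hU hσ hz, h.toC_deriv₂_map hq hU hσ hz, ← map_add,
    add_add_add_comm, hs, ← toC_add, map_add, map_smul]
  rfl

theorem firstBundle_map (h : IsLocalIsometry U Λ q μ φ) (hq : IsConstrainedWillmoreOn U Λ q)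
    (hU : IsOpen U) (hσ : IsNormalLift U Λ σ) {z : ℂ} (hz : z ∈ U) :
    firstBundle (mapLocal φ Λ) z = (firstBundle Λ z).map (cx (φ z).toLinearMap) := by
  rw [(h.normalLift_map hq hU hσ).firstBundle_eq hU hz, hσ.firstBundle_eq hU hz,
    h.fderiv_map_lift hq hU hσ hz, h.fderiv_map_lift hq hU hσ hz, Submodule.map_span]
  simp only [Set.image_insert_eq, Set.image_singleton, cx_toC]
  rfl

theorem centralSphere_map (h : IsLocalIsometry U Λ q μ φ) (hq : IsConstrainedWillmoreOn U Λ q)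
    (hU : IsOpen U) (hσ : IsNormalLift U Λ σ) {z : ℂ} (hz : z ∈ U) :
    centralSphere (mapLocal φ Λ) z = (centralSphere Λ z).map (cx (φ z).toLinearMap) := by
  obtain ⟨c, hc⟩ := h.lapC_map hq hU hσ hz
  rw [(h.normalLift_map hq hU hσ).centralSphere_eq hU hz, hσ.centralSphere_eq hU hz,
    h.fderiv_map_lift hq hU hσ hz, h.fderiv_map_lift hq hU hσ hz, Submodule.map_span, hc]
  simp only [Set.image_insert_eq, Set.image_singleton, ← cxL_toC, ← cxL_apply]
  generalize cxL φ z (toC (σ z)) = s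
  generalize cxL φ z (toC (fderiv ℝ σ z 1)) = u
  generalize cxL φ z (toC (fderiv ℝ σ z Complex.I)) = v
  generalize cxL φ z (lapC σ z) = L
  have hsub : ∀ {F : Set (CV n)} {x : CV n}, x ∈ F → x ∈ Submodule.span ℂ F := fun hx =>
    Submodule.subset_span hx
  apply le_antisymm
  · rw [Submodule.span_le]
    rintro x (rfl | rfl | rfl | rfl)
    · exact hsub (by simp)
    · exact hsub (by simp)
    · exact hsub (by simp)
    · exact Submodule.add_mem _ (hsub (by simp)) (Submodule.smul_mem _ _ (hsub (by simp)))
  · rw [Submodule.span_le]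
    rintro x (rfl | rfl | rfl | rfl)
    · exact hsub (by simp)
    · exact hsub (by simp)
    · exact hsub (by simp)
    · have h1 : x + c • s ∈ Submodule.span ℂ {s, u, v, x + c • s} := hsub (by simp)
      have h2 : s ∈ Submodule.span ℂ {s, u, v, x + c • s} := hsub (by simp)
      have := Submodule.sub_mem _ h1 (Submodule.smul_mem _ c h2)
      rwa [add_sub_cancel_right] at this

theorem lorentz_cxL (h : IsLocalIsometry U Λ q μ φ) {z : ℂ} (hz : z ∈ U) (u v : CV n) :
    lorentz ℂ n (cx (φ z).toLinearMap u) (cx (φ z).toLinearMap v) = lorentz ℂ n u v :=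
  lorentz_cx (T := (φ z).toLinearMap) (h.isometry z hz) u v

theorem perp_map (h : IsLocalIsometry U Λ q μ φ) {z : ℂ} (hz : z ∈ U) {W : Submodule ℂ (CV n)}
    {w : CV n} (hw : w ∈ perp W) :
    cx (φ z).toLinearMap w ∈ perp (W.map (cx (φ z).toLinearMap)) := by
  rw [mem_perp] at hw ⊢
  rintro _ ⟨u, hu, rfl⟩
  rw [h.lorentz_cxL hz, hw u hu]

theorem projL_map (h : IsLocalIsometry U Λ q μ φ) (hq : IsConstrainedWillmoreOn U Λ q)
    (hU : IsOpen U) (hσ : IsNormalLift U Λ σ) {z : ℂ} (hz : z ∈ U) :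
    projL (mapLocal φ Λ) z = cxL φ z * projL Λ z * cxInvL φ z := by
  have hΛ := hσ.isSurface hU
  have h1 := (CWillmore.orthProj_eq (W := (centralSphere Λ z).map (cx (φ z).toLinearMap))
    (P := cx (φ z).toLinearMap ∘ₗ projS Λ z ∘ₗ cx (φ z).symm.toLinearMap) ?_ ?_ ?_).1
  · ext1 w
    rw [projL_apply, projS, h.centralSphere_map hq hU hσ hz, h1]
    rfl
  · intro w
    exact Submodule.mem_map_of_mem (hΛ.projL_mem hz _)
  · rintro _ ⟨w, hw, rfl⟩
    simp only [LinearMap.comp_apply, cx_symm_apply]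
    congr 1
    exact hΛ.projL_of_mem hz hw
  · intro w
    obtain ⟨w, rfl⟩ : ∃ w', w = cx (φ z).toLinearMap w' := ⟨_, (cx_apply_symm (φ z) w).symm⟩
    simp only [LinearMap.comp_apply, cx_symm_apply]
    rw [← map_sub]
    refine h.perp_map hz (mem_perp.2 fun u hu => ?_)
    have h2 := hΛ.lorentz_projL hz u w
    rw [hΛ.projL_of_mem hz hu] at h2
    rw [map_sub, h2, projL_apply, sub_self]

/-- Conjugation changes `dP` by the commutator of `P` with `d^μ_q - d`. The `q` part commutes with
`P`; the remaining part `μ𝒩^{1,0} + μ⁻¹𝒩^{0,1} - 𝒩` is recovered by `reflection_mul_commutator` and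
added to the original `𝒩`. -/
theorem formNL_map (h : IsLocalIsometry U Λ q μ φ) (hq : IsConstrainedWillmoreOn U Λ q)
    (hU : IsOpen U) (hσ : IsNormalLift U Λ σ) {z : ℂ} (hz : z ∈ U) (v : ℂ) :
    formNL (mapLocal φ Λ) v z =
      cxL φ z * rot μ (fun t => formNL Λ t z) v * cxInvL φ z := by
  have hΛ := hσ.isSurface hU
  have hev : projL (mapLocal φ Λ) =ᶠ[nhds z] fun y => cxL φ y * projL Λ y * cxInvL φ y := by
    filter_upwards [hU.mem_nhds hz] with y hy using h.projL_map hq hU hσ hy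
  have hJ : (1 : EndC n) - (2 : ℂ) • (cxL φ z * projL Λ z * cxInvL φ z) =
      cxL φ z * (1 - (2 : ℂ) • projL Λ z) * cxInvL φ z := by
    rw [mul_sub, sub_mul, mul_one, cxL_mul_cxInvL, mul_smul_comm, smul_mul_assoc]
  rw [formNL, h.projL_map hq hU hσ hz, hev.fderiv_eq,
    h.fderiv_conj hΛ hz (hΛ.differentiableAt_projL hz), hJ, conj_mul_conj]
  congr 2
  have hP := hΛ.projL_mul_self hz
  have hN := fun t => reflection_mul_commutator hP (hΛ.projL_mul_formNL_add hz t)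
  have hB : shiftForm q μ v z * projL Λ z = projL Λ z * shiftForm q μ v z := by
    simp only [shiftForm, rot, add_mul, sub_mul, mul_add, mul_sub, smul_mul_assoc, mul_smul_comm,
      hq.formL_mul_projL hU hσ hz]
  have hK : dSpecForm Λ q μ v z * projL Λ z - projL Λ z * dSpecForm Λ q μ v z =
      cosL μ • (formNL Λ v z * projL Λ z - projL Λ z * formNL Λ v z) +
      sinL μ • (formNL Λ (Complex.I * v) z * projL Λ z -
        projL Λ z * formNL Λ (Complex.I * v) z) -
      (formNL Λ v z * projL Λ z - projL Λ z * formNL Λ v z) := by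
    change (rot μ (fun t => formNL Λ t z) v - formNL Λ v z + shiftForm q μ v z) * projL Λ z -
      projL Λ z * (rot μ (fun t => formNL Λ t z) v - formNL Λ v z + shiftForm q μ v z) = _
    simp only [rot, add_mul, sub_mul, mul_add, mul_sub, hB, smul_mul_assoc, mul_smul_comm]
    module
  rw [hK, mul_add, mul_sub, mul_add, mul_smul_comm, mul_smul_comm, hN, hN]
  change formNL Λ v z + _ = _
  simp only [rot]
  abel

/-- Subtracting the new `𝒩` from the gauge term removes its rotated `𝒩`, so `𝒟` changes by
`shiftForm` alone. -/
theorem covL_map (h : IsLocalIsometry U Λ q μ φ) (hq : IsConstrainedWillmoreOn U Λ q)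
    (hU : IsOpen U) (hσ : IsNormalLift U Λ σ) {z : ℂ} (hz : z ∈ U) {A : ℂ → EndC n}
    (hA : DifferentiableAt ℝ A z) (v : ℂ) :
    covL (mapLocal φ Λ) v (fun y => cxL φ y * A y * cxInvL φ y) z = cxL φ z *
      (covL Λ v A z + (shiftForm q μ v z * A z - A z * shiftForm q μ v z)) * cxInvL φ z := by
  have hΛ := hσ.isSurface hU
  rw [covL, h.fderiv_conj hΛ hz hA, h.formNL_map hq hU hσ hz, conj_mul_conj, conj_mul_conj,
    ← sub_mul, ← sub_mul, ← mul_sub, ← mul_sub]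
  congr 2
  change fderiv ℝ A z v +
    ((rot μ (fun t => formNL Λ t z) v - formNL Λ v z + shiftForm q μ v z) * A z -
    A z * (rot μ (fun t => formNL Λ t z) v - formNL Λ v z + shiftForm q μ v z)) - _ = _
  rw [covL]
  simp only [add_mul, sub_mul, mul_add, mul_sub]
  abel

/-- The connections of the deformed surface are gauge equivalent to those of the original one. -/
theorem dSpec_map (h : IsLocalIsometry U Λ q μ φ) (hq : IsConstrainedWillmoreOn U Λ q)
    (hU : IsOpen U) (hσ : IsNormalLift U Λ σ) {z : ℂ} (hz : z ∈ U) (hμ : μ ≠ 0)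
    {q' : ℂ → ℂ →ₗ[ℝ] Module.End ℂ (CV n)}
    (hq' : ∀ v, formL q' v z = cxL φ z * rot (μ ^ 2) (fun t => formL q t z) v * cxInvL φ z)
    {l : ℂ} (hl : l ≠ 0) {ξ : ℂ → CV n} (hξ : DifferentiableAt ℝ ξ z) (v : ℂ) :
    dSpec (mapLocal φ Λ) q' l (fun y => cxL φ y (ξ y)) z v =
      cxL φ z (dSpec Λ q (μ * l) ξ z v) := by
  have hΛ := hσ.isSurface hU
  have hd := h.differentiableAt_cxL hU hz
  -- Composing rotations produces the parameter `μ * l`. The subtracted form at `μ` is exactly what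
  -- differentiating `φ` adds back.
  have key : dSpecForm (mapLocal φ Λ) q' l v z = cxL φ z *
      (dSpecForm Λ q (μ * l) v z - dSpecForm Λ q μ v z) * cxInvL φ z := by
    simp only [dSpecForm, h.formNL_map hq hU hσ hz, hq', rot_conj]
    rw [rot_rot hl hμ fun v => formNL_I_mul_I_mul Λ z v,
      rot_rot (pow_ne_zero 2 hl) (pow_ne_zero 2 hμ) fun v => formL_I_mul_I_mul q z v, ← mul_pow,
      ← sub_mul, ← sub_mul, ← mul_sub, ← mul_sub, ← add_mul, ← mul_add]
    congr 2
    abel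
  rw [((h.normalLift_map hq hU hσ).isSurface hU).dSpec_apply hz q' l
    (differentiableAt_apply hd hξ), hΛ.dSpec_apply hz q _ hξ, fderiv_apply hd hξ,
    h.fderiv_cxL hΛ hz, key, ← EndC.mul_apply _ (cxL φ z), mul_assoc _ (cxInvL φ z),
    cxInvL_mul_cxL, mul_one, add_assoc, ← EndC.add_apply, ← mul_add, add_sub_cancel, map_add]
  rfl

end IsLocalIsometry

theorem inv_eq_star_of_norm_eq_one {l : ℂ} (hl : ‖l‖ = 1) : l⁻¹ = star l := by
  rw [Complex.inv_def, Complex.normSq_eq_norm_sq, hl]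
  simp

/-- For unit `l` this is the cosine of a real angle. With `star_sinL` it keeps the deformed form
real. -/
theorem star_cosL {l : ℂ} (hl : ‖l‖ = 1) : star (cosL l) = cosL l := by
  rw [cosL, inv_eq_star_of_norm_eq_one hl]
  simp [add_comm]

theorem star_sinL {l : ℂ} (hl : ‖l‖ = 1) : star (sinL l) = sinL l := by
  rw [sinL, inv_eq_star_of_norm_eq_one hl]
  simp only [Complex.star_def, map_div₀, map_mul, map_sub, Complex.conj_I, Complex.conj_conj,
    Complex.conj_ofNat]
  ring

theorem IsNormalLift.isConformalOn {n : ℕ} {U : Set ℂ} {Λ : ℂ → Submodule ℝ (RV n)}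
    {σ : ℂ → RV n} (h : IsNormalLift U Λ σ) (hU : IsOpen U) : IsConformalOn U Λ := by
  intro z hz
  refine ⟨?_, σ, h.isLiftAt hU hz, 1, one_pos, fun v w => by rw [h.metric z hz, one_mul]⟩
  intro u hu
  rw [h.span z hz, Submodule.mem_span_singleton] at hu
  obtain ⟨c, rfl⟩ := hu
  simp [h.null z hz]

/-! ### The constrained Willmore equations of the deformation -/

namespace IsLocalIsometry

variable {n : ℕ} {U : Set ℂ} {Λ : ℂ → Submodule ℝ (RV n)} {σ : ℂ → RV n}
  {q q' : ℂ → ℂ →ₗ[ℝ] Module.End ℂ (CV n)} {μ : ℂ} {φ : ℂ → RV n ≃ₗ[ℝ] RV n}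

theorem conj_mem_span (h : IsLocalIsometry U Λ q μ φ) (hq : IsConstrainedWillmoreOn U Λ q)
    (hU : IsOpen U) (hσ : IsNormalLift U Λ σ) {z : ℂ} (hz : z ∈ U) {A : Module.End ℂ (CV n)}
    (hA : A ∈ Submodule.span ℂ {A : Module.End ℂ (CV n) | ∃ u ∈ Λ z, ∃ w ∈ firstBundle Λ z,
      A = wedge (toC u) w}) :
    cx (φ z).toLinearMap ∘ₗ A ∘ₗ cx (φ z).symm.toLinearMap ∈
      Submodule.span ℂ {A : Module.End ℂ (CV n) | ∃ u ∈ mapLocal φ Λ z,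
        ∃ w ∈ firstBundle (mapLocal φ Λ) z, A = wedge (toC u) w} := by
  induction hA using Submodule.span_induction with
  | mem A hA =>
    obtain ⟨u, hu, w, hw, rfl⟩ := hA
    refine Submodule.subset_span ⟨φ z u, Submodule.mem_map_of_mem hu, cx (φ z).toLinearMap w, ?_, ?_⟩
    · rw [h.firstBundle_map hq hU hσ hz]
      exact Submodule.mem_map_of_mem hw
    · rw [cx_wedge (h.isometry z hz), cx_toC]
      rfl
  | zero => simp
  | add A B _ _ hA hB =>
    rw [LinearMap.add_comp, LinearMap.comp_add]
    exact Submodule.add_mem _ hA hB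
  | smul c A _ hA =>
    rw [LinearMap.smul_comp, LinearMap.comp_smul]
    exact Submodule.smul_mem _ c hA

theorem contDiffOn_rot (hq : IsConstrainedWillmoreOn U Λ q) (l v : ℂ) :
    ContDiffOn ℝ ∞ (fun y => rot l (fun t => formL q t y) v) U :=
  ((hq.contDiffOn_formL v).const_smul (cosL l)).add
    ((hq.contDiffOn_formL (Complex.I * v)).const_smul (sinL l))

theorem contDiffOn_formL_of_eq_conj (h : IsLocalIsometry U Λ q μ φ)
    (hq : IsConstrainedWillmoreOn U Λ q)
    (hq' : ∀ z ∈ U, ∀ v,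
      formL q' v z = cxL φ z * rot (μ ^ 2) (fun t => formL q t z) v * cxInvL φ z) (v : ℂ) : ContDiffOn ℝ ∞ (formL q' v) U :=
  ((h.contDiffOn_cxL.mul (contDiffOn_rot hq _ v)).mul h.contDiffOn_cxInvL).congr
    fun y hy => hq' y hy v

/-- The equation `d^𝒟 q = 0` for the spectral deformation. -/
theorem extD_formFun_eq_zero (h : IsLocalIsometry U Λ q μ φ)
    (hq : IsConstrainedWillmoreOn U Λ q) (hU : IsOpen U) (hσ : IsNormalLift U Λ σ)
    (hq' : ∀ z ∈ U, ∀ v,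
      formL q' v z = cxL φ z * rot (μ ^ 2) (fun t => formL q t z) v * cxInvL φ z)
    {z : ℂ} (hz : z ∈ U) (w : CV n) : extD (mapLocal φ Λ) (formFun q') z w = 0 := by
  have hΛ := hσ.isSurface hU
  have hΛ' := (h.normalLift_map hq hU hσ).isSurface hU
  have hdq : ∀ v, DifferentiableAt ℝ (formL q v) z := fun v =>
    differentiableAt_of_contDiffOn hU (hq.contDiffOn_formL v) hz
  have hrot := contDiffOn_rot hq (μ ^ 2)
  have hsm := h.contDiffOn_formL_of_eq_conj hq hq'
  have hev : ∀ v, formL q' v =ᶠ[nhds z]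
      fun y => cxL φ y * rot (μ ^ 2) (fun t => formL q t y) v * cxInvL φ y := by
    intro v
    filter_upwards [hU.mem_nhds hz] with y hy using hq' y hy v
  rw [hΛ'.extD_eq hz (α := formFun q') (β := formL q') (fun v y _ w => rfl)
    (fun v => differentiableAt_of_contDiffOn hU (hsm v) hz), covL_congr _ _ (hev _),
    covL_congr _ _ (hev _),
    h.covL_map hq hU hσ hz (differentiableAt_of_contDiffOn hU (hrot _) hz),
    h.covL_map hq hU hσ hz (differentiableAt_of_contDiffOn hU (hrot _) hz), ← sub_mul, ← mul_sub]
  have hcomm : ∀ v w, shiftForm q μ v z * rot (μ ^ 2) (fun t => formL q t z) w -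
      rot (μ ^ 2) (fun t => formL q t z) w * shiftForm q μ v z = 0 := by
    intro v w
    have hc := hq.formL_mul_comm hU hσ hz
    rw [sub_eq_zero]
    simp only [shiftForm, rot, mul_add, add_mul, mul_sub, sub_mul, smul_mul_assoc,
      mul_smul_comm, smul_add, smul_sub]
    rw [hc v w, hc (Complex.I * v) w, hc v (Complex.I * w), hc (Complex.I * v) (Complex.I * w)]
    module
  have hcl := hq.covL_closed hΛ hz
  have hco := hq.covL_coclosed hU hσ hz
  have e1 : ∀ v w, covL Λ v (fun y => rot (μ ^ 2) (fun t => formL q t y) w) z =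
      cosL (μ ^ 2) • covL Λ v (formL q w) z +
        sinL (μ ^ 2) • covL Λ v (formL q (Complex.I * w)) z := by
    intro v w
    have hd1 := (hdq w).fun_const_smul (cosL (μ ^ 2))
    have hd2 := (hdq (Complex.I * w)).fun_const_smul (sinL (μ ^ 2))
    simp only [rot]
    rw [covL_add Λ v hd1 hd2, covL_const_smul Λ v _ (hdq w),
      covL_const_smul Λ v _ (hdq (Complex.I * w))]
  have e2 : formL q (Complex.I * Complex.I) = fun y => -formL q 1 y := by
    funext y
    rw [Complex.I_mul_I, formL_neg]
  rw [hcomm, hcomm, e1, e1, mul_one, e2, covL_neg, add_zero, add_zero]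
  -- The derivative of the rotated form splits into the closedness and the coclosedness expression
  -- of `q`.
  have e3 : cosL (μ ^ 2) • covL Λ 1 (formL q Complex.I) z +
      sinL (μ ^ 2) • -covL Λ 1 (formL q 1) z -
      (cosL (μ ^ 2) • covL Λ Complex.I (formL q 1) z +
        sinL (μ ^ 2) • covL Λ Complex.I (formL q Complex.I) z) =
      cosL (μ ^ 2) • (covL Λ 1 (formL q Complex.I) z - covL Λ Complex.I (formL q 1) z) -
      sinL (μ ^ 2) • (covL Λ 1 (formL q 1) z + covL Λ Complex.I (formL q Complex.I) z) := by
    module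
  rw [e3, hcl, hco]
  simp

/-- The equation `d^𝒟 *𝒩 = 2 [q ∧ *𝒩]` for the spectral deformation. -/
theorem extD_hodge_formN (h : IsLocalIsometry U Λ q μ φ)
    (hq : IsConstrainedWillmoreOn U Λ q) (hU : IsOpen U) (hσ : IsNormalLift U Λ σ) (hμ0 : μ ≠ 0)
    (hq' : ∀ z ∈ U, ∀ v,
      formL q' v z = cxL φ z * rot (μ ^ 2) (fun t => formL q t z) v * cxInvL φ z)
    {z : ℂ} (hz : z ∈ U) (w : CV n) : extD (mapLocal φ Λ) (hodge (formN (mapLocal φ Λ))) z w =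
      (2 : ℂ) • bracketWedge (formFun q') (hodge (formN (mapLocal φ Λ))) z w := by
  have hΛ := hσ.isSurface hU
  have hΛ' := (h.normalLift_map hq hU hσ).isSurface hU
  have hdN := hΛ.differentiableAt_formNL hz
  have hrotN : ∀ v, DifferentiableAt ℝ (fun y => rot μ (fun t => formNL Λ t y) v) z := fun v =>
    ((hdN v).fun_const_smul (cosL μ)).fun_add ((hdN (Complex.I * v)).fun_const_smul (sinL μ))
  have hevN : ∀ v, formNL (mapLocal φ Λ) v =ᶠ[nhds z]
      fun y => cxL φ y * rot μ (fun t => formNL Λ t y) v * cxInvL φ y := by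
    intro v
    filter_upwards [hU.mem_nhds hz] with y hy using h.formNL_map hq hU hσ hy v
  -- Since `*𝒩` takes the values `-𝒩_y` and `𝒩_x` on `∂/∂x` and `∂/∂y`, its exterior derivative is
  -- the divergence of `𝒩`. A general `Λ'` covers both surfaces.
  have hex : ∀ {Λ' : ℂ → Submodule ℝ (RV n)}, IsSurface U Λ' → ∀ w,
      extD Λ' (hodge (formN Λ')) z w =
      (covL Λ' 1 (formNL Λ' 1) z + covL Λ' Complex.I (formNL Λ' Complex.I) z) w := by
    intro Λ' hΛ' w
    rw [hΛ'.extD_eq hz (α := hodge (formN Λ')) (β := fun v y => -formNL Λ' (Complex.I * v) y)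
      (fun v y hy w => by rw [hodge, hΛ'.formN_apply hy]; rfl)
      (fun v => (hΛ'.differentiableAt_formNL hz _).fun_neg)]
    have e2 : (fun y => -formNL Λ' (Complex.I * Complex.I) y) = formNL Λ' 1 := by
      funext y
      rw [Complex.I_mul_I, formNL_neg, neg_neg]
    rw [e2, covL_neg, mul_one, sub_neg_eq_add]
  have hbr : ∀ {Λ' : ℂ → Submodule ℝ (RV n)}, IsSurface U Λ' →
      ∀ (r : ℂ → ℂ →ₗ[ℝ] Module.End ℂ (CV n)) w,
      bracketWedge (formFun r) (hodge (formN Λ')) z w =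
      ((formL r 1 z * formNL Λ' 1 z - formNL Λ' 1 z * formL r 1 z) +
        (formL r Complex.I z * formNL Λ' Complex.I z -
          formNL Λ' Complex.I z * formL r Complex.I z)) w := by
    intro Λ' hΛ' r w
    simp only [bracketWedge, hodge, hΛ'.formN_apply hz, mul_one, Complex.I_mul_I, formNL_neg,
      EndC.neg_apply, neg_neg, formFun, EndC.add_apply, EndC.sub_apply, EndC.mul_apply,
      formL_apply, map_neg]
    abel
  have hW : covL Λ 1 (formNL Λ 1) z + covL Λ Complex.I (formNL Λ Complex.I) z =
      (2 : ℂ) • ((formL q 1 z * formNL Λ 1 z - formNL Λ 1 z * formL q 1 z) +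
        (formL q Complex.I z * formNL Λ Complex.I z -
          formNL Λ Complex.I z * formL q Complex.I z)) := by
    ext1 w
    rw [← hex hΛ, hq.willmore z hz, hbr hΛ]
    rfl
  rw [hex hΛ', hbr hΛ', hq' z hz, hq' z hz, h.formNL_map hq hU hσ hz, h.formNL_map hq hU hσ hz,
    covL_congr _ _ (hevN 1), covL_congr _ _ (hevN Complex.I), h.covL_map hq hU hσ hz (hrotN _),
    h.covL_map hq hU hσ hz (hrotN _), ← EndC.smul_apply]
  simp only [conj_mul_conj, ← sub_mul, ← mul_sub, ← add_mul, ← mul_add]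
  rw [← smul_mul_assoc, ← mul_smul_comm]
  congr 3
  have e1 : ∀ v w, covL Λ v (fun y => rot μ (fun t => formNL Λ t y) w) z =
      cosL μ • covL Λ v (formNL Λ w) z +
        sinL μ • covL Λ v (formNL Λ (Complex.I * w)) z := by
    intro v w
    simp only [rot]
    rw [covL_add Λ v ((hdN w).fun_const_smul (cosL μ))
      ((hdN (Complex.I * w)).fun_const_smul (sinL μ)), covL_const_smul Λ v _ (hdN w),
      covL_const_smul Λ v _ (hdN (Complex.I * w))]
  have e2 : formNL Λ (Complex.I * Complex.I) = fun y => -formNL Λ 1 y := by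
    funext y
    rw [Complex.I_mul_I, formNL_neg]
  -- The divergence of the rotated `𝒩` has a cosine term, given by the original Willmore equation,
  -- and a sine term, zero by Codazzi. An identity between commutators of values of `q` and `𝒩` is
  -- left, settled coefficientwise by `c1` and `c2`.
  have hcod := sub_eq_zero.1 (hΛ.codazzi hz 1 Complex.I)
  have hW' := eq_sub_of_add_eq hW
  have c1 := cosL_sq_mul_add hμ0
  have c2 := cosL_sq_mul_sub hμ0
  rw [e1, e1, mul_one, e2, covL_neg, hcod, hW']
  simp only [shiftForm, rot, mul_one, Complex.I_mul_I, formNL_neg, formL_neg]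
  generalize formL q 1 z = X
  generalize formL q Complex.I z = Y
  generalize formNL Λ 1 z = N
  generalize formNL Λ Complex.I z = K
  simp only [mul_add, add_mul, mul_sub, sub_mul, smul_mul_assoc, mul_smul_comm, mul_neg, neg_mul,
    smul_add, smul_sub, smul_neg]
  match_scalars <;> first
    | ring1
    | linear_combination c1
    | linear_combination -c1
    | linear_combination c2
    | linear_combination -c2

/-- The spectral deformation of a constrained Willmore surface in a coordinate. -/
theorem isConstrainedWillmoreOn (h : IsLocalIsometry U Λ q μ φ)
    (hq : IsConstrainedWillmoreOn U Λ q) (hU : IsOpen U) (hσ : IsNormalLift U Λ σ) (hμ : ‖μ‖ = 1)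
    (hq' : ∀ z ∈ U, ∀ v,
      formL q' v z = cxL φ z * rot (μ ^ 2) (fun t => formL q t z) v * cxInvL φ z) :
    IsConstrainedWillmoreOn U (mapLocal φ Λ) q' := by
  have hσ' := h.normalLift_map hq hU hσ
  have hμ0 : μ ≠ 0 := by
    rintro rfl
    simp at hμ
  refine ⟨hσ'.isConformalOn hU, fun v w => ?_, ?_, ?_,
    fun z hz w => h.extD_formFun_eq_zero hq hU hσ hq' hz w,
    fun z hz w => h.extD_hodge_formN hq hU hσ hμ0 hq' hz w⟩
  · exact contDiffOn_apply (h.contDiffOn_formL_of_eq_conj hq hq' v) contDiffOn_const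
  · intro z hz v w
    have h1 : ∀ w, q' z v w = cx (φ z).toLinearMap (cosL (μ ^ 2) •
        q z v (cx (φ z).symm.toLinearMap w) +
        sinL (μ ^ 2) • q z (Complex.I * v) (cx (φ z).symm.toLinearMap w)) := fun w =>
      congrArg (fun T : EndC n => T w) (hq' z hz v)
    have hμ2 : ‖μ ^ 2‖ = 1 := by rw [norm_pow, hμ, one_pow]
    rw [h1, h1, cx_star, hq.real z hz, hq.real z hz, ← cx_star, star_add, star_smul, star_smul,
      star_cosL hμ2, star_sinL hμ2]
  · intro z hz v
    have h1 : q' z v = cx (φ z).toLinearMap ∘ₗ (cosL (μ ^ 2) • q z v +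
        sinL (μ ^ 2) • q z (Complex.I * v)) ∘ₗ cx (φ z).symm.toLinearMap :=
      LinearMap.ext fun w => congrArg (fun T : EndC n => T w) (hq' z hz v)
    rw [h1]
    exact h.conj_mem_span hq hU hσ hz (Submodule.add_mem _
      (Submodule.smul_mem _ _ (hq.values z hz v)) (Submodule.smul_mem _ _ (hq.values z hz _)))

end IsLocalIsometry

/-! ### The spectral deformation on a Riemann surface -/

section Charts

variable {M : Type*} [TopologicalSpace M] [ChartedSpace ℂ M] [IsManifold 𝓘(ℂ, ℂ) ω M]

/-- A Riemann surface is a smooth real surface. -/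
theorem isManifold_real : IsManifold 𝓘(ℝ, ℂ) ∞ M := by
  refine isManifold_of_contDiffOn _ _ _ fun e e' he he' => ?_
  have h := (contDiffGroupoid ω 𝓘(ℂ, ℂ)).compatible he he'
  rw [contDiffGroupoid, mem_groupoid_of_pregroupoid] at h
  have h1 : ContDiffOn ℂ ω (e.symm ≫ₕ e') (e.symm ≫ₕ e').source := by
    simpa [contDiffPregroupoid] using h.1
  have h2 := (h1.restrict_scalars ℝ).of_le (le_top : (∞ : ℕ∞ω) ≤ ω)
  simpa using h2

theorem contMDiffOn_chart_symm {e : OpenPartialHomeomorph M ℂ} (he : e ∈ atlas ℂ M) :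
    ContMDiffOn 𝓘(ℝ, ℂ) 𝓘(ℝ, ℂ) ∞ e.symm e.target := by
  have : IsManifold 𝓘(ℝ, ℂ) ∞ M := isManifold_real
  exact contMDiffOn_symm_of_mem_maximalAtlas (IsManifold.subset_maximalAtlas he)

theorem contDiffOn_comp_chart_symm {F : Type*} [NormedAddCommGroup F] [NormedSpace ℝ F] {f : M → F}
    (hf : ContMDiff 𝓘(ℝ, ℂ) 𝓘(ℝ, F) ∞ f) {e : OpenPartialHomeomorph M ℂ} (he : e ∈ atlas ℂ M) :
    ContDiffOn ℝ ∞ (fun z => f (e.symm z)) e.target :=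
  (hf.comp_contMDiffOn (contMDiffOn_chart_symm he)).contDiffOn

/-- The differential of the inverse of a holomorphic chart is complex linear. -/
theorem mfderiv_chart_symm_I_mul {e : OpenPartialHomeomorph M ℂ} (he : e ∈ atlas ℂ M) {z : ℂ}
    (hz : z ∈ e.target) (v : ℂ) :
    mfderiv 𝓘(ℝ, ℂ) 𝓘(ℝ, ℂ) e.symm z (Complex.I * v : ℂ) =
      tangentJ (e.symm z) (mfderiv 𝓘(ℝ, ℂ) 𝓘(ℝ, ℂ) e.symm z v) := by
  have h1 : MDifferentiableAt 𝓘(ℂ, ℂ) 𝓘(ℂ, ℂ) e.symm z :=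
    ((contMDiffOn_symm_of_mem_maximalAtlas (I := 𝓘(ℂ, ℂ)) (n := ω)
      (IsManifold.subset_maximalAtlas he)).contMDiffAt
        (e.open_target.mem_nhds hz)).mdifferentiableAt (by simp)
  have h2 := h1.hasMFDerivAt
  set f' : ℂ →L[ℂ] ℂ := mfderiv 𝓘(ℂ, ℂ) 𝓘(ℂ, ℂ) e.symm z with hf'
  -- The real differential is the complex one with scalars restricted, hence commutes with `i`.
  have h3 : HasMFDerivAt 𝓘(ℝ, ℂ) 𝓘(ℝ, ℂ) e.symm z (f'.restrictScalars ℝ) :=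
    ⟨h2.1, HasFDerivWithinAt.restrictScalars ℝ h2.2⟩
  rw [h3.mfderiv]
  exact f'.map_smul Complex.I v

variable {n : ℕ}

/-- Types of one-forms are preserved by holomorphic charts, so `q_μ`, defined through `tangentJ`,
pulls back to the rotation by `μ²` in the coordinate. -/
theorem pullForm_spectral {q : EndForm n M} {φ : M → RV n ≃ₗ[ℝ] RV n} {μ : ℂ}
    {e : OpenPartialHomeomorph M ℂ} (he : e ∈ atlas ℂ M) {z : ℂ} (hz : z ∈ e.target) (v : ℂ) :
    formL (pullForm (adForm φ (spectralForm μ q)) e) v z =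
      cxL (fun y => φ (e.symm y)) z * rot (μ ^ 2) (fun t => formL (pullForm q e) t z) v *
        cxInvL (fun y => φ (e.symm y)) z := by
  have h1 : spectralForm μ q (e.symm z) (mfderiv 𝓘(ℝ, ℂ) 𝓘(ℝ, ℂ) e.symm z v) =
      rot (μ ^ 2) (pullForm q e z) v := by
    rw [← part_eq_rot]
    have hJ := mfderiv_chart_symm_I_mul he hz v
    have h2 : pullForm q e z (mulI v) =
        q (e.symm z) (tangentJ (e.symm z) (mfderiv 𝓘(ℝ, ℂ) 𝓘(ℝ, ℂ) e.symm z v)) :=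
      congrArg (q (e.symm z)) hJ
    simp only [spectralForm, part10, part01, LinearMap.add_apply, LinearMap.smul_apply,
      LinearMap.sub_apply, LinearMap.comp_apply, h2, inv_pow]
    rfl
  ext1 w
  have h3 : pullForm (adForm φ (spectralForm μ q)) e z v w =
      cx (φ (e.symm z)).toLinearMap
        (spectralForm μ q (e.symm z) (mfderiv 𝓘(ℝ, ℂ) 𝓘(ℝ, ℂ) e.symm z v)
          (cx (φ (e.symm z)).symm.toLinearMap w)) := rfl
  rw [formL_apply, h3, h1]
  rfl

theorem IsConnectionIsometry.isLocalIsometry {Λ : M → Submodule ℝ (RV n)} {q : EndForm n M}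
    {μ : ℂ} {φ : M → RV n ≃ₗ[ℝ] RV n} (h : IsConnectionIsometry Λ q μ φ)
    {e : OpenPartialHomeomorph M ℂ} (he : e ∈ atlas ℂ M) :
    IsLocalIsometry e.target (fun y => Λ (e.symm y)) (pullForm q e) μ
      (fun y => φ (e.symm y)) where
  smooth w := contDiffOn_comp_chart_symm (h.smooth w) he
  isometry _ _ := h.isometry _
  intertwines w z hz v := h.intertwines (fun _ => w) contMDiff_const e he z hz v

end Charts

/-! ### Conserved quantities and the global statements -/

section Global

variable {n : ℕ} {M : Type*}

theorem evalL_spectralPoly (d : ℕ) (p : ℤ → M → CV n) (μ : ℂ) (φ : M → RV n ≃ₗ[ℝ] RV n) (l : ℂ)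
    (x : M) :
    evalL d (spectralPoly μ φ p) l x = cx (φ x).toLinearMap (evalL d p (μ * l) x) := by
  simp only [evalL, spectralPoly, map_sum, map_smul, mul_zpow, smul_smul]
  exact Finset.sum_congr rfl fun k _ => by rw [mul_comm]

variable [TopologicalSpace M] [ChartedSpace ℂ M]

theorem contMDiff_spectralPoly {p : ℤ → M → CV n} {φ : M → RV n ≃ₗ[ℝ] RV n} (μ : ℂ) {k : ℤ}
    (hp : ContMDiff 𝓘(ℝ, ℂ) 𝓘(ℝ, CV n) ∞ (p k))
    (hφ : ∀ w : RV n, ContMDiff 𝓘(ℝ, ℂ) 𝓘(ℝ, RV n) ∞ (fun x => φ x w)) :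
    ContMDiff 𝓘(ℝ, ℂ) 𝓘(ℝ, CV n) ∞ (spectralPoly μ φ p k) := by
  -- The section is a fixed smooth function of the columns of `φ` and of `p_k`.
  let G : (Fin (n + 2) → RV n) × CV n → CV n := fun a => μ ^ k • ∑ j, a.2 j • toC (a.1 j)
  have hG : ContDiff ℝ ∞ G := by
    have h1 : ∀ j, ContDiff ℝ ∞ fun a : (Fin (n + 2) → RV n) × CV n => toC (a.1 j) := fun j =>
      (toCL n).contDiff.comp ((contDiff_apply ℝ (RV n) j).comp contDiff_fst)
    have h2 : ∀ j, ContDiff ℝ ∞ fun a : (Fin (n + 2) → RV n) × CV n => a.2 j := fun j =>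
      (contDiff_apply ℝ ℂ j).comp contDiff_snd
    exact (ContDiff.sum fun j _ => (h2 j).smul (h1 j)).const_smul (μ ^ k)
  have h3 : spectralPoly μ φ p k = G ∘ fun x => (fun j => φ x (Pi.single j 1), p k x) := by
    funext x
    simp only [spectralPoly, G, Function.comp]
    congr 1
    conv_lhs => rw [pi_eq_sum_univ' (p k x)]
    simp only [map_sum, map_smul]
    refine Finset.sum_congr rfl fun j _ => ?_
    have : (Pi.single j 1 : CV n) = toC (Pi.single j 1) := by
      ext i
      by_cases hij : i = j
      · subst hij; simp [toC]
      · simp [toC, hij]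
    congr 1
    rw [this]
    exact cx_toC _ _
  rw [h3]
  exact hG.contMDiff.comp ((contMDiff_pi_space.2 fun j => hφ _).prodMk_space hp)

variable [IsManifold 𝓘(ℂ, ℂ) ω M] {Λ : M → Submodule ℝ (RV n)} {q : EndForm n M} {μ : ℂ}
  {φ : M → RV n ≃ₗ[ℝ] RV n}

theorem IsConstrainedWillmore.spectral (hΛ : IsConstrainedWillmore Λ q)
    (hμ : ‖μ‖ = 1) (hφ : IsConnectionIsometry Λ q μ φ) :
    IsConstrainedWillmore (mapBundle φ Λ) (adForm φ (spectralForm μ q)) := by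
  intro e he
  obtain ⟨σ, hσ⟩ := (hΛ e he).conformal.exists_normalLift e.open_target
  exact (hφ.isLocalIsometry he).isConstrainedWillmoreOn (hΛ e he) e.open_target hσ hμ
    fun z hz v => pullForm_spectral he hz v

theorem IsPCQ.spectral (hΛ : IsConstrainedWillmore Λ q) {d : ℕ} {p : ℤ → M → CV n}
    (hp : IsPCQ Λ q d p) (hμ : ‖μ‖ = 1) (hφ : IsConnectionIsometry Λ q μ φ)
    (hpμ : evalL d p μ ≠ 0) :
    IsPCQ (mapBundle φ Λ) (adForm φ (spectralForm μ q)) d (spectralPoly μ φ p) := by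
  have hμ0 : μ ≠ 0 := by
    rintro rfl
    simp at hμ
  have hS : ∀ e ∈ atlas ℂ M, ∀ z ∈ e.target,
      centralSphere (fun y => mapBundle φ Λ (e.symm y)) z =
        (centralSphere (fun y => Λ (e.symm y)) z).map (cx (φ (e.symm z)).toLinearMap) := by
    intro e he z hz
    obtain ⟨σ, hσ⟩ := (hΛ e he).conformal.exists_normalLift e.open_target
    exact (hφ.isLocalIsometry he).centralSphere_map (hΛ e he) e.open_target hσ hz
  have hperp : ∀ k, ∀ e ∈ atlas ℂ M, ∀ z ∈ e.target,
      p k (e.symm z) ∈ perp (centralSphere (fun y => Λ (e.symm y)) z) →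
      spectralPoly μ φ p k (e.symm z) ∈
        perp (centralSphere (fun y => mapBundle φ Λ (e.symm y)) z) := by
    intro k e he z hz hk
    rw [hS e he z hz]
    exact Submodule.smul_mem _ _ ((hφ.isLocalIsometry he).perp_map hz hk)
  refine ⟨?_, ?_, ?_, ?_, ?_, ?_, ?_, ?_⟩
  · intro k hk
    funext x
    simp [spectralPoly, hp.degree k hk]
  · intro k
    exact contMDiff_spectralPoly μ (hp.smooth k) hφ.smooth
  · intro k x
    -- On the unit circle the conjugate of `μ^k` is `μ^{-k}`.
    rw [spectralPoly, spectralPoly, hp.real, star_smul, cx_star, star_zpow₀,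
      ← inv_eq_star_of_norm_eq_one hμ, inv_zpow']
  · intro e he z hz
    exact hperp _ e he z hz (hp.top e he z hz)
  · intro k hk e he z hz
    exact hperp _ e he z hz (hp.same_parity k hk e he z hz)
  · intro k hk e he z hz
    rw [hS e he z hz]
    exact Submodule.smul_mem _ _ (Submodule.mem_map_of_mem (hp.other_parity k hk e he z hz))
  -- The new polynomial at `1` is `φ p(μ)`, and `φ` is injective on each fibre.
  · intro h0
    apply hpμ
    funext x
    have h1 := congrFun h0 x
    rw [evalL_spectralPoly, mul_one] at h1
    rw [← cx_symm_apply (φ x) (evalL d p μ x), h1]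
    simp
  · intro l hl e he z hz
    obtain ⟨σ, hσ⟩ := (hΛ e he).conformal.exists_normalLift e.open_target
    have hξ : DifferentiableAt ℝ (fun y => evalL d p (μ * l) (e.symm y)) z := by
      refine differentiableAt_of_contDiffOn e.open_target ?_ hz
      have h1 : ∀ k, ContDiffOn ℝ ∞ (fun y => (μ * l) ^ k • p k (e.symm y)) e.target := fun k =>
        (contDiffOn_comp_chart_symm (hp.smooth k) he).const_smul ((μ * l) ^ k)
      exact ContDiffOn.sum fun k _ => h1 k
    have h2 : (fun y => evalL d (spectralPoly μ φ p) l (e.symm y)) =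
        fun y => cxL (fun y => φ (e.symm y)) y (evalL d p (μ * l) (e.symm y)) :=
      funext fun y => evalL_spectralPoly d p μ φ l (e.symm y)
    refine LinearMap.ext fun v => ?_
    rw [h2]
    refine ((hφ.isLocalIsometry he).dSpec_map (hΛ e he) e.open_target hσ hz hμ0
      (fun v => pullForm_spectral he hz v) hl hξ v).trans ?_
    rw [hp.parallel (μ * l) (mul_ne_zero hμ0 hl) e he z hz]
    simp

end Global

end CWillmore

theorem mainTheorem4 {n : ℕ} (hn : 3 ≤ n) {M : Type*} [TopologicalSpace M] [ChartedSpace ℂ M]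
    [IsManifold 𝓘(ℂ, ℂ) ω M]
    (Λ : M → Submodule ℝ (RV n)) (q : EndForm n M) (hΛ : IsConstrainedWillmore Λ q)
    (d : ℕ) (p : ℤ → M → CV n) (hp : IsPCQ Λ q d p)
    (μ : ℂ) (hμ : ‖μ‖ = 1)
    (φ : M → RV n ≃ₗ[ℝ] RV n) (hφ : IsConnectionIsometry Λ q μ φ)
    (hpμ : evalL d p μ ≠ 0) :
    IsConstrainedWillmore (mapBundle φ Λ) (adForm φ (spectralForm μ q)) ∧
    IsPCQ (mapBundle φ Λ) (adForm φ (spectralForm μ q)) d (spectralPoly μ φ p) ∧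
    ∀ (l : ℂ) (x : M),
      evalL d (spectralPoly μ φ p) l x = cx (φ x).toLinearMap (evalL d p (μ * l) x) :=
  ⟨hΛ.spectral hμ hφ, hp.spectral hΛ hμ hφ hpμ, evalL_spectralPoly d p μ φ⟩
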